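/- Let $n\ge 2$ and let $G$ be any (finite-dimensional real) Lie group. Let $SO(n)$ act on the unit sphere $S^n\subset\mathbb R^{n+1}$ by orthogonal transformations fixing the last coordinate, and regard $SO(n-1)$ as the subgroup of $SO(n)$ fixing the last coordinate of $\mathbb R^n$. An $SO(n)$-equivariant principal $G$-bundle over $S^n$ is a smooth principal $G$-bundle $p\colon E\to S^n$ ($G$ acting on $E$ from the right) together with a smooth left action of $SO(n)$ on $E$ which commutes with the action of $G$ and for which $p$ is equivariant. Two such bundles are isomorphic if there is an $SO(n)$- and $G$-equivariant diffeomorphism between their total spaces which commutes with the projections to $S^n$; let $\mathcal E(n,G)$ be the set of isomorphism classes. Let $\mathcal R(n,G)$ be the set of smooth homomorphisms $SO(n)\to G$ modulo conjugation by elements of $G$, and let $\mathrm{Res}\colon\mathcal R(n,G)\to\mathcal R(n-1,G)$ be the map induced by restriction to $SO(n-1)$. For a bundle $\xi$ as above choose $a,b\in E$ with $p(a)=(0,\dots,0,-1)$ and $p(b)=(0,\dots,0,1)$; the formulae $A\cdot a=a\cdot\alpha(A)$ and $A\cdot b=b\cdot\beta(A)$ for $A\in SO(n)$ determine smooth homomorphisms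 $\alpha,\beta\colon SO(n)\to G$ whose conjugacy classes depend only on the isomorphism class of $\xi$. This defines the isotropy map $J\colon\mathcal E(n,G)\to\mathcal R(n,G)\times\mathcal R(n,G)$, $J([\xi])=([\alpha],[\beta])$. For a homomorphism $\varphi$ with values in $G$ let $Z_\varphi\subset G$ be the centralizer of its image. Theorem B. (i) The image of $J$ is the set of all pairs $([\alpha],[\beta])\in\mathcal R(n,G)\times\mathcal R(n,G)$ such that $\mathrm{Res}[\alpha]=\mathrm{Res}[\beta]$. (ii) Let $\alpha,\beta\colon SO(n)\to G$ be smooth homomorphisms with $\alpha|_{SO(n-1)}=\beta|_{SO(n-1)}=:\gamma$. Then $J^{-1}([\alpha],[\beta])$ is in bijection with the set of double cosets $\pi_0(Z_\alpha)\backslash\pi_0(Z_\gamma)/\pi_0(Z_\beta)$, where $\pi_0(Z_\alpha)$ and $\pi_0(Z_\beta)$ act on the group $\pi_0(Z_\gamma)$ through the homomorphisms induced by the inclusions $Z_\alpha\subset Z_\gamma$ and $Z_\beta\subset Z_\gamma$. -/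

import Mathlib

open scoped Manifold ContDiff

noncomputable section

open Matrix
open scoped Matrix RightActions

/-! ### The Lie group `SO(n)` and its smooth structure -/

/-- The special orthogonal group `SO(n)` of real `n × n` matrices. -/
abbrev SO (n : ℕ) : Type := Matrix.specialOrthogonalGroup (Fin n) ℝ

namespace SO

variable {n : ℕ}

theorem mul_transpose (A : SO n) : A.1 * A.1ᵀ = 1 :=
  (Matrix.mem_orthogonalGroup_iff _ _).1 (Matrix.mem_specialOrthogonalGroup_iff.1 A.2).1

theorem transpose_mul (A : SO n) : A.1ᵀ * A.1 = 1 :=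
  (Matrix.mem_orthogonalGroup_iff' _ _).1 (Matrix.mem_specialOrthogonalGroup_iff.1 A.2).1

theorem det_eq_one (A : SO n) : A.1.det = 1 :=
  (Matrix.mem_specialOrthogonalGroup_iff.1 A.2).2

/-- Build an element of `SO(n)` from an explicit matrix. -/
def ofMatrix (M : Matrix (Fin n) (Fin n) ℝ) (h : Mᵀ * M = 1) (hd : M.det = 1) : SO n :=
  ⟨M, Matrix.mem_specialOrthogonalGroup_iff.2 ⟨(Matrix.mem_orthogonalGroup_iff' _ _).2 h, hd⟩⟩

theorem coe_inv (A : SO n) : (A⁻¹).1 = A.1ᵀ := rfl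

/-- The model space of `SO(n)`: the entries above the diagonal of a skew-symmetric matrix. -/
abbrev Coord (n : ℕ) := {p : Fin n × Fin n // p.1 < p.2} → ℝ

/-- The skew-symmetric matrix with prescribed entries above the diagonal. -/
def skew (x : Coord n) : Matrix (Fin n) (Fin n) ℝ := Matrix.of fun i j =>
  if h : i < j then x ⟨(i, j), h⟩ else if h : j < i then -x ⟨(j, i), h⟩ else 0

/-- The entries of a matrix above the diagonal. -/
def upper (M : Matrix (Fin n) (Fin n) ℝ) : Coord n := fun p => M p.1.1 p.1.2

/-- The Cayley transform `M ↦ (1 - M)(1 + M)⁻¹`. -/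
def cayley (M : Matrix (Fin n) (Fin n) ℝ) : Matrix (Fin n) (Fin n) ℝ := (1 - M) * (1 + M)⁻¹

theorem skew_transpose (x : Coord n) : (skew x)ᵀ = -skew x := by
  ext i j
  simp only [skew, Matrix.transpose_apply, Matrix.of_apply, Matrix.neg_apply]
  rcases lt_trichotomy i j with h | h | h
  · simp [h, h.not_gt]
  · subst h; simp
  · simp [h, h.not_gt]

theorem upper_skew (x : Coord n) : upper (skew x) = x := by
  funext p
  obtain ⟨⟨i, j⟩, h⟩ := p
  have h' : i < j := h
  simp [upper, skew, h']

theorem skew_upper {M : Matrix (Fin n) (Fin n) ℝ} (hM : Mᵀ = -M) : skew (upper M) = M := by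
  have key : ∀ i j, M j i = -M i j := fun i j => by
    simpa using congrFun (congrFun hM i) j
  ext i j
  simp only [skew, upper, Matrix.of_apply]
  rcases lt_trichotomy i j with h | h | h
  · simp [h]
  · subst h
    have := key i i
    simp; linarith
  · simp [h, h.not_gt, key i j]

theorem isUnit_det_one_add_of_skew {X : Matrix (Fin n) (Fin n) ℝ} (hX : Xᵀ = -X) :
    IsUnit (1 + X).det := by
  rw [isUnit_iff_ne_zero]
  intro h
  obtain ⟨v, hv, h0⟩ := Matrix.exists_mulVec_eq_zero_iff.2 h
  have h1 : v ⬝ᵥ (X *ᵥ v) = 0 := by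
    have : v ⬝ᵥ (X *ᵥ v) = -(v ⬝ᵥ (X *ᵥ v)) := by
      conv_lhs => rw [Matrix.dotProduct_mulVec, ← Matrix.mulVec_transpose, hX, dotProduct_comm]
      simp [Matrix.neg_mulVec]
    linarith
  have h2 : v ⬝ᵥ ((1 + X) *ᵥ v) = 0 := by rw [h0]; simp
  rw [Matrix.add_mulVec, Matrix.one_mulVec, dotProduct_add, h1, add_zero] at h2
  exact hv (dotProduct_self_eq_zero.1 h2)

theorem one_add_cayley {M : Matrix (Fin n) (Fin n) ℝ} (h : IsUnit (1 + M).det) :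
    1 + cayley M = (2 : ℝ) • (1 + M)⁻¹ := by
  have : 1 = (1 + M) * (1 + M)⁻¹ := (Matrix.mul_nonsing_inv _ h).symm
  rw [cayley, two_smul]
  nth_rewrite 1 [this]
  rw [← add_mul]
  have : (1 + M + (1 - M)) = 1 + 1 := by abel
  rw [this, add_mul, one_mul]

theorem isUnit_det_one_add_cayley {M : Matrix (Fin n) (Fin n) ℝ} (h : IsUnit (1 + M).det) :
    IsUnit (1 + cayley M).det := by
  rw [one_add_cayley h, Matrix.det_smul]
  exact (IsUnit.pow _ (by norm_num)).mul (Matrix.isUnit_nonsing_inv_det _ h)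

theorem cayley_cayley {M : Matrix (Fin n) (Fin n) ℝ} (h : IsUnit (1 + M).det) :
    cayley (cayley M) = M := by
  have h1 : (1 : Matrix (Fin n) (Fin n) ℝ) - cayley M = (2 : ℝ) • (M * (1 + M)⁻¹) := by
    have : 1 = (1 + M) * (1 + M)⁻¹ := (Matrix.mul_nonsing_inv _ h).symm
    rw [cayley, two_smul]
    nth_rewrite 1 [this]
    rw [← sub_mul, ← add_mul]
    congr 1
    abel
  have h2 : (1 + cayley M)⁻¹ = (2⁻¹ : ℝ) • (1 + M) := by
    apply Matrix.inv_eq_right_inv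
    rw [one_add_cayley h, smul_mul_smul_comm, Matrix.nonsing_inv_mul _ h]
    norm_num
  rw [cayley, h2, h1, smul_mul_smul_comm, mul_assoc, Matrix.nonsing_inv_mul _ h]
  norm_num

theorem cayley_transpose (A : SO n) (h : IsUnit (1 + A.1).det) :
    (cayley A.1)ᵀ = -cayley A.1 := by
  have ht : IsUnit (1 + A.1ᵀ).det := by
    rw [← Matrix.det_transpose]; simpa using h
  have key : (1 - A.1ᵀ) * (1 + A.1) = -((1 + A.1ᵀ) * (1 - A.1)) := by
    have := transpose_mul A
    rw [sub_mul, mul_add, mul_add, add_mul, mul_sub, mul_sub, this]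
    simp only [one_mul, mul_one]
    abel
  rw [cayley, Matrix.transpose_mul, Matrix.transpose_nonsing_inv]
  simp only [Matrix.transpose_add, Matrix.transpose_sub, Matrix.transpose_one]
  calc (1 + A.1ᵀ)⁻¹ * (1 - A.1ᵀ)
      = (1 + A.1ᵀ)⁻¹ * ((1 - A.1ᵀ) * (1 + A.1)) * (1 + A.1)⁻¹ := by
        rw [mul_assoc, mul_assoc, Matrix.mul_nonsing_inv _ h, mul_one]
    _ = -((1 - A.1) * (1 + A.1)⁻¹) := by
        rw [key, mul_neg, ← mul_assoc, Matrix.nonsing_inv_mul _ ht, one_mul, neg_mul]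

/-- The Cayley transform of a skew-symmetric matrix, as a rotation. -/
def ofCoord (x : Coord n) : SO n :=
  ofMatrix (cayley (skew x))
    (by
      have hX := skew_transpose x
      have h := isUnit_det_one_add_of_skew hX
      have h' : IsUnit (1 - skew x).det := by
        have := (Matrix.det_transpose (1 + skew x)).symm
        rw [Matrix.transpose_add, Matrix.transpose_one, hX, ← sub_eq_add_neg] at this
        rwa [← this]
      rw [cayley, Matrix.transpose_mul, Matrix.transpose_nonsing_inv]
      simp only [Matrix.transpose_add, Matrix.transpose_sub, Matrix.transpose_one, hX]
      have hc : (1 - -skew x) * (1 - skew x) = (1 - skew x) * (1 + skew x) := by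
        noncomm_ring
      rw [← sub_eq_add_neg, mul_assoc, ← mul_assoc (1 - -skew x), hc, mul_assoc (1 - skew x),
        Matrix.mul_nonsing_inv _ h, mul_one, Matrix.nonsing_inv_mul _ h'])
    (by
      have hX := skew_transpose x
      have h := isUnit_det_one_add_of_skew hX
      have := (Matrix.det_transpose (1 + skew x)).symm
      rw [Matrix.transpose_add, Matrix.transpose_one, hX, ← sub_eq_add_neg] at this
      rw [cayley, Matrix.det_mul, Matrix.det_nonsing_inv, ← this]
      exact Ring.mul_inverse_cancel _ h)

theorem continuousOn_cayley {X : Type*} [TopologicalSpace X] {s : Set X}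
    {f : X → Matrix (Fin n) (Fin n) ℝ} (hf : ContinuousOn f s)
    (h : ∀ x ∈ s, IsUnit (1 + f x).det) : ContinuousOn (fun x => cayley (f x)) s := by
  rw [continuousOn_iff_continuous_domRestrict] at hf ⊢
  have h1 : Continuous fun x : s => (1 + f x : Matrix (Fin n) (Fin n) ℝ) := continuous_const.add hf
  have h2 : Continuous fun x : s => (1 + f x)⁻¹ := by
    simp only [Matrix.inv_def, Ring.inverse_eq_inv']
    exact (h1.matrix_det.inv₀ fun x => (h x x.2).ne_zero).smul h1.matrix_adjugate
  exact (continuous_const.sub hf).matrix_mul h2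

/-- The Cayley chart around the identity of `SO(n)`. -/
def cayleyChart (n : ℕ) : OpenPartialHomeomorph (SO n) (Coord n) where
  toFun A := upper (cayley A.1)
  invFun := ofCoord
  source := {A | (1 + A.1).det ≠ 0}
  target := Set.univ
  map_source' _ _ := Set.mem_univ _
  map_target' x _ :=
    (isUnit_det_one_add_cayley (isUnit_det_one_add_of_skew (skew_transpose x))).ne_zero
  left_inv' A hA := by
    have h : IsUnit (1 + A.1).det := isUnit_iff_ne_zero.2 hA
    apply Subtype.ext
    change cayley (skew (upper (cayley A.1))) = A.1
    rw [skew_upper (cayley_transpose A h), cayley_cayley h]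
  right_inv' x _ := by
    change upper (cayley (cayley (skew x))) = x
    rw [cayley_cayley (isUnit_det_one_add_of_skew (skew_transpose x)), upper_skew]
  open_source := by
    have : Continuous fun A : SO n => (1 + A.1).det :=
      (continuous_const.add continuous_subtype_val).matrix_det
    exact isOpen_ne_fun this continuous_const
  open_target := isOpen_univ
  continuousOn_toFun := by
    have := continuousOn_cayley (s := {A : SO n | (1 + A.1).det ≠ 0})
      continuous_subtype_val.continuousOn (fun A hA => isUnit_iff_ne_zero.2 hA)
    refine continuousOn_pi.2 fun p => ?_
    exact (continuous_apply_apply p.1.1 p.1.2).comp_continuousOn this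
  continuousOn_invFun := by
    have hs : Continuous (skew : Coord n → Matrix (Fin n) (Fin n) ℝ) := by
      refine continuous_matrix fun i j => ?_
      simp only [skew, Matrix.of_apply]
      split_ifs <;> fun_prop
    refine Topology.IsInducing.subtypeVal.continuousOn_iff.2 ?_
    exact continuousOn_cayley hs.continuousOn
      (fun x _ => isUnit_det_one_add_of_skew (skew_transpose x))

/-- The smooth atlas of `SO(n)`: left translates of the Cayley chart. -/
instance instChartedSpace (n : ℕ) : ChartedSpace (Coord n) (SO n) where
  atlas := Set.range fun B : SO n => (Homeomorph.mulLeft B⁻¹).transOpenPartialHomeomorph (cayleyChart n)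
  chartAt B := (Homeomorph.mulLeft B⁻¹).transOpenPartialHomeomorph (cayleyChart n)
  mem_chart_source B := by
    change (1 + (B⁻¹ * B : SO n).1).det ≠ 0
    rw [inv_mul_cancel]
    change ((1 : Matrix (Fin n) (Fin n) ℝ) + 1).det ≠ 0
    rw [← two_smul ℝ (1 : Matrix (Fin n) (Fin n) ℝ), Matrix.det_smul, Matrix.det_one, mul_one]
    positivity
  chart_mem_atlas B := ⟨B, rfl⟩


section Smooth

variable {E H M : Type*} [NormedAddCommGroup E] [NormedSpace ℝ E] [TopologicalSpace H]
  {I : ModelWithCorners ℝ E H} [TopologicalSpace M] [ChartedSpace H M] {k : ℕ∞ω} {x : M}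

theorem contMDiffAt_matrix_mul {F F' : M → Matrix (Fin n) (Fin n) ℝ}
    (hF : ∀ i j, ContMDiffAt I 𝓘(ℝ, ℝ) k (fun y => F y i j) x)
    (hF' : ∀ i j, ContMDiffAt I 𝓘(ℝ, ℝ) k (fun y => F' y i j) x) (i j : Fin n) :
    ContMDiffAt I 𝓘(ℝ, ℝ) k (fun y => (F y * F' y) i j) x := by
  simp only [Matrix.mul_apply]
  exact ContMDiffAt.sum fun l _ => (hF i l).mul (hF' l j)

theorem contMDiffAt_matrix_det {F : M → Matrix (Fin n) (Fin n) ℝ}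
    (hF : ∀ i j, ContMDiffAt I 𝓘(ℝ, ℝ) k (fun y => F y i j) x) :
    ContMDiffAt I 𝓘(ℝ, ℝ) k (fun y => (F y).det) x := by
  simp only [Matrix.det_apply']
  exact ContMDiffAt.sum fun σ _ => contMDiffAt_const.mul (ContMDiffAt.prod fun i _ => hF _ _)

theorem contMDiffAt_matrix_inv {F : M → Matrix (Fin n) (Fin n) ℝ}
    (hF : ∀ i j, ContMDiffAt I 𝓘(ℝ, ℝ) k (fun y => F y i j) x) (h : (F x).det ≠ 0)
    (i j : Fin n) : ContMDiffAt I 𝓘(ℝ, ℝ) k (fun y => (F y)⁻¹ i j) x := by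
  simp only [Matrix.inv_def, Ring.inverse_eq_inv', Matrix.smul_apply, smul_eq_mul,
    Matrix.adjugate_apply]
  refine ((contMDiffAt_matrix_det hF).inv₀ h).mul (contMDiffAt_matrix_det fun a b => ?_)
  by_cases hab : a = j
  · subst hab
    simpa using contMDiffAt_const
  · simpa [Matrix.updateRow_ne hab] using hF a b

theorem contMDiffAt_cayley {F : M → Matrix (Fin n) (Fin n) ℝ}
    (hF : ∀ i j, ContMDiffAt I 𝓘(ℝ, ℝ) k (fun y => F y i j) x) (h : (1 + F x).det ≠ 0)
    (i j : Fin n) : ContMDiffAt I 𝓘(ℝ, ℝ) k (fun y => cayley (F y) i j) x := by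
  refine contMDiffAt_matrix_mul (F := fun y => 1 - F y) (F' := fun y => (1 + F y)⁻¹)
    (fun a b => ?_) (contMDiffAt_matrix_inv (F := fun y => 1 + F y) (fun a b => ?_) h) i j
  · exact contMDiffAt_const.sub (hF a b)
  · exact contMDiffAt_const.add (hF a b)

theorem contMDiff_coe_ofCoord (B : SO n) (i j : Fin n) :
    ContMDiff 𝓘(ℝ, Coord n) 𝓘(ℝ, ℝ) k (fun x : Coord n => (B * ofCoord x).1 i j) := by
  intro x
  refine contMDiffAt_matrix_mul (F := fun _ => B.1) (F' := fun x => cayley (skew x))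
    (fun a b => contMDiffAt_const) (contMDiffAt_cayley (F := skew) (fun a b => ?_)
      (isUnit_det_one_add_of_skew (skew_transpose x)).ne_zero) i j
  rw [contMDiffAt_iff_contDiffAt]
  simp only [skew, Matrix.of_apply]
  split_ifs <;> fun_prop

end Smooth

instance instIsManifold (n : ℕ) : IsManifold 𝓘(ℝ, Coord n) ∞ (SO n) := by
  refine isManifold_of_contDiffOn _ _ _ ?_
  rintro _ _ ⟨B, rfl⟩ ⟨B', rfl⟩ x hx
  refine ContDiffAt.contDiffWithinAt ?_
  rw [← contMDiffAt_iff_contDiffAt]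
  have hx' : (1 + (B'⁻¹ * (B⁻¹⁻¹ * ofCoord x) : SO n).1).det ≠ 0 := hx.1.2
  have : ContMDiffAt 𝓘(ℝ, Coord n) 𝓘(ℝ, Coord n) ∞
      (fun y : Coord n => upper (cayley (B'⁻¹ * (B⁻¹⁻¹ * ofCoord y) : SO n).1)) x := by
    rw [contMDiffAt_pi_space]
    intro p
    refine contMDiffAt_cayley (F := fun y : Coord n => (B'⁻¹ * (B⁻¹⁻¹ * ofCoord y) : SO n).1)
      (fun a b => ?_) hx' _ _
    exact contMDiffAt_matrix_mul (F := fun _ => (B'⁻¹).1)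
      (F' := fun y : Coord n => (B⁻¹⁻¹ * ofCoord y : SO n).1) (fun _ _ => contMDiffAt_const)
      (fun a b => contMDiff_coe_ofCoord _ a b x) a b
  exact this

/-- The matrix entries are smooth functions on `SO(n)`. -/
theorem contMDiff_entry (i j : Fin n) :
    ContMDiff 𝓘(ℝ, Coord n) 𝓘(ℝ, ℝ) ∞ (fun A : SO n => A.1 i j) := by
  intro A
  have h1 : ContMDiffAt 𝓘(ℝ, Coord n) 𝓘(ℝ, Coord n) ∞ (chartAt (Coord n) A) A :=
    contMDiffAt_of_mem_maximalAtlas (IsManifold.chart_mem_maximalAtlas A)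
      (mem_chart_source _ A)
  have h2 := ((contMDiff_coe_ofCoord (k := ∞) A⁻¹⁻¹ i j) (chartAt (Coord n) A A)).comp A h1
  refine h2.congr_of_eventuallyEq ?_
  filter_upwards [(chartAt (Coord n) A).open_source.mem_nhds (mem_chart_source _ A)] with B hB
  have := (chartAt (Coord n) A).left_inv hB
  exact congrArg (fun C : SO n => C.1 i j) this.symm

/-- A map into `SO(n)` is smooth as soon as its matrix entries are. -/
theorem contMDiff_of_entry {E H M : Type*} [NormedAddCommGroup E] [NormedSpace ℝ E]
    [TopologicalSpace H] {I : ModelWithCorners ℝ E H} [TopologicalSpace M] [ChartedSpace H M]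
    {f : M → SO n} (hf : ∀ i j, ContMDiff I 𝓘(ℝ, ℝ) ∞ (fun y => (f y).1 i j)) :
    ContMDiff I 𝓘(ℝ, Coord n) ∞ f := by
  intro x
  have hc : Continuous f := by
    refine continuous_induced_rng.2 (continuous_matrix fun i j => (hf i j).continuous)
  rw [contMDiffAt_iff_target]
  refine ⟨hc.continuousAt, ?_⟩
  have : ContMDiffAt I 𝓘(ℝ, Coord n) ∞
      (fun y => upper (cayley ((f x)⁻¹ * f y : SO n).1)) x := by
    rw [contMDiffAt_pi_space]
    intro p
    refine contMDiffAt_cayley (F := fun y => ((f x)⁻¹ * f y : SO n).1)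
      (fun a b => ?_) (mem_chart_source (Coord n) (f x)) _ _
    exact contMDiffAt_matrix_mul (F := fun _ => ((f x)⁻¹).1) (F' := fun y => (f y).1) (fun _ _ => contMDiffAt_const)
      (fun a b => hf a b x) a b
  exact this

/-- The inclusion `SO(n) ⊂ SO(n + 1)` of the rotations fixing the last coordinate,
`A ↦ diag(A, 1)`. -/
def incl (n : ℕ) : SO n →* SO (n + 1) where
  toFun A := ofMatrix (Matrix.reindex finSumFinEquiv finSumFinEquiv
      (Matrix.fromBlocks A.1 0 0 (1 : Matrix (Fin 1) (Fin 1) ℝ)))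
    (by
      rw [Matrix.reindex_apply, Matrix.transpose_submatrix, Matrix.submatrix_mul_equiv,
        Matrix.fromBlocks_transpose, Matrix.fromBlocks_multiply]
      simp [transpose_mul A])
    (by simp [det_eq_one A])
  map_one' := by
    apply Subtype.ext
    change Matrix.reindex _ _ (Matrix.fromBlocks 1 0 0 1) = 1
    simp
  map_mul' A B := by
    apply Subtype.ext
    change Matrix.reindex _ _ (Matrix.fromBlocks (A.1 * B.1) 0 0 1) =
      Matrix.reindex _ _ (Matrix.fromBlocks A.1 0 0 1) *
        Matrix.reindex _ _ (Matrix.fromBlocks B.1 0 0 1)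
    simp [Matrix.reindex_apply, Matrix.submatrix_mul_equiv, Matrix.fromBlocks_multiply]

theorem contMDiff_incl (n : ℕ) : ContMDiff 𝓘(ℝ, Coord n) 𝓘(ℝ, Coord (n + 1)) ∞ (incl n) := by
  refine contMDiff_of_entry fun i j => ?_
  change ContMDiff _ _ _ fun A : SO n =>
    Matrix.fromBlocks A.1 0 0 (1 : Matrix (Fin 1) (Fin 1) ℝ) (finSumFinEquiv.symm i)
      (finSumFinEquiv.symm j)
  rcases finSumFinEquiv.symm i with a | a <;> rcases finSumFinEquiv.symm j with b | b
  · exact contMDiff_entry a b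
  all_goals exact contMDiff_const

end SO

/-! ### The sphere with its action of `SO(n)` -/

/-- The unit sphere `S^n` of `ℝ^(n+1)`. -/
abbrev Sph (n : ℕ) : Type := Metric.sphere (0 : EuclideanSpace ℝ (Fin (n + 1))) 1

/-- `SO(n)` acts on `S^n` by orthogonal transformations fixing the last coordinate. -/
instance Sph.instMulAction (n : ℕ) : MulAction (SO n) (Sph n) where
  smul A x := ⟨WithLp.toLp 2 ((SO.incl n A).1 *ᵥ x.1.ofLp), by
    have hx : ‖x.1‖ = 1 := by simp
    have h1 : x.1.ofLp ⬝ᵥ x.1.ofLp = 1 := by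
      have := EuclideanSpace.real_norm_sq_eq x.1
      rw [hx] at this
      simp only [dotProduct, ← pow_two]
      linarith
    have h2 : ‖WithLp.toLp 2 ((SO.incl n A).1 *ᵥ x.1.ofLp)‖ ^ 2 = 1 := by
      rw [EuclideanSpace.real_norm_sq_eq]
      have : ((SO.incl n A).1 *ᵥ x.1.ofLp) ⬝ᵥ ((SO.incl n A).1 *ᵥ x.1.ofLp) = 1 := by
        rw [Matrix.dotProduct_mulVec, ← Matrix.mulVec_transpose, Matrix.mulVec_mulVec,
          SO.transpose_mul, Matrix.one_mulVec, h1]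
      simpa only [dotProduct, ← pow_two] using this
    have h3 : ‖WithLp.toLp 2 ((SO.incl n A).1 *ᵥ x.1.ofLp)‖ = 1 :=
      (pow_eq_one_iff_of_nonneg (norm_nonneg _) two_ne_zero).1 h2
    simpa using h3⟩
  one_smul x := by
    apply Subtype.ext
    change WithLp.toLp 2 ((SO.incl n 1).1 *ᵥ x.1.ofLp) = x.1
    rw [map_one]
    change WithLp.toLp 2 ((1 : Matrix _ _ ℝ) *ᵥ x.1.ofLp) = x.1
    rw [Matrix.one_mulVec]
  mul_smul A B x := by
    apply Subtype.ext
    change WithLp.toLp 2 ((SO.incl n (A * B)).1 *ᵥ x.1.ofLp) =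
      WithLp.toLp 2 ((SO.incl n A).1 *ᵥ ((SO.incl n B).1 *ᵥ x.1.ofLp))
    rw [map_mul, Matrix.mulVec_mulVec]
    rfl

/-- The pole `(0, …, 0, -1)`. -/
def southPole (n : ℕ) : Sph n := ⟨EuclideanSpace.single (Fin.last n) (-1), by simp⟩

/-- The pole `(0, …, 0, 1)`. -/
def northPole (n : ℕ) : Sph n := ⟨EuclideanSpace.single (Fin.last n) 1, by simp⟩

theorem SO.incl_mulVec_single_last {n : ℕ} (A : SO n) (r : ℝ) :
    (SO.incl n A).1 *ᵥ Pi.single (Fin.last n) r = Pi.single (Fin.last n) r := by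
  have hl : (finSumFinEquiv (m := n) (n := 1)).symm (Fin.last n) = Sum.inr 0 := by
    rw [Equiv.symm_apply_eq]; rfl
  funext i
  rw [Matrix.mulVec_single]
  change Matrix.fromBlocks A.1 0 0 (1 : Matrix (Fin 1) (Fin 1) ℝ) (finSumFinEquiv.symm i)
      (finSumFinEquiv.symm (Fin.last n)) * r = _
  rw [hl]
  obtain ⟨i', rfl⟩ := (finSumFinEquiv (m := n) (n := 1)).surjective i
  rw [Equiv.symm_apply_apply]
  rcases i' with a | a
  · have : (finSumFinEquiv (m := n) (n := 1)) (Sum.inl a) ≠ Fin.last n :=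
      fun h => by simpa [hl] using congrArg (finSumFinEquiv (m := n) (n := 1)).symm h
    rw [Pi.single_eq_of_ne this]
    simp
  · have h0 : a = 0 := Subsingleton.elim _ _
    subst h0
    have : (finSumFinEquiv (m := n) (n := 1)) (Sum.inr 0) = Fin.last n := rfl
    rw [this]
    simp

theorem smul_southPole {n : ℕ} (A : SO n) : A • southPole n = southPole n :=
  Subtype.ext (congrArg (WithLp.toLp 2) (A.incl_mulVec_single_last (-1)))

theorem smul_northPole {n : ℕ} (A : SO n) : A • northPole n = northPole n :=
  Subtype.ext (congrArg (WithLp.toLp 2) (A.incl_mulVec_single_last 1))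

/-! ### Smooth homomorphisms `SO(n) → G` up to conjugation -/

section Hom

variable (n : ℕ) (V : Type*) [NormedAddCommGroup V] [NormedSpace ℝ V]
  (G : Type*) [Group G] [TopologicalSpace G] [ChartedSpace V G]

/-- Smooth homomorphisms from `SO(n)` to the Lie group `G` (modelled on `V`). -/
abbrev SmoothHom := ContMDiffMonoidMorphism 𝓘(ℝ, SO.Coord n) 𝓘(ℝ, V) ∞ (SO n) G

/-- Conjugacy of smooth homomorphisms by elements of `G`. -/
instance SmoothHom.conjSetoid : Setoid (SmoothHom n V G) where
  r α β := ∃ g : G, ∀ A, β A = g * α A * g⁻¹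
  iseqv :=
    { refl := fun α => ⟨1, by simp⟩
      symm := fun {α β} ⟨g, h⟩ => ⟨g⁻¹, fun A => by rw [h]; group⟩
      trans := fun {α β δ} ⟨g, h⟩ ⟨g', h'⟩ => ⟨g' * g, fun A => by rw [h', h]; group⟩ }

/-- The set `R(n, G)` of conjugacy classes of smooth homomorphisms `SO(n) → G`. -/
def RepClass := Quotient (SmoothHom.conjSetoid n V G)

variable {n V G}

/-- The conjugacy class of a smooth homomorphism. -/
def RepClass.mk (α : SmoothHom n V G) : RepClass n V G := Quotient.mk _ α

/-- The restriction of a smooth homomorphism to `SO(n) ⊂ SO(n + 1)`. -/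
def SmoothHom.res (α : SmoothHom (n + 1) V G) : SmoothHom n V G where
  toMonoidHom := α.toMonoidHom.comp (SO.incl n)
  contMDiff_toFun := α.contMDiff_toFun.comp (SO.contMDiff_incl n)

/-- The restriction map `Res : R(n + 1, G) → R(n, G)`. -/
def RepClass.res : RepClass (n + 1) V G → RepClass n V G :=
  Quotient.map SmoothHom.res fun _ _ ⟨g, h⟩ => ⟨g, fun A => h (SO.incl n A)⟩

end Hom

/-! ### Equivariant principal bundles -/

universe u v

section Bundle

variable (n : ℕ) (V : Type v) [NormedAddCommGroup V] [NormedSpace ℝ V]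
  (G : Type u) [Group G] [TopologicalSpace G] [ChartedSpace V G]

/-- An `SO(n)`-equivariant smooth principal `G`-bundle over `S^n`. The principal right action of
`G` is an action of `Gᵐᵒᵖ`, written `z <• g`. Freeness of this action, surjectivity of the
projection and the Hausdorff property of the total space follow from local triviality. -/
structure EquivBundle where
  /-- the total space, a smooth manifold -/
  Total : Type u
  [topTotal : TopologicalSpace Total]
  [chartedTotal : ChartedSpace (ModelProd (EuclideanSpace ℝ (Fin n)) V) Total]
  [manifoldTotal : IsManifold ((𝓡 n).prod 𝓘(ℝ, V)) ∞ Total]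
  /-- the right action of `G` -/
  [rightAction : MulAction Gᵐᵒᵖ Total]
  /-- the left action of `SO(n)` -/
  [leftAction : MulAction (SO n) Total]
  /-- the projection -/
  proj : Total → Sph n
  contMDiff_proj : ContMDiff ((𝓡 n).prod 𝓘(ℝ, V)) (𝓡 n) ∞ proj
  contMDiff_right : ContMDiff (((𝓡 n).prod 𝓘(ℝ, V)).prod 𝓘(ℝ, V)) ((𝓡 n).prod 𝓘(ℝ, V)) ∞
    (fun p : Total × G => p.1 <• p.2)
  contMDiff_left : ContMDiff (𝓘(ℝ, SO.Coord n).prod ((𝓡 n).prod 𝓘(ℝ, V)))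
    ((𝓡 n).prod 𝓘(ℝ, V)) ∞ (fun p : SO n × Total => p.1 • p.2)
  proj_right : ∀ (z : Total) (g : G), proj (z <• g) = proj z
  proj_left : ∀ (A : SO n) (z : Total), proj (A • z) = A • proj z
  left_right_comm : ∀ (A : SO n) (z : Total) (g : G), A • (z <• g) = (A • z) <• g
  /-- local triviality: around every point there is a `G`-equivariant diffeomorphism
  `proj⁻¹ U ≅ U × G` over `U` -/
  locally_trivial : ∀ x : Sph n, ∃ e : Bundle.Trivialization G proj, x ∈ e.baseSet ∧
    ContMDiffOn ((𝓡 n).prod 𝓘(ℝ, V)) ((𝓡 n).prod 𝓘(ℝ, V)) ∞ e e.source ∧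
    ContMDiffOn ((𝓡 n).prod 𝓘(ℝ, V)) ((𝓡 n).prod 𝓘(ℝ, V)) ∞
      e.toOpenPartialHomeomorph.symm e.target ∧
    ∀ z ∈ e.source, ∀ g : G, (e (z <• g)).2 = (e z).2 * g

attribute [instance] EquivBundle.topTotal EquivBundle.chartedTotal EquivBundle.manifoldTotal
  EquivBundle.rightAction EquivBundle.leftAction

variable {n V G}

/-- Isomorphism of equivariant bundles: a diffeomorphism of the total spaces, equivariant for
`SO(n)` and `G`, over the identity of `S^n`. -/
def EquivBundle.Iso (ξ η : EquivBundle n V G) : Prop :=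
  ∃ h : Diffeomorph ((𝓡 n).prod 𝓘(ℝ, V)) ((𝓡 n).prod 𝓘(ℝ, V)) ξ.Total η.Total ∞,
    (∀ (A : SO n) (z : ξ.Total), h (A • z) = A • h z) ∧
    (∀ (z : ξ.Total) (g : G), h (z <• g) = h z <• g) ∧
    ∀ z : ξ.Total, η.proj (h z) = ξ.proj z

variable (n V G) in
/-- The isomorphism relation on equivariant bundles. -/
instance EquivBundle.isoSetoid : Setoid (EquivBundle n V G) where
  r := EquivBundle.Iso
  iseqv :=
    { refl := fun ξ => ⟨Diffeomorph.refl _ _ _, fun _ _ => rfl, fun _ _ => rfl, fun _ => rfl⟩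
      symm := fun {ξ η} ⟨h, h1, h2, h3⟩ => ⟨h.symm,
        fun A z => h.injective ((h.apply_symm_apply _).trans (by
          refine Eq.trans ?_ (h1 _ _).symm; rw [h.apply_symm_apply])),
        fun z g => h.injective ((h.apply_symm_apply _).trans (by
          refine Eq.trans ?_ (h2 _ _).symm; rw [h.apply_symm_apply])),
        fun z => by rw [← h3, h.apply_symm_apply]⟩
      trans := fun {ξ η ζ} ⟨h, h1, h2, h3⟩ ⟨k, k1, k2, k3⟩ => ⟨h.trans k,
        fun A z => by simp [h1, k1], fun z g => by simp [h2, k2], fun z => by simp [h3, k3]⟩ }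

variable (n V G) in
/-- The set `E(n, G)` of isomorphism classes of `SO(n)`-equivariant principal `G`-bundles
over `S^n`. -/
def BundleClass := Quotient (EquivBundle.isoSetoid n V G)

namespace EquivBundle

theorem eq_of_right_eq (ξ : EquivBundle n V G) (z : ξ.Total) {g g' : G}
    (h : z <• g = z <• g') : g = g' := by
  obtain ⟨e, hx, -, -, he⟩ := ξ.locally_trivial (ξ.proj z)
  have hz : z ∈ e.source := e.mem_source.2 hx
  have := he z hz g
  rw [h, he z hz g'] at this
  exact (mul_left_cancel this).symm

theorem exists_right_eq (ξ : EquivBundle n V G) {z w : ξ.Total} (h : ξ.proj z = ξ.proj w) :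
    ∃ g : G, w = z <• g := by
  obtain ⟨e, hx, -, -, he⟩ := ξ.locally_trivial (ξ.proj z)
  have hz : z ∈ e.source := e.mem_source.2 hx
  have hw : w ∈ e.source := e.mem_source.2 (h ▸ hx)
  refine ⟨(e z).2⁻¹ * (e w).2, ?_⟩
  have hzg : z <• ((e z).2⁻¹ * (e w).2) ∈ e.source :=
    e.mem_source.2 (by rw [ξ.proj_right]; exact hx)
  refine e.injOn hw hzg (Prod.ext ?_ ?_)
  · change (e w).1 = (e _).1
    rw [e.coe_fst hw, e.coe_fst hzg, ξ.proj_right, h]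
  · change (e w).2 = (e _).2
    rw [he z hz]; group

theorem exists_proj_eq (ξ : EquivBundle n V G) (x : Sph n) : ∃ a : ξ.Total, ξ.proj a = x := by
  obtain ⟨e, hx, -⟩ := ξ.locally_trivial x
  exact ⟨e.toOpenPartialHomeomorph.symm (x, 1), e.proj_symm_apply' hx⟩

/-- `α` is the isotropy representation of `ξ` associated to the point `a` of the total space. -/
def IsIsotropyRep (ξ : EquivBundle n V G) (a : ξ.Total) (α : SmoothHom n V G) : Prop :=
  ∀ A : SO n, A • a = a <• α A

theorem conj_of_isIsotropyRep (ξ : EquivBundle n V G) {a b : ξ.Total} (h : ξ.proj a = ξ.proj b)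
    {α β : SmoothHom n V G} (hα : ξ.IsIsotropyRep a α) (hβ : ξ.IsIsotropyRep b β) :
    RepClass.mk α = RepClass.mk β := by
  obtain ⟨g, rfl⟩ := ξ.exists_right_eq h
  refine Quotient.sound ⟨g⁻¹, fun A => ?_⟩
  have h1 : a <• (g * β A) = a <• (α A * g) := by
    rw [MulOpposite.op_mul, mul_smul, ← hβ A, ξ.left_right_comm, hα A, MulOpposite.op_mul, mul_smul]
  have h2 := ξ.eq_of_right_eq a h1
  rw [inv_inv, mul_assoc, ← h2]; group

variable [LieGroup 𝓘(ℝ, V) ∞ G]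

theorem exists_isIsotropyRep (ξ : EquivBundle n V G) (a : ξ.Total)
    (ha : ∀ A : SO n, A • ξ.proj a = ξ.proj a) : ∃ α : SmoothHom n V G, ξ.IsIsotropyRep a α := by
  have h : ∀ A : SO n, ∃ g : G, A • a = a <• g := fun A =>
    ξ.exists_right_eq (by rw [ξ.proj_left, ha])
  choose α hα using h
  obtain ⟨e, hx, he1, -, he⟩ := ξ.locally_trivial (ξ.proj a)
  have hz : a ∈ e.source := e.mem_source.2 hx
  have hAz : ∀ A : SO n, A • a ∈ e.source := fun A =>
    e.mem_source.2 (by rw [ξ.proj_left, ha]; exact hx)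
  have hformula : ∀ A, α A = (e a).2⁻¹ * (e (A • a)).2 := fun A => by
    rw [hα, he a hz]; group
  refine ⟨{ toFun := α, map_one' := ?_, map_mul' := ?_, contMDiff_toFun := ?_ }, hα⟩
  · apply ξ.eq_of_right_eq a
    rw [← hα, one_smul]; simp
  · intro A B
    apply ξ.eq_of_right_eq a
    rw [← hα, mul_smul, hα B, ξ.left_right_comm, hα A, MulOpposite.op_mul, mul_smul]
  · rw [funext hformula]
    have h1 : ContMDiff 𝓘(ℝ, SO.Coord n) ((𝓡 n).prod 𝓘(ℝ, V)) ∞ fun A : SO n => A • a :=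
      ξ.contMDiff_left.comp (contMDiff_id.prodMk contMDiff_const)
    have h2 : ContMDiff 𝓘(ℝ, SO.Coord n) ((𝓡 n).prod 𝓘(ℝ, V)) ∞ fun A : SO n => e (A • a) :=
      he1.comp_contMDiff h1 hAz
    exact contMDiff_const.mul (contMDiff_snd.comp h2)

theorem exists_isIsotropyRep_over (ξ : EquivBundle n V G) (x : Sph n)
    (hx : ∀ A : SO n, A • x = x) :
    ∃ (α : SmoothHom n V G) (a : ξ.Total), ξ.proj a = x ∧ ξ.IsIsotropyRep a α := by
  obtain ⟨a, rfl⟩ := ξ.exists_proj_eq x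
  obtain ⟨α, hα⟩ := ξ.exists_isIsotropyRep a hx
  exact ⟨α, a, rfl, hα⟩

/-- The class in `R(n, G)` of the isotropy representations of `ξ` over a fixed point `x`. -/
def isotropyClass (ξ : EquivBundle n V G) (x : Sph n) (hx : ∀ A : SO n, A • x = x) :
    RepClass n V G :=
  RepClass.mk (ξ.exists_isIsotropyRep_over x hx).choose

/-- The class does not depend on the choice of a point in the fibre. -/
theorem isotropyClass_eq (ξ : EquivBundle n V G) {x : Sph n} (hx : ∀ A : SO n, A • x = x)
    {a : ξ.Total} (ha : ξ.proj a = x) {α : SmoothHom n V G} (hα : ξ.IsIsotropyRep a α) :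
    ξ.isotropyClass x hx = RepClass.mk α := by
  obtain ⟨b, hb, hβ⟩ := (ξ.exists_isIsotropyRep_over x hx).choose_spec
  exact ξ.conj_of_isIsotropyRep (hb.trans ha.symm) hβ hα

theorem isotropyClass_congr {ξ η : EquivBundle n V G} (h : ξ.Iso η) {x : Sph n}
    (hx : ∀ A : SO n, A • x = x) : ξ.isotropyClass x hx = η.isotropyClass x hx := by
  obtain ⟨f, h1, h2, h3⟩ := h
  obtain ⟨α, a, ha, hα⟩ := ξ.exists_isIsotropyRep_over x hx
  rw [ξ.isotropyClass_eq hx ha hα]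
  refine (η.isotropyClass_eq hx (a := f a) (by rw [h3, ha]) fun A => ?_).symm
  rw [← h1, hα A, h2]

end EquivBundle

variable (n V G) in
/-- The isotropy map `J : E(n, G) → R(n, G) × R(n, G)`, sending a bundle to the classes of its
isotropy representations over the south and the north pole. -/
def isotropyMap [LieGroup 𝓘(ℝ, V) ∞ G] :
    BundleClass n V G → RepClass n V G × RepClass n V G :=
  Quotient.lift
    (fun ξ => (ξ.isotropyClass (southPole n) smul_southPole,
      ξ.isotropyClass (northPole n) smul_northPole))
    fun _ _ h => Prod.ext (EquivBundle.isotropyClass_congr h smul_southPole)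
      (EquivBundle.isotropyClass_congr h smul_northPole)

end Bundle

/-! ### Components of centralizers -/

/-- The group structure on the set `π₀` of path components of a topological group. -/
instance ZerothHomotopy.instGroup {K : Type*} [Group K] [TopologicalSpace K]
    [IsTopologicalGroup K] : Group (ZerothHomotopy K) where
  mul := Quotient.map₂ (· * ·) fun _ _ h _ _ h' => Joined.mul h h'
  one := .mk 1
  inv := Quotient.map (·⁻¹) fun _ _ h => Joined.inv h
  mul_assoc := by rintro ⟨a⟩ ⟨b⟩ ⟨c⟩; exact congrArg ZerothHomotopy.mk (mul_assoc a b c)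
  one_mul := by rintro ⟨a⟩; exact congrArg ZerothHomotopy.mk (one_mul a)
  mul_one := by rintro ⟨a⟩; exact congrArg ZerothHomotopy.mk (mul_one a)
  inv_mul_cancel := by rintro ⟨a⟩; exact congrArg ZerothHomotopy.mk (inv_mul_cancel a)

/-- The homomorphism `π₀(H) → π₀(K)` induced by an inclusion of subgroups `H ≤ K`. -/
def pi0Inclusion {G : Type*} [Group G] [TopologicalSpace G] [IsTopologicalGroup G]
    {H K : Subgroup G} (h : H ≤ K) : ZerothHomotopy H →* ZerothHomotopy K where
  toFun := Quotient.map (Subgroup.inclusion h) fun _ _ ⟨p⟩ =>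
    ⟨p.map (continuous_inclusion h)⟩
  map_one' := rfl
  map_mul' := by rintro ⟨a⟩ ⟨b⟩; rfl

section Centralizer

variable {n : ℕ} {V : Type*} [NormedAddCommGroup V] [NormedSpace ℝ V]
  {G : Type*} [Group G] [TopologicalSpace G] [ChartedSpace V G]

/-- The centralizer `Z_φ` in `G` of the image of `φ`. -/
def SmoothHom.centralizer (φ : SmoothHom n V G) : Subgroup G :=
  Subgroup.centralizer (Set.range φ)

theorem SmoothHom.centralizer_le_res (φ : SmoothHom (n + 1) V G) :
    SmoothHom.centralizer φ ≤ SmoothHom.centralizer (SmoothHom.res φ) :=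
  Subgroup.centralizer_le (by rintro _ ⟨A, rfl⟩; exact ⟨SO.incl n A, rfl⟩)

/-- The double cosets `π₀(Z_α) \ π₀(Z_γ) / π₀(Z_β)`, where `γ` is the common restriction of `α`
and `β`, and `π₀(Z_α)`, `π₀(Z_β)` act through their images in `π₀(Z_γ)`. -/
def CentralizerDoubleCosets [LieGroup 𝓘(ℝ, V) ∞ G] (α β : SmoothHom (n + 1) V G)
    (γ : SmoothHom n V G) (hα : SmoothHom.res α = γ) (hβ : SmoothHom.res β = γ) : Type _ :=
  haveI : IsTopologicalGroup G := topologicalGroup_of_lieGroup 𝓘(ℝ, V) ∞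
  DoubleCoset.Quotient
    (Set.range (pi0Inclusion (H := SmoothHom.centralizer α) (K := SmoothHom.centralizer γ)
      (hα ▸ SmoothHom.centralizer_le_res α)))
    (Set.range (pi0Inclusion (H := SmoothHom.centralizer β) (K := SmoothHom.centralizer γ)
      (hβ ▸ SmoothHom.centralizer_le_res β)))

end Centralizer

end

/-! A meridian from the south to the north pole meets every `SO(n + 1)`-orbit of the sphere exactly
once. The stabilizer of its points is the whole group at the two ends and `SO(n)` in between. An
equivariant bundle should therefore be determined by its restriction to the meridian. One lifts the
meridian to a path `s` in the total space along which `SO(n)` acts through one fixed homomorphism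
`γ`; at its ends the whole group acts through homomorphisms `α` and `β'` extending `γ`. If two
bundles have such lifts with the same `α` and `β'`, then `A s(t) g ↦ A s'(t) g` is a well-defined
equivariant bijection, because stabilizers act identically on both lifts (`transport_smul_lift`). It
is smooth at the poles if the lifts are adapted, that is, if near each pole they run inside a smooth
local section on which the group acts through a constant homomorphism (`IsAdapted.iso`).

The analytic core is the existence of such sections. In a local trivialization, the failure of a
section to be equivariant is a smooth `G`-valued cocycle. Averaging over Haar measure in a chart of
`G` linearizes the twisted action along the fibre (`exists_linearization`), and the zero section of
the linearized action is the corrected section (`exists_smooth_trivialization`). The same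
linearization identifies a centralizer near `1` with the fixed space of a linear representation.
Hence elements joined to `1` by a continuous path in the centralizer are also joined by a smooth one
(`mem_smoothlyJoined_of_joined`).

The remaining invariant is the element `z ∈ Z_γ` comparing the end of an adapted lift with a point
of isotropy `β` (`HasType`). Other choices of the two end points change `z` to `u⁻¹ z v` with `u ∈
Z_α`, `v ∈ Z_β`. Multiplying the lift by a path in `Z_γ` moves `z` within its path component, and
the quotient of two adapted lifts shows that nothing else can happen (`HasType.exists_joined`).
Every `z` occurs: glue two product bundles by the transition function with value `α(A) z β(A)⁻¹` at
`A · meridian` (`hasType_clutchMap`). Taking `z = 1` shows that all compatible pairs are in the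
image of the isotropy map. -/

open scoped Manifold ContDiff

noncomputable section

set_option linter.unusedSectionVars false

open Matrix
open scoped Matrix RightActions

/-! ### Smoothness of integrals depending on a parameter -/

section ParametricIntegral

open MeasureTheory

variable {E K P : Type*} [NormedAddCommGroup E] [NormedSpace ℝ E] [TopologicalSpace K]
  [ChartedSpace E K] [IsManifold 𝓘(ℝ, E) ∞ K] [NormedAddCommGroup P] [NormedSpace ℝ P]

/-- The partial derivative along the linear factor of a smooth map on `K × P`. -/
theorem ContMDiffAt.partial_fderiv {V : Type*} [NormedAddCommGroup V] [NormedSpace ℝ V]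
    {Φ : K × P → V} {x : K × P}
    (h : ContMDiffAt (𝓘(ℝ, E).prod 𝓘(ℝ, P)) 𝓘(ℝ, V) ∞ Φ x) :
    ContMDiffAt (𝓘(ℝ, E).prod 𝓘(ℝ, P)) 𝓘(ℝ, P →L[ℝ] V) ∞
        (fun y => fderiv ℝ (fun p => Φ (y.1, p)) y.2) x := by
  obtain ⟨A, p⟩ := x
  set χ := chartAt E A with hχ
  have hA : A ∈ χ.source := mem_chart_source E A
  have hχA : χ A ∈ χ.target := χ.map_source hA
  set Ψ : E × P → V := fun q => Φ (χ.symm q.1, q.2) with hΨ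
  have hs : ContMDiffAt 𝓘(ℝ, E) 𝓘(ℝ, E) ∞ χ.symm (χ A) :=
    (contMDiffOn_chart_symm (I := 𝓘(ℝ, E)) (n := ∞)).contMDiffAt (χ.open_target.mem_nhds hχA)
  have hc : ContMDiffAt 𝓘(ℝ, E) 𝓘(ℝ, E) ∞ χ A :=
    (contMDiffOn_chart (I := 𝓘(ℝ, E)) (n := ∞)).contMDiffAt (χ.open_source.mem_nhds hA)
  have hΨs : ContDiffAt ℝ ∞ Ψ (χ A, p) := by
    have h' : ContMDiffAt (𝓘(ℝ, E).prod 𝓘(ℝ, P)) 𝓘(ℝ, V) ∞ Φ (χ.symm (χ A), p) := by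
      rwa [χ.left_inv hA]
    have h2 : ContMDiffAt 𝓘(ℝ, E × P) (𝓘(ℝ, E).prod 𝓘(ℝ, P)) ∞
        (fun q : E × P => (χ.symm q.1, q.2)) (χ A, p) :=
      (ContMDiffAt.comp (I' := 𝓘(ℝ, E)) (χ A, p) hs
        contDiff_fst.contMDiff.contMDiffAt).prodMk contDiff_snd.contMDiff.contMDiffAt
    exact contMDiffAt_iff_contDiffAt.1 (ContMDiffAt.comp (χ A, p) h' h2)
  -- Once `K` is read in a chart, the partial derivative is the total derivative restricted to the
  -- second factor, so its smoothness is that of a total derivative.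
  have hD : ContDiffAt ℝ ∞ (fun q => (fderiv ℝ Ψ q).comp (ContinuousLinearMap.inr ℝ E P))
      (χ A, p) :=
    (hΨs.fderiv_right (m := ∞) (by simp)).clm_comp contDiffAt_const
  have hev : ∀ᶠ q in nhds (χ A, p), DifferentiableAt ℝ Ψ q := by
    have h1 : ContDiffAt ℝ 1 Ψ (χ A, p) := hΨs.of_le (by exact_mod_cast le_top)
    filter_upwards [h1.eventually (by simp)] with q hq using hq.differentiableAt (by simp)
  have hm : ContMDiffAt (𝓘(ℝ, E).prod 𝓘(ℝ, P)) (𝓘(ℝ, E).prod 𝓘(ℝ, P)) ∞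
      (fun y : K × P => ((χ y.1, y.2) : E × P)) (A, p) :=
    (ContMDiffAt.comp (I' := 𝓘(ℝ, E)) (A, p) hc contMDiffAt_fst).prodMk contMDiffAt_snd
  have hD' : ContMDiffAt (𝓘(ℝ, E).prod 𝓘(ℝ, P)) 𝓘(ℝ, P →L[ℝ] V) ∞
      (fun q => (fderiv ℝ Ψ q).comp (ContinuousLinearMap.inr ℝ E P)) (χ A, p) := by
    rw [← contMDiffAt_iff_contDiffAt, modelWithCornersSelf_prod, ← chartedSpaceSelf_prod] at hD
    exact hD
  refine (ContMDiffAt.comp (I' := 𝓘(ℝ, E).prod 𝓘(ℝ, P)) (A, p) hD' hm).congr_of_eventuallyEq ?_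
  have hcont : ContinuousAt (fun y : K × P => ((χ y.1, y.2) : E × P)) (A, p) := hm.continuousAt
  filter_upwards [hcont.eventually hev,
    continuousAt_fst.eventually (χ.open_source.mem_nhds hA)] with y hy hyA
  have h1 : (fun p => Φ (y.1, p)) = fun p => Ψ (χ y.1, p) := by
    funext p; simp only [hΨ]; rw [χ.left_inv hyA]
  have h2 : HasFDerivAt (fun p => Ψ (χ y.1, p))
      ((fderiv ℝ Ψ (χ y.1, y.2)).comp (ContinuousLinearMap.inr ℝ E P)) y.2 :=
    hy.hasFDerivAt.comp y.2 (hasFDerivAt_prodMk_right (χ y.1) y.2)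
  simp only [Function.comp]
  rw [h1, h2.fderiv]

variable [CompactSpace K] [SecondCountableTopology K] [MeasurableSpace K] [BorelSpace K]
  (μ : Measure K) [IsFiniteMeasure μ]

/-- Differentiation under the integral sign. Compactness of `K` and finiteness of `μ` provide a
constant dominating function. -/
theorem hasFDerivAt_integral_of_contMDiffOn {V : Type*} [NormedAddCommGroup V] [NormedSpace ℝ V]
    {U : Set P} (hU : IsOpen U) {Φ : K × P → V}
    (h : ContMDiffOn (𝓘(ℝ, E).prod 𝓘(ℝ, P)) 𝓘(ℝ, V) ∞ Φ (Set.univ ×ˢ U)) {p : P} (hp : p ∈ U) :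
    HasFDerivAt (fun q => ∫ A, Φ (A, q) ∂μ) (∫ A, fderiv ℝ (fun q => Φ (A, q)) p ∂μ) p := by
  have hOpen : IsOpen ((Set.univ : Set K) ×ˢ U) := isOpen_univ.prod hU
  have hat : ∀ A, ∀ q ∈ U, ContMDiffAt (𝓘(ℝ, E).prod 𝓘(ℝ, P)) 𝓘(ℝ, V) ∞ Φ (A, q) :=
    fun A q hq => h.contMDiffAt (hOpen.mem_nhds ⟨trivial, hq⟩)
  have hslice : ∀ q ∈ U, Continuous fun A => Φ (A, q) := fun q hq =>
    continuous_iff_continuousAt.2 fun A =>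
      (hat A q hq).continuousAt.comp (f := fun A : K => (A, q)) (by fun_prop)
  have hD : ∀ A, ∀ q ∈ U,
      ContinuousAt (fun y : K × P => fderiv ℝ (fun p => Φ (y.1, p)) y.2) (A, q) :=
    fun A q hq => (hat A q hq).partial_fderiv.continuousAt
  have hDc : Continuous fun A : K => fderiv ℝ (fun q => Φ (A, q)) p :=
    continuous_iff_continuousAt.2 fun A =>
      ContinuousAt.comp (f := fun A : K => (A, p)) (hD A p hp) (by fun_prop)
  have hdiff : ∀ A, ∀ q ∈ U, DifferentiableAt ℝ (fun q => Φ (A, q)) q := fun A q hq => by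
    have : ContMDiffAt 𝓘(ℝ, P) 𝓘(ℝ, V) ∞ (fun q => Φ (A, q)) q :=
      ContMDiffAt.comp (I' := 𝓘(ℝ, E).prod 𝓘(ℝ, P)) q (hat A q hq)
        (contMDiffAt_const.prodMk contMDiffAt_id)
    exact (contMDiffAt_iff_contDiffAt.1 this).differentiableAt (by simp)
  obtain ⟨C, hC⟩ : ∃ C : ℝ, ∀ A : K, ‖fderiv ℝ (fun q => Φ (A, q)) p‖ ≤ C := by
    obtain ⟨C, hC⟩ := (isCompact_range hDc.norm).bddAbove
    exact ⟨C, fun A => hC ⟨A, rfl⟩⟩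
  -- `C` bounds the derivative only at `p` itself. By the tube lemma the slightly larger bound `C +
  -- 1` persists near `p`, uniformly in `A`.
  have hnear : ∀ᶠ q in nhds p, ∀ A ∈ (Set.univ : Set K),
      ‖fderiv ℝ (fun q => Φ (A, q)) q‖ < C + 1 := by
    refine isCompact_univ.eventually_forall_of_forall_eventually fun A _ => ?_
    have h1 : ContinuousAt (fun y : P × K => ‖fderiv ℝ (fun p => Φ (y.2, p)) y.1‖) (p, A) :=
      (ContinuousAt.comp (f := fun y : P × K => (y.2, y.1)) (x := (p, A)) (hD A p hp)
        continuous_swap.continuousAt).norm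
    exact h1.eventually (gt_mem_nhds ((hC A).trans_lt (lt_add_one C)))
  refine hasFDerivAt_integral_of_dominated_of_fderiv_le (bound := fun _ => C + 1)
    (F := fun q A => Φ (A, q)) (F' := fun q A => fderiv ℝ (fun q => Φ (A, q)) q)
    (Filter.inter_mem hnear (hU.mem_nhds hp)) ?_ ?_ hDc.aestronglyMeasurable ?_
    (integrable_const _) ?_
  · filter_upwards [hU.mem_nhds hp] with q hq using (hslice q hq).aestronglyMeasurable
  · exact (hslice p hp).integrable_of_hasCompactSupport (HasCompactSupport.of_compactSpace _)
  · exact Filter.Eventually.of_forall fun A q hq => (hq.1 A trivial).le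
  · exact Filter.Eventually.of_forall fun A q hq => (hdiff A q hq.2).hasFDerivAt

universe v

/-- Induction on the order of differentiability, applied to the partial derivative of `Φ`. The
target changes from `V` to `P →L[ℝ] V`, so the induction runs over all targets, and `P` and `V`
share a universe to keep it closed. -/
theorem contDiffOn_integral_of_contMDiffOn {P V : Type v} [NormedAddCommGroup P]
    [NormedSpace ℝ P] [NormedAddCommGroup V] [NormedSpace ℝ V]
    {U : Set P} (hU : IsOpen U) {Φ : K × P → V}
    (h : ContMDiffOn (𝓘(ℝ, E).prod 𝓘(ℝ, P)) 𝓘(ℝ, V) ∞ Φ (Set.univ ×ˢ U)) :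
    ContDiffOn ℝ ∞ (fun q => ∫ A, Φ (A, q) ∂μ) U := by
  have hOpen : IsOpen ((Set.univ : Set K) ×ˢ U) := isOpen_univ.prod hU
  refine contDiffOn_infty.2 fun k => ?_
  induction k generalizing V with
  | zero =>
    refine contDiffOn_zero.2 fun p hp => ?_
    exact (hasFDerivAt_integral_of_contMDiffOn μ hU h hp).continuousAt.continuousWithinAt
  | succ k ih =>
    have hD : ContMDiffOn (𝓘(ℝ, E).prod 𝓘(ℝ, P)) 𝓘(ℝ, P →L[ℝ] V) ∞
        (fun y : K × P => fderiv ℝ (fun p => Φ (y.1, p)) y.2) (Set.univ ×ˢ U) := fun y hy =>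
      ((h.contMDiffAt (hOpen.mem_nhds hy)).partial_fderiv).contMDiffWithinAt
    have hF := fun p (hp : p ∈ U) => hasFDerivAt_integral_of_contMDiffOn μ hU h hp
    have key : ContDiffOn ℝ (k + 1) (fun q => ∫ A, Φ (A, q) ∂μ) U := by
      refine (contDiffOn_succ_iff_fderiv_of_isOpen hU).2
        ⟨fun p hp => (hF p hp).differentiableAt.differentiableWithinAt, fun h => by simp at h, ?_⟩
      exact (ih hD).congr fun p hp => (hF p hp).fderiv
    exact_mod_cast key

end ParametricIntegral

/-! ### Averaging over a compact group -/

section Averaging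

open MeasureTheory

universe v

variable {E K : Type*} [NormedAddCommGroup E] [NormedSpace ℝ E] [TopologicalSpace K]
  [ChartedSpace E K] [Group K] [LieGroup 𝓘(ℝ, E) ∞ K]
  {V : Type v} [NormedAddCommGroup V] [NormedSpace ℝ V]
  {G : Type*} [Group G] [TopologicalSpace G] [ChartedSpace V G] [LieGroup 𝓘(ℝ, V) ∞ G]

/-- The adjoint action of `α A` on the model space of `G`, read in the preferred chart at `1`. -/
def adjointRep (V : Type v) [NormedAddCommGroup V] [NormedSpace ℝ V] {G : Type*} [Group G]
    [TopologicalSpace G] [ChartedSpace V G] (α : K →* G) (A : K) : V →L[ℝ] V :=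
  fderiv ℝ (fun v => chartAt V (1 : G) (α A * (chartAt V (1 : G)).symm v * (α A)⁻¹))
    (chartAt V (1 : G) 1)

theorem contMDiffAt_chart_symm_base :
    ContMDiffAt 𝓘(ℝ, V) 𝓘(ℝ, V) ∞ (chartAt V (1 : G)).symm (chartAt V (1 : G) 1) :=
  (contMDiffOn_chart_symm (I := 𝓘(ℝ, V)) (n := ∞)).contMDiffAt
    ((chartAt V (1 : G)).open_target.mem_nhds (mem_chart_target V 1))

variable {α : K →* G}

theorem contMDiffAt_conj_chart (hα : ContMDiff 𝓘(ℝ, E) 𝓘(ℝ, V) ∞ α) (A : K) :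
    ContMDiffAt (𝓘(ℝ, E).prod 𝓘(ℝ, V)) 𝓘(ℝ, V) ∞
      (fun x : K × V => chartAt V (1 : G)
        (α x.1 * (chartAt V (1 : G)).symm x.2 * (α x.1)⁻¹)) (A, chartAt V (1 : G) 1) := by
  have h1 : ContMDiffAt (𝓘(ℝ, E).prod 𝓘(ℝ, V)) 𝓘(ℝ, V) ∞ (fun x : K × V => α x.1)
      (A, chartAt V (1 : G) 1) := (hα.comp contMDiff_fst).contMDiffAt
  have h2 : ContMDiffAt (𝓘(ℝ, E).prod 𝓘(ℝ, V)) 𝓘(ℝ, V) ∞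
      (fun x : K × V => (chartAt V (1 : G)).symm x.2) (A, chartAt V (1 : G) 1) :=
    ContMDiffAt.comp (I' := 𝓘(ℝ, V)) (A, chartAt V (1 : G) 1) contMDiffAt_chart_symm_base
      contMDiffAt_snd
  have h3 : ContMDiffAt 𝓘(ℝ, V) 𝓘(ℝ, V) ∞ (chartAt V (1 : G))
      (α A * (chartAt V (1 : G)).symm (chartAt V (1 : G) 1) * (α A)⁻¹) := by
    rw [(chartAt V (1 : G)).left_inv (mem_chart_source V 1)]
    simp only [mul_one, mul_inv_cancel]
    exact (contMDiffOn_chart (I := 𝓘(ℝ, V)) (n := ∞)).contMDiffAt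
      ((chartAt V (1 : G)).open_source.mem_nhds (mem_chart_source V 1))
  exact ContMDiffAt.comp (I' := 𝓘(ℝ, V)) (A, chartAt V (1 : G) 1) h3 ((h1.mul h2).mul h1.inv)

theorem contMDiff_adjointRep (hα : ContMDiff 𝓘(ℝ, E) 𝓘(ℝ, V) ∞ α) :
    ContMDiff 𝓘(ℝ, E) 𝓘(ℝ, V →L[ℝ] V) ∞ (adjointRep V α) := fun A =>
  ContMDiffAt.comp (I' := 𝓘(ℝ, E).prod 𝓘(ℝ, V)) A (contMDiffAt_conj_chart hα A).partial_fderiv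
    (contMDiffAt_id.prodMk contMDiffAt_const)

theorem hasFDerivAt_adjointRep (hα : ContMDiff 𝓘(ℝ, E) 𝓘(ℝ, V) ∞ α) (A : K) :
    HasFDerivAt (fun v => chartAt V (1 : G) (α A * (chartAt V (1 : G)).symm v * (α A)⁻¹))
      (adjointRep V α A) (chartAt V (1 : G) 1) := by
  have : ContMDiffAt 𝓘(ℝ, V) 𝓘(ℝ, V) ∞
      (fun v => chartAt V (1 : G) (α A * (chartAt V (1 : G)).symm v * (α A)⁻¹))
      (chartAt V (1 : G) 1) :=
    ContMDiffAt.comp (I' := 𝓘(ℝ, E).prod 𝓘(ℝ, V)) (chartAt V (1 : G) 1)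
      (f := fun v => (A, v)) (contMDiffAt_conj_chart hα A)
      (contMDiffAt_const.prodMk contMDiffAt_id)
  exact ((contMDiffAt_iff_contDiffAt.1 this).differentiableAt (by simp)).hasFDerivAt

theorem adjointRep_one : adjointRep V α 1 = ContinuousLinearMap.id ℝ V := by
  refine HasFDerivAt.fderiv ?_
  refine (hasFDerivAt_id _).congr_of_eventuallyEq ?_
  filter_upwards [(chartAt V (1 : G)).open_target.mem_nhds (mem_chart_target V 1)] with v hv
  simp [(chartAt V (1 : G)).right_inv hv]

/-- The chain rule: conjugations fix `1`, so both derivatives are taken at the same base point. -/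
theorem adjointRep_mul (hα : ContMDiff 𝓘(ℝ, E) 𝓘(ℝ, V) ∞ α) (A B : K) :
    adjointRep V α (A * B) = (adjointRep V α A).comp (adjointRep V α B) := by
  have hbase : chartAt V (1 : G) (α B * (chartAt V (1 : G)).symm (chartAt V (1 : G) 1) *
      (α B)⁻¹) = chartAt V (1 : G) 1 := by
    rw [(chartAt V (1 : G)).left_inv (mem_chart_source V 1)]; simp
  have hA := hasFDerivAt_adjointRep hα A
  rw [← hbase] at hA
  refine HasFDerivAt.fderiv ?_
  refine (hA.comp (f := fun v => chartAt V (1 : G) (α B * (chartAt V (1 : G)).symm v * (α B)⁻¹))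
    _ (hasFDerivAt_adjointRep hα B)).congr_of_eventuallyEq ?_
  have hc : ContinuousAt (fun v => α B * (chartAt V (1 : G)).symm v * (α B)⁻¹)
      (chartAt V (1 : G) 1) := by
    have : ContMDiffAt 𝓘(ℝ, V) 𝓘(ℝ, V) ∞
        (fun v => α B * (chartAt V (1 : G)).symm v * (α B)⁻¹) (chartAt V (1 : G) 1) :=
      (contMDiffAt_const.mul contMDiffAt_chart_symm_base).mul contMDiffAt_const
    exact this.continuousAt
  have hsrc : (chartAt V (1 : G)).source ∈ nhds (α B * (chartAt V (1 : G)).symm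
      (chartAt V (1 : G) 1) * (α B)⁻¹) := by
    rw [(chartAt V (1 : G)).left_inv (mem_chart_source V 1)]
    simpa using (chartAt V (1 : G)).open_source.mem_nhds (mem_chart_source V 1)
  filter_upwards [hc hsrc] with v hv
  simp only [Function.comp]
  rw [(chartAt V (1 : G)).left_inv hv]
  simp [mul_assoc]

end Averaging

/-! ### Smooth group-valued cocycles and their averages -/

section Cocycle

open MeasureTheory

universe v

variable {E K : Type*} [NormedAddCommGroup E] [NormedSpace ℝ E] [TopologicalSpace K]
  [ChartedSpace E K] [Group K] [LieGroup 𝓘(ℝ, E) ∞ K]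
  {V : Type v} [NormedAddCommGroup V] [NormedSpace ℝ V]
  {G : Type*} [Group G] [TopologicalSpace G] [ChartedSpace V G] [LieGroup 𝓘(ℝ, V) ∞ G]
  {W : Type} [NormedAddCommGroup W] [NormedSpace ℝ W]

/-- `φ` is a smooth `G`-valued cocycle for a norm-preserving action of `K` on the ball of radius
`r` of `W`, whose value at the fixed point `0` is the homomorphism `α`. -/
structure IsSmoothCocycle (α : K →* G) (act : K → W → W) (φ : K × W → G) (r : ℝ) : Prop where
  r_pos : 0 < r
  contMDiff_hom : ContMDiff 𝓘(ℝ, E) 𝓘(ℝ, V) ∞ α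
  norm_act : ∀ A y, ‖act A y‖ = ‖y‖
  contMDiffOn : ContMDiffOn (𝓘(ℝ, E).prod 𝓘(ℝ, W)) 𝓘(ℝ, V) ∞ φ (Set.univ ×ˢ Metric.ball 0 r)
  map_zero : ∀ A, φ (A, 0) = α A
  map_mul : ∀ A B y, ‖y‖ < r → φ (A * B, y) = φ (A, act B y) * φ (B, y)

namespace IsSmoothCocycle

variable {α : K →* G} {act : K → W → W} {φ : K × W → G} {r : ℝ}

variable (α φ) in
/-- The group element to be averaged, as a function of the coordinates of a point of `W × G`. -/
def twist (x : K × (W × V)) : G := φ (x.1⁻¹, x.2.1) * (chartAt V (1 : G)).symm x.2.2 * α x.1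

theorem contMDiffOn_twist (h : IsSmoothCocycle (E := E) (V := V) α act φ r) :
    ContMDiffOn (𝓘(ℝ, E).prod 𝓘(ℝ, W × V)) 𝓘(ℝ, V) ∞ (twist (V := V) α φ)
      (Set.univ ×ˢ (Metric.ball 0 r ×ˢ (chartAt V (1 : G)).target)) := by
  have hinv : ContMDiff (𝓘(ℝ, E).prod 𝓘(ℝ, W × V)) 𝓘(ℝ, E) ∞ fun x : K × (W × V) => x.1⁻¹ :=
    contMDiff_fst.inv
  have hW : ContMDiff (𝓘(ℝ, E).prod 𝓘(ℝ, W × V)) 𝓘(ℝ, W) ∞ fun x : K × (W × V) => x.2.1 :=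
    contDiff_fst.contMDiff.comp contMDiff_snd
  have hV : ContMDiff (𝓘(ℝ, E).prod 𝓘(ℝ, W × V)) 𝓘(ℝ, V) ∞ fun x : K × (W × V) => x.2.2 :=
    contDiff_snd.contMDiff.comp contMDiff_snd
  have h1 : ContMDiffOn (𝓘(ℝ, E).prod 𝓘(ℝ, W × V)) 𝓘(ℝ, V) ∞
      (fun x : K × (W × V) => φ (x.1⁻¹, x.2.1))
      (Set.univ ×ˢ (Metric.ball 0 r ×ˢ (chartAt V (1 : G)).target)) :=
    h.contMDiffOn.comp (hinv.prodMk hW).contMDiffOn fun x hx => ⟨trivial, hx.2.1⟩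
  have h2 : ContMDiffOn (𝓘(ℝ, E).prod 𝓘(ℝ, W × V)) 𝓘(ℝ, V) ∞
      (fun x : K × (W × V) => (chartAt V (1 : G)).symm x.2.2)
      (Set.univ ×ˢ (Metric.ball 0 r ×ˢ (chartAt V (1 : G)).target)) :=
    (contMDiffOn_chart_symm (I := 𝓘(ℝ, V)) (n := ∞)).comp hV.contMDiffOn fun x hx => hx.2.2
  exact (h1.mul h2).mul (h.contMDiff_hom.comp contMDiff_fst).contMDiffOn

theorem twist_base (h : IsSmoothCocycle (E := E) (V := V) α act φ r) (A : K) :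
    twist α φ (A, ((0 : W), chartAt V (1 : G) 1)) = 1 := by
  simp [twist, h.map_zero]

variable [CompactSpace K]

/-- At the base point the twist is `1` for every `A`. Compactness of `K` gives one neighbourhood on
which it stays close to `1` for all `A` at once, so that it can be read in the chart of `G` and
averaged. -/
theorem exists_twist_mem (h : IsSmoothCocycle (E := E) (V := V) α act φ r) {S : Set G}
    (hS : S ∈ nhds 1) :
    ∃ U : Set (W × V), IsOpen U ∧ (0, chartAt V (1 : G) 1) ∈ U ∧
      U ⊆ Metric.ball 0 r ×ˢ (chartAt V (1 : G)).target ∧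
      ∀ A, ∀ p ∈ U, twist α φ (A, p) ∈ S := by
  set D : Set (W × V) := Metric.ball 0 r ×ˢ (chartAt V (1 : G)).target with hD
  have hDo : IsOpen D := Metric.isOpen_ball.prod (chartAt V (1 : G)).open_target
  have hD0 : ((0 : W), chartAt V (1 : G) 1) ∈ D :=
    ⟨Metric.mem_ball_self h.r_pos, mem_chart_target V 1⟩
  have hev : ∀ᶠ p in nhds ((0 : W), chartAt V (1 : G) 1), ∀ A ∈ (Set.univ : Set K),
      twist α φ (A, p) ∈ S := by
    refine isCompact_univ.eventually_forall_of_forall_eventually fun A _ => ?_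
    have h1 : ContinuousAt (twist (V := V) α φ) (A, ((0 : W), chartAt V (1 : G) 1)) :=
      (h.contMDiffOn_twist.continuousOn).continuousAt
        ((isOpen_univ.prod hDo).mem_nhds ⟨trivial, hD0⟩)
    have h2 : ContinuousAt (fun q : (W × V) × K => twist (V := V) α φ (q.2, q.1))
        (((0 : W), chartAt V (1 : G) 1), A) :=
      ContinuousAt.comp (f := fun q : (W × V) × K => (q.2, q.1))
        (x := (((0 : W), chartAt V (1 : G) 1), A)) h1 continuous_swap.continuousAt
    refine h2 ?_
    simpa only [h.twist_base] using hS
  obtain ⟨U, hU, hUo, hU0⟩ := eventually_nhds_iff.1 (hev.and (hDo.mem_nhds hD0))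
  exact ⟨U, hUo, hU0, fun p hp => (hU p hp).2, fun A p hp => (hU p hp).1 A trivial⟩

variable (V α φ) in
/-- The vector to be averaged. -/
def integrand (x : K × (W × V)) : V :=
  adjointRep V α x.1 (chartAt V (1 : G) (twist α φ x) - chartAt V (1 : G) 1)

theorem contMDiffOn_integrand (h : IsSmoothCocycle (E := E) (V := V) α act φ r) {U : Set (W × V)}
    (hU : U ⊆ Metric.ball 0 r ×ˢ (chartAt V (1 : G)).target)
    (hU' : ∀ A, ∀ p ∈ U, twist α φ (A, p) ∈ (chartAt V (1 : G)).source) :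
    ContMDiffOn (𝓘(ℝ, E).prod 𝓘(ℝ, W × V)) 𝓘(ℝ, V) ∞ (integrand V α φ) (Set.univ ×ˢ U) := by
  have h1 : ContMDiffOn (𝓘(ℝ, E).prod 𝓘(ℝ, W × V)) 𝓘(ℝ, V) ∞
      (fun x => chartAt V (1 : G) (twist α φ x)) (Set.univ ×ˢ U) :=
    (contMDiffOn_chart (I := 𝓘(ℝ, V)) (n := ∞)).comp
      (h.contMDiffOn_twist.mono (Set.prod_mono_right hU)) fun x hx => hU' x.1 x.2 hx.2
  exact ((contMDiff_adjointRep h.contMDiff_hom).comp contMDiff_fst).contMDiffOn.clm_apply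
    (h1.sub contMDiffOn_const)

theorem integrand_apply_inr (h : IsSmoothCocycle (E := E) (V := V) α act φ r) (A : K) (v : V) :
    integrand V α φ (A, ((0 : W), v)) = adjointRep V α A
      (chartAt V (1 : G) (α A⁻¹ * (chartAt V (1 : G)).symm v * (α A⁻¹)⁻¹)
        - chartAt V (1 : G) 1) := by
  simp [integrand, twist, h.map_zero]

/-- Over the fixed point the twist is conjugation by `α A⁻¹`, whose derivative is undone by the
outer factor `adjointRep V α A`. So every integrand, and hence the average, has the identity as
fibre derivative. -/
theorem hasFDerivAt_integrand_inr (h : IsSmoothCocycle (E := E) (V := V) α act φ r) (A : K) :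
    HasFDerivAt (fun v => integrand V α φ (A, ((0 : W), v))) (ContinuousLinearMap.id ℝ V)
      (chartAt V (1 : G) 1) := by
  have h1 := (adjointRep V α A).hasFDerivAt.comp (chartAt V (1 : G) 1)
    ((hasFDerivAt_adjointRep h.contMDiff_hom A⁻¹).sub_const (chartAt V (1 : G) 1))
  rw [← adjointRep_mul h.contMDiff_hom, mul_inv_cancel, adjointRep_one] at h1
  simp only [h.integrand_apply_inr]
  exact h1

/-- By the cocycle identity, moving a point by `B` amounts to the substitution `A ↦ B⁻¹ * A`, up to
the linear factor `adjointRep V α B`. Invariance of Haar measure then makes the average equivariant.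
-/
theorem integrand_smul (h : IsSmoothCocycle (E := E) (V := V) α act φ r) (A B : K) {y : W}
    (hy : ‖y‖ < r) {v : V}
    (hg : φ (B, y) * (chartAt V (1 : G)).symm v * (α B)⁻¹ ∈ (chartAt V (1 : G)).source) :
    integrand V α φ (A, (act B y, chartAt V (1 : G)
        (φ (B, y) * (chartAt V (1 : G)).symm v * (α B)⁻¹))) =
      adjointRep V α B (integrand V α φ (B⁻¹ * A, (y, v))) := by
  simp only [integrand, twist]
  rw [(chartAt V (1 : G)).left_inv hg, ← ContinuousLinearMap.comp_apply,
    ← adjointRep_mul h.contMDiff_hom, mul_inv_cancel_left, _root_.mul_inv_rev, inv_inv,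
    h.map_mul A⁻¹ B y hy]
  simp [mul_assoc]

variable [SecondCountableTopology K] [FiniteDimensional ℝ V] [FiniteDimensional ℝ W]

/-- Averaging linearizes the twisted action of `K` on `W × G` along the second factor near the
fixed point `(0, 1)`. -/
theorem exists_average (h : IsSmoothCocycle (E := E) (V := V) α act φ r) :
    ∃ (F : W × V → V) (U : Set (W × V)), IsOpen U ∧ (0, chartAt V (1 : G) 1) ∈ U ∧
      U ⊆ Metric.ball 0 r ×ˢ (chartAt V (1 : G)).target ∧ ContDiffOn ℝ ∞ F U ∧
      F (0, chartAt V (1 : G) 1) = 0 ∧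
      (∀ v, fderiv ℝ F (0, chartAt V (1 : G) 1) (0, v) = v) ∧
      ∀ B, ∀ p ∈ U,
        φ (B, p.1) * (chartAt V (1 : G)).symm p.2 * (α B)⁻¹ ∈ (chartAt V (1 : G)).source →
        F (act B p.1, chartAt V (1 : G)
          (φ (B, p.1) * (chartAt V (1 : G)).symm p.2 * (α B)⁻¹)) = adjointRep V α B (F p) := by
  have : IsTopologicalGroup K := topologicalGroup_of_lieGroup 𝓘(ℝ, E) ∞
  let : MeasurableSpace K := borel K
  have : BorelSpace K := ⟨rfl⟩
  -- The compact group itself is the normalizing set, so the total mass is `1` and averages of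
  -- constants are unchanged.
  let μ : Measure K := Measure.haarMeasure ⊤
  have : IsProbabilityMeasure μ := ⟨Measure.haarMeasure_self⟩
  obtain ⟨U, hUo, hU0, hUD, hU⟩ := h.exists_twist_mem
    ((chartAt V (1 : G)).open_source.mem_nhds (mem_chart_source V 1))
  have hsm := h.contMDiffOn_integrand hUD hU
  have hint : ∀ p ∈ U, Integrable (fun A => integrand V α φ (A, p)) μ := fun p hp => by
    refine Continuous.integrable_of_hasCompactSupport ?_ (HasCompactSupport.of_compactSpace _)
    exact hsm.continuousOn.comp_continuous (f := fun A : K => (A, p)) (by fun_prop)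
      fun A => ⟨trivial, hp⟩
  refine ⟨fun p => ∫ A, integrand V α φ (A, p) ∂μ, U, hUo, hU0, hUD,
    contDiffOn_integral_of_contMDiffOn μ hUo hsm, ?_, fun v => ?_, fun B p hp hB => ?_⟩
  · have : ∀ A, integrand V α φ (A, ((0 : W), chartAt V (1 : G) 1)) = 0 := fun A => by
      rw [integrand, h.twist_base]; simp
    simp [this]
  · have hD := hasFDerivAt_integral_of_contMDiffOn μ hUo hsm hU0
    have hv : ∀ A, fderiv ℝ (fun q => integrand V α φ (A, q)) ((0 : W), chartAt V (1 : G) 1)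
        (0, v) = v := fun A => by
      have hd : DifferentiableAt ℝ (fun q => integrand V α φ (A, q))
          ((0 : W), chartAt V (1 : G) 1) := by
        have : ContMDiffAt 𝓘(ℝ, W × V) 𝓘(ℝ, V) ∞ (fun q => integrand V α φ (A, q))
            ((0 : W), chartAt V (1 : G) 1) :=
          ContMDiffAt.comp (I' := 𝓘(ℝ, E).prod 𝓘(ℝ, W × V)) (f := fun q => (A, q)) _
            (hsm.contMDiffAt ((isOpen_univ.prod hUo).mem_nhds ⟨trivial, hU0⟩))
            (contMDiffAt_const.prodMk contMDiffAt_id)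
        exact (contMDiffAt_iff_contDiffAt.1 this).differentiableAt (by simp)
      have h1 := hd.hasFDerivAt.comp (f := fun v => ((0 : W), v)) (chartAt V (1 : G) 1)
        (hasFDerivAt_prodMk_right (0 : W) (chartAt V (1 : G) 1))
      have h2 := h1.unique (h.hasFDerivAt_integrand_inr A)
      simpa using congrArg (fun T => T v) h2
    -- Evaluation at `(0, v)` passes under the integral, where the integrand is constantly `v`.
    rw [hD.fderiv, ContinuousLinearMap.integral_apply]
    · simp [hv]
    · refine Continuous.integrable_of_hasCompactSupport ?_ (HasCompactSupport.of_compactSpace _)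
      refine continuous_iff_continuousAt.2 fun A => ?_
      exact ContinuousAt.comp (f := fun A : K => (A, ((0 : W), chartAt V (1 : G) 1)))
        (hsm.contMDiffAt ((isOpen_univ.prod hUo).mem_nhds
          (Set.mk_mem_prod trivial hU0))).partial_fderiv.continuousAt (by fun_prop)
  · have hy : ‖p.1‖ < r := by simpa using (hUD hp).1
    simp only [h.integrand_smul _ B hy hB]
    rw [integral_mul_left_eq_self (fun A => adjointRep V α B (integrand V α φ (A, (p.1, p.2)))) B⁻¹]
    exact (adjointRep V α B).integral_comp_comm (hint p hp)

end IsSmoothCocycle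
end Cocycle

/-- A smooth map with invertible derivative at a point restricts to a homeomorphism between
neighbourhoods whose inverse is smooth. -/
theorem ContDiffOn.exists_openPartialHomeomorph {X Y : Type*} [NormedAddCommGroup X]
    [NormedSpace ℝ X] [CompleteSpace X] [NormedAddCommGroup Y] [NormedSpace ℝ Y] [CompleteSpace Y]
    {f : X → Y} {U : Set X} (hU : IsOpen U) (hf : ContDiffOn ℝ ∞ f U) {x : X} (hx : x ∈ U)
    {f' : X ≃L[ℝ] Y} (hf' : HasFDerivAt f (f' : X →L[ℝ] Y) x) :
    ∃ e : OpenPartialHomeomorph X Y, x ∈ e.source ∧ e.source ⊆ U ∧ (∀ y, e y = f y) ∧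
      ContDiffOn ℝ ∞ e.symm e.target := by
  have hat : ∀ y ∈ U, ContDiffAt ℝ ∞ f y := fun y hy => hf.contDiffAt (hU.mem_nhds hy)
  set e₀ := (hat x hx).toOpenPartialHomeomorph f hf' (by simp) with he₀
  have hcont : ContinuousAt (fderiv ℝ f) x :=
    ((hat x hx).fderiv_right (m := ∞) (by simp)).continuousAt
  -- Invertibility of the derivative is an open condition. Shrinking to where it holds makes the
  -- inverse smooth on the whole target and not only at the image of `x`.
  have hinv : ∀ᶠ y in nhds x, fderiv ℝ f y ∈ Set.range ((↑) : (X ≃L[ℝ] Y) → X →L[ℝ] Y) := by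
    refine hcont.eventually ?_
    rw [hf'.fderiv]
    exact ContinuousLinearEquiv.nhds f'
  obtain ⟨O, hO, hOo, hxO⟩ := eventually_nhds_iff.1 (hinv.and (hU.mem_nhds hx))
  refine ⟨e₀.restr O, ?_, fun y hy => ?_, fun y => rfl, fun y hy => ?_⟩
  · rw [e₀.restr_source, hOo.interior_eq]
    exact ⟨(hat x hx).mem_toOpenPartialHomeomorph_source hf' (by simp), hxO⟩
  · rw [e₀.restr_source, hOo.interior_eq] at hy
    exact (hO y hy.2).2
  · have hs := (e₀.restr O).map_target hy
    rw [e₀.restr_source, hOo.interior_eq] at hs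
    obtain ⟨⟨g', hg'⟩, hyU⟩ := hO _ hs.2
    refine (OpenPartialHomeomorph.contDiffAt_symm (e₀.restr O) (f₀' := g') hy ?_ ?_).contDiffWithinAt
    · rw [hg']
      exact ((hat _ hyU).differentiableAt (by simp)).hasFDerivAt
    · exact hat _ hyU

/-! ### Linearization of twisted actions, and smooth paths in centralizers -/

section Cocycle

universe v

variable {E K : Type*} [NormedAddCommGroup E] [NormedSpace ℝ E] [TopologicalSpace K]
  [ChartedSpace E K] [Group K] [LieGroup 𝓘(ℝ, E) ∞ K] [CompactSpace K] [SecondCountableTopology K]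
  {V : Type v} [NormedAddCommGroup V] [NormedSpace ℝ V] [FiniteDimensional ℝ V]
  {G : Type*} [Group G] [TopologicalSpace G] [ChartedSpace V G] [LieGroup 𝓘(ℝ, V) ∞ G]
  {W : Type} [NormedAddCommGroup W] [NormedSpace ℝ W] [FiniteDimensional ℝ W]

namespace IsSmoothCocycle

variable {α : K →* G} {act : K → W → W} {φ : K × W → G} {r : ℝ}

/-- `Θ` is `(y, v) ↦ (y, F (y, v))` with `F` the average. It turns the twisted action `(y, g) ↦ (B
y, φ(B, y) g α(B)⁻¹)` into the action of `B` on `W` times its adjoint action on `V`. The smaller set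
`O` consists of points whose translates under all of `K` stay in the domain of `Θ`. -/
theorem exists_linearization (h : IsSmoothCocycle (E := E) (V := V) α act φ r) :
    ∃ (Θ : OpenPartialHomeomorph (W × V) (W × V)) (O : Set (W × V)),
      Θ (0, chartAt V (1 : G) 1) = (0, 0) ∧ (∀ p, (Θ p).1 = p.1) ∧
      Θ.source ⊆ Metric.ball 0 r ×ˢ (chartAt V (1 : G)).target ∧
      ContDiffOn ℝ ∞ Θ.symm Θ.target ∧
      IsOpen O ∧ (0, chartAt V (1 : G) 1) ∈ O ∧ O ⊆ Θ.source ∧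
      ∀ B, ∀ p ∈ O,
        φ (B, p.1) * (chartAt V (1 : G)).symm p.2 * (α B)⁻¹ ∈ (chartAt V (1 : G)).source ∧
        (act B p.1, chartAt V (1 : G) (φ (B, p.1) * (chartAt V (1 : G)).symm p.2 * (α B)⁻¹)) ∈
          Θ.source ∧
        (Θ (act B p.1, chartAt V (1 : G)
          (φ (B, p.1) * (chartAt V (1 : G)).symm p.2 * (α B)⁻¹))).2 =
            adjointRep V α B (Θ p).2 := by
  have : CompleteSpace V := FiniteDimensional.complete ℝ V
  have : CompleteSpace W := FiniteDimensional.complete ℝ W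
  obtain ⟨F, U, hUo, hU0, hUD, hF, hF0, hFd, hFe⟩ := h.exists_average
  set p₀ : W × V := (0, chartAt V (1 : G) 1) with hp₀
  set T : W × V →L[ℝ] V := fderiv ℝ F p₀ with hT
  have hFat : HasFDerivAt F T p₀ :=
    ((hF.contDiffAt (hUo.mem_nhds hU0)).differentiableAt (by simp)).hasFDerivAt
  -- The fibre derivative of `F` is the identity, so the derivative of `Θ` is a unipotent triangular
  -- map and the inverse function theorem applies.
  let T' : (W × V) ≃L[ℝ] (W × V) := (ContinuousLinearEquiv.refl ℝ W).skewProd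
    (ContinuousLinearEquiv.refl ℝ V) (T.comp (ContinuousLinearMap.inl ℝ W V))
  have hT' : (T' : (W × V) →L[ℝ] (W × V)) = (ContinuousLinearMap.fst ℝ W V).prod T := by
    refine ContinuousLinearMap.ext fun p => Prod.ext rfl ?_
    have h1 : T p = T (p.1, 0) + T (0, p.2) := by rw [← map_add]; simp
    change p.2 + T (p.1, 0) = T p
    rw [h1, hFd, add_comm]
  have hΨ : HasFDerivAt (fun p : W × V => (p.1, F p)) (T' : (W × V) →L[ℝ] (W × V)) p₀ := by
    rw [hT']
    exact hasFDerivAt_fst.prodMk hFat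
  obtain ⟨Θ, hΘ0, hΘU, hΘ, hΘs⟩ := ContDiffOn.exists_openPartialHomeomorph hUo
    (contDiff_fst.contDiffOn.prodMk hF) hU0 hΨ
  obtain ⟨ε, hε, hball⟩ := Metric.isOpen_iff.1 Θ.open_source p₀ hΘ0
  set S : Set G := (chartAt V (1 : G)).source ∩ chartAt V (1 : G) ⁻¹'
    Metric.ball (chartAt V (1 : G) 1) ε with hS
  have hSn : S ∈ nhds (1 : G) :=
    ((chartAt V (1 : G)).isOpen_inter_preimage Metric.isOpen_ball).mem_nhds
      ⟨mem_chart_source V 1, Metric.mem_ball_self hε⟩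
  obtain ⟨O, hOo, hO0, -, hO⟩ := h.exists_twist_mem hSn
  refine ⟨Θ, O ∩ Θ.source ∩ (Metric.ball 0 ε ×ˢ Set.univ), by rw [hΘ, hF0], fun p => by rw [hΘ],
    fun p hp => hUD (hΘU hp), hΘs,
    (hOo.inter Θ.open_source).inter (Metric.isOpen_ball.prod isOpen_univ),
    ⟨⟨hO0, hΘ0⟩, Metric.mem_ball_self hε, trivial⟩, fun p hp => hp.1.2, fun B p hp => ?_⟩
  -- The twist at `B⁻¹` is the fibre component of the translate of `p` by `B`, so the uniform bound
  -- on twists also controls translates.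
  have hSmem := hO B⁻¹ p hp.1.1
  rw [twist, inv_inv, map_inv] at hSmem
  refine ⟨hSmem.1, hball ?_, ?_⟩
  · rw [Metric.mem_ball, Prod.dist_eq]
    refine max_lt ?_ hSmem.2
    have := hp.2.1
    simpa [hp₀, h.norm_act] using this
  · rw [hΘ, hΘ]
    exact hFe B p (hΘU hp.1.2) hSmem.1

/-- A smooth cocycle is cohomologous to a constant one near the fixed point. -/
theorem exists_smooth_trivialization (h : IsSmoothCocycle (E := E) (V := V) α act φ r) :
    ∃ (ε : ℝ) (f : W → G), 0 < ε ∧ ε ≤ r ∧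
      ContMDiffOn 𝓘(ℝ, W) 𝓘(ℝ, V) ∞ f (Metric.ball 0 ε) ∧ f 0 = 1 ∧
      ∀ A, ∀ y ∈ Metric.ball 0 ε, φ (A, y) * f y = f (act A y) * α A := by
  obtain ⟨Θ, O, hΘ0, hΘ1, hsrc, hsm, hOo, hO0, hOs, hO⟩ := h.exists_linearization
  have hsrc0 := hOs hO0
  have h0t : ((0 : W), (0 : V)) ∈ Θ.target := hΘ0 ▸ Θ.map_source hsrc0
  have hsymm0 : Θ.symm (0, 0) = (0, chartAt V (1 : G) 1) := by rw [← hΘ0, Θ.left_inv hsrc0]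
  have hcont : ContinuousAt (fun y : W => Θ.symm (y, (0 : V))) 0 :=
    ContinuousAt.comp (f := fun y : W => (y, (0 : V))) (x := 0)
      (Θ.continuousAt_symm h0t) (by fun_prop)
  have hev : ∀ᶠ y : W in nhds 0, (y, (0 : V)) ∈ Θ.target ∧ Θ.symm (y, 0) ∈ O := by
    refine Filter.Eventually.and ?_ (hcont (hOo.mem_nhds (by simpa only [hsymm0] using hO0)))
    have hc : ContinuousAt (fun y : W => (y, (0 : V))) 0 := by fun_prop
    exact hc (Θ.open_target.mem_nhds h0t)
  obtain ⟨ε, hε, hball⟩ := Metric.eventually_nhds_iff_ball.1 hev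
  -- `f` is the zero section of the linearized action. The adjoint action is linear and fixes `0`,
  -- so `f` is invariant under the twisted action, which is the asserted identity.
  refine ⟨min ε r, fun y => (chartAt V (1 : G)).symm (Θ.symm (y, 0)).2, lt_min hε h.r_pos,
    min_le_right _ _, ?_, ?_, fun A y hy => ?_⟩
  · have hmem : ∀ y ∈ Metric.ball (0 : W) (min ε r), y ∈ Metric.ball (0 : W) ε :=
      fun y hy => Metric.ball_subset_ball (min_le_left _ _) hy
    have h1 : ContMDiffOn 𝓘(ℝ, W) 𝓘(ℝ, V) ∞ (fun y : W => (Θ.symm (y, (0 : V))).2)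
        (Metric.ball 0 (min ε r)) := by
      rw [contMDiffOn_iff_contDiffOn]
      exact contDiff_snd.comp_contDiffOn (hsm.comp (contDiff_id.prodMk contDiff_const).contDiffOn
        fun y hy => (hball y (hmem y hy)).1)
    exact (contMDiffOn_chart_symm (I := 𝓘(ℝ, V)) (n := ∞)).comp h1
      fun y hy => (hsrc (hOs (hball y (hmem y hy)).2)).2
  · simp [hsymm0]
  · have hyε : y ∈ Metric.ball (0 : W) ε := Metric.ball_subset_ball (min_le_left _ _) hy
    have hAy : act A y ∈ Metric.ball (0 : W) ε := by simpa [h.norm_act] using hyε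
    obtain ⟨hyt, hyO⟩ := hball y hyε
    have hfst : ∀ y ∈ Metric.ball (0 : W) ε, (Θ.symm (y, (0 : V))).1 = y := fun y hy => by
      rw [← hΘ1, Θ.right_inv (hball y hy).1]
    obtain ⟨h1, h2, h3⟩ := hO A _ hyO
    rw [hfst y hyε, Θ.right_inv hyt] at *
    have h4 : Θ.symm (act A y, 0) = (act A y, chartAt V (1 : G) (φ (A, y) *
        (chartAt V (1 : G)).symm (Θ.symm (y, 0)).2 * (α A)⁻¹)) := by
      rw [← Θ.left_inv h2]
      congr 1
      exact Prod.ext (by rw [hΘ1]) (by rw [h3]; simp)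
    simp only [h4]
    rw [(chartAt V (1 : G)).left_inv h1]
    simp

end IsSmoothCocycle

/-- Elements of the centralizer of `α` near `1` are joined to `1` by smooth paths in the
centralizer. -/
theorem eventually_exists_smooth_path_centralizer {α : K →* G}
    (hα : ContMDiff 𝓘(ℝ, E) 𝓘(ℝ, V) ∞ α) :
    ∀ᶠ z in nhds (1 : G), z ∈ Subgroup.centralizer (Set.range α) →
      ∃ ζ : ℝ → G, ContMDiff 𝓘(ℝ, ℝ) 𝓘(ℝ, V) ∞ ζ ∧
        (∀ t, ζ t ∈ Subgroup.centralizer (Set.range α)) ∧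
        (∀ t ≤ 0, ζ t = 1) ∧ ∀ t, 1 ≤ t → ζ t = z := by
  -- The constant cocycle over a dummy line with trivial action: here the twisted action is
  -- conjugation by `α`, and its fixed points are the centralizer.
  have h : IsSmoothCocycle (E := E) (V := V) α (fun _ (y : ℝ) => y) (fun x => α x.1) 1 :=
    { r_pos := one_pos
      contMDiff_hom := hα
      norm_act := fun _ _ => rfl
      contMDiffOn := (hα.comp contMDiff_fst).contMDiffOn
      map_zero := fun _ => rfl
      map_mul := fun A B _ _ => map_mul α A B }
  obtain ⟨Θ, O, hΘ0, hΘ1, hsrc, hsm, hOo, hO0, hOs, hO⟩ := h.exists_linearization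
  have hsrc0 := hOs hO0
  have h0t : ((0 : ℝ), (0 : V)) ∈ Θ.target := hΘ0 ▸ Θ.map_source hsrc0
  have hsymm0 : Θ.symm (0, 0) = (0, chartAt V (1 : G) 1) := by rw [← hΘ0, Θ.left_inv hsrc0]
  have hev : ∀ᶠ w : V in nhds 0, ((0 : ℝ), w) ∈ Θ.target ∧ Θ.symm (0, w) ∈ O := by
    have hc : ContinuousAt (fun w : V => ((0 : ℝ), w)) 0 := by fun_prop
    refine Filter.Eventually.and (hc (Θ.open_target.mem_nhds h0t)) ?_
    have hc' : ContinuousAt (fun w : V => Θ.symm ((0 : ℝ), w)) 0 :=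
      ContinuousAt.comp (f := fun w : V => ((0 : ℝ), w)) (x := 0) (Θ.continuousAt_symm h0t) hc
    exact hc' (hOo.mem_nhds (by simpa only [hsymm0] using hO0))
  obtain ⟨δ, hδ, hball⟩ := Metric.eventually_nhds_iff_ball.1 hev
  have hchart : ContinuousAt (fun g : G => ((0 : ℝ), chartAt V (1 : G) g)) 1 :=
    continuousAt_const.prodMk ((chartAt V (1 : G)).continuousAt (mem_chart_source V 1))
  have hΘc : ContinuousAt (fun g : G => (Θ ((0 : ℝ), chartAt V (1 : G) g)).2) 1 :=
    continuousAt_snd.comp (ContinuousAt.comp (f := fun g : G => ((0 : ℝ), chartAt V (1 : G) g))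
      (x := 1) (Θ.continuousAt hsrc0) hchart)
  filter_upwards [hchart (hOo.mem_nhds hO0),
    (chartAt V (1 : G)).open_source.mem_nhds (mem_chart_source V 1),
    hΘc (Metric.ball_mem_nhds _ hδ)] with z hzO hzs hzδ hz
  simp only [Set.mem_preimage, hΘ0] at hzO hzδ
  have hcen : ∀ g : G, g ∈ Subgroup.centralizer (Set.range α) ↔ ∀ A, α A * g * (α A)⁻¹ = g :=
    fun g => by
      simp [Subgroup.mem_centralizer_iff, mul_inv_eq_iff_eq_mul]
  set w := (Θ ((0 : ℝ), chartAt V (1 : G) z)).2 with hw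
  have hΘz : Θ (0, chartAt V (1 : G) z) = (0, w) := Prod.ext (hΘ1 _) rfl
  have hwfix : ∀ A, adjointRep V α A w = w := fun A => by
    have h3 := (hO A _ hzO).2.2
    rw [(chartAt V (1 : G)).left_inv hzs, (hcen z).1 hz A] at h3
    exact h3.symm
  have hmem : ∀ t : ℝ, Real.smoothTransition t • w ∈ Metric.ball (0 : V) δ := fun t => by
    rw [mem_ball_zero_iff, norm_smul, Real.norm_of_nonneg (Real.smoothTransition.nonneg t)]
    refine lt_of_le_of_lt (mul_le_of_le_one_left (norm_nonneg _)
      (Real.smoothTransition.le_one t)) (by simpa using hzδ)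
  have hfst : ∀ w ∈ Metric.ball (0 : V) δ, (Θ.symm ((0 : ℝ), w)).1 = 0 := fun w hw => by
    rw [← hΘ1, Θ.right_inv (hball w hw).1]
  -- In the linear coordinate, being in the centralizer means being fixed by the adjoint action.
  -- This is a linear condition, so it holds along the segment from `0` to `w`;
  -- `Real.smoothTransition` makes the path stationary outside `[0, 1]`.
  refine ⟨fun t => (chartAt V (1 : G)).symm (Θ.symm (0, Real.smoothTransition t • w)).2,
    ?_, fun t => ?_, fun t ht => ?_, fun t ht => ?_⟩
  · have h1 : ContMDiff 𝓘(ℝ, ℝ) 𝓘(ℝ, V) ∞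
        (fun t : ℝ => (Θ.symm ((0 : ℝ), Real.smoothTransition t • w)).2) := by
      rw [contMDiff_iff_contDiff, ← contDiffOn_univ]
      refine contDiff_snd.comp_contDiffOn (hsm.comp (ContDiff.contDiffOn ?_)
        fun t _ => (hball _ (hmem t)).1)
      exact contDiff_const.prodMk (Real.smoothTransition.contDiff.smul contDiff_const)
    exact (contMDiffOn_chart_symm (I := 𝓘(ℝ, V)) (n := ∞)).comp_contMDiff h1
      fun t => (hsrc (hOs (hball _ (hmem t)).2)).2
  · rw [hcen]
    intro A
    obtain ⟨ht, hO'⟩ := hball _ (hmem t)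
    obtain ⟨h1, h2, h3⟩ := hO A _ hO'
    simp only [hfst _ (hmem t), Θ.right_inv ht, map_smul, hwfix] at h1 h2 h3
    have h4 : Θ.symm (0, Real.smoothTransition t • w) = (0, chartAt V (1 : G) (α A *
        (chartAt V (1 : G)).symm (Θ.symm (0, Real.smoothTransition t • w)).2 * (α A)⁻¹)) := by
      rw [← Θ.left_inv h2]
      congr 1
      exact Prod.ext (by rw [hΘ1]) (by rw [h3])
    have h5 := congrArg (fun p => (chartAt V (1 : G)).symm p.2) h4
    simp only [(chartAt V (1 : G)).left_inv h1] at h5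
    exact h5.symm
  · simp [Real.smoothTransition.zero_of_nonpos ht, hsymm0]
  · simp only [Real.smoothTransition.one_of_one_le ht, one_smul]
    rw [← hΘz, Θ.left_inv (hOs hzO), (chartAt V (1 : G)).left_inv hzs]

variable (V) in
/-- The elements of the centralizer of `α` which are joined to `1` by a smooth path. -/
def smoothlyJoined (α : K →* G) : Subgroup (Subgroup.centralizer (Set.range α)) where
  carrier := {z | ∃ ζ : ℝ → G, ContMDiff 𝓘(ℝ, ℝ) 𝓘(ℝ, V) ∞ ζ ∧
    (∀ t, ζ t ∈ Subgroup.centralizer (Set.range α)) ∧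
    (∀ t ≤ 0, ζ t = 1) ∧ ∀ t, 1 ≤ t → ζ t = z}
  one_mem' := ⟨fun _ => 1, contMDiff_const, fun _ => one_mem _, fun _ _ => rfl, fun _ _ => rfl⟩
  mul_mem' := by
    rintro z w ⟨ζ, h1, h2, h3, h4⟩ ⟨η, k1, k2, k3, k4⟩
    exact ⟨fun t => ζ t * η t, h1.mul k1, fun t => mul_mem (h2 t) (k2 t),
      fun t ht => by simp [h3 t ht, k3 t ht], fun t ht => by simp [h4 t ht, k4 t ht]⟩
  inv_mem' := by
    rintro z ⟨ζ, h1, h2, h3, h4⟩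
    exact ⟨fun t => (ζ t)⁻¹, h1.inv, fun t => inv_mem (h2 t),
      fun t ht => by simp [h3 t ht], fun t ht => by simp [h4 t ht]⟩

/-- The smoothly joined elements form a subgroup containing a neighbourhood of `1`. It is open,
hence closed, and so contains the path component of `1`. -/
theorem mem_smoothlyJoined_of_joined {α : K →* G} (hα : ContMDiff 𝓘(ℝ, E) 𝓘(ℝ, V) ∞ α)
    {z : Subgroup.centralizer (Set.range α)} (h : Joined 1 z) : z ∈ smoothlyJoined V α := by
  have : IsTopologicalGroup G := topologicalGroup_of_lieGroup 𝓘(ℝ, V) ∞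
  have hopen : IsOpen (smoothlyJoined V α : Set (Subgroup.centralizer (Set.range α))) := by
    refine Subgroup.isOpen_of_mem_nhds (g := 1) _ ?_
    have hc : ContinuousAt (Subtype.val : Subgroup.centralizer (Set.range α) → G) 1 :=
      continuous_subtype_val.continuousAt
    filter_upwards [hc.eventually (eventually_exists_smooth_path_centralizer hα)] with z hz
    exact hz z.2
  have hclopen : IsClopen (smoothlyJoined V α : Set (Subgroup.centralizer (Set.range α))) :=
    ⟨Subgroup.isClosed_of_isOpen _ hopen, hopen⟩
  exact hclopen.connectedComponent_subset (one_mem (smoothlyJoined V α))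
    (pathComponent_subset_component 1 h)

end Cocycle

/-! ### Rotations -/

namespace SO

variable {n : ℕ}

section Smooth

variable {E H M : Type*} [NormedAddCommGroup E] [NormedSpace ℝ E]
    [TopologicalSpace H] {I : ModelWithCorners ℝ E H} [TopologicalSpace M] [ChartedSpace H M]

theorem contMDiffAt_of_entry {f : M → SO n} {x : M}
    (hf : ∀ i j, ContMDiffAt I 𝓘(ℝ, ℝ) ∞ (fun y => (f y).1 i j) x) :
    ContMDiffAt I 𝓘(ℝ, Coord n) ∞ f x := by
  have hc : ContinuousAt f x := by
    refine Topology.IsInducing.subtypeVal.continuousAt_iff.2 ?_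
    exact continuousAt_pi.2 fun i => continuousAt_pi.2 fun j => (hf i j).continuousAt
  rw [contMDiffAt_iff_target]
  refine ⟨hc, ?_⟩
  have : ContMDiffAt I 𝓘(ℝ, Coord n) ∞
      (fun y => upper (cayley ((f x)⁻¹ * f y : SO n).1)) x := by
    rw [contMDiffAt_pi_space]
    intro p
    refine contMDiffAt_cayley (F := fun y => ((f x)⁻¹ * f y : SO n).1)
      (fun a b => ?_) (mem_chart_source (Coord n) (f x)) _ _
    exact contMDiffAt_matrix_mul (F := fun _ => ((f x)⁻¹).1) (F' := fun y => (f y).1)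
      (fun _ _ => contMDiffAt_const) (fun a b => hf a b) a b
  exact this

end Smooth

instance instLieGroup (n : ℕ) : LieGroup 𝓘(ℝ, Coord n) ∞ (SO n) where
  contMDiff_mul := contMDiff_of_entry fun i j _ =>
    contMDiffAt_matrix_mul (F := fun p : SO n × SO n => p.1.1) (F' := fun p => p.2.1)
      (fun a b => ((contMDiff_entry a b).comp contMDiff_fst).contMDiffAt)
      (fun a b => ((contMDiff_entry a b).comp contMDiff_snd).contMDiffAt) i j
  contMDiff_inv := contMDiff_of_entry fun i j => contMDiff_entry j i

theorem sq_entry_le_one (A : SO n) (i j : Fin n) : A.1 i j ^ 2 ≤ 1 := by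
  have h := congrFun (congrFun (mul_transpose A) i) i
  rw [Matrix.mul_apply, Matrix.one_apply_eq] at h
  rw [← h, pow_two]
  exact Finset.single_le_sum (f := fun l => A.1 i l * A.1ᵀ l i)
    (fun l _ => mul_self_nonneg (A.1 i l)) (Finset.mem_univ j)

instance instCompactSpace (n : ℕ) : CompactSpace (SO n) := by
  refine isCompact_iff_compactSpace.1 ?_
  have hK : IsCompact (Set.univ.pi fun _ : Fin n => Set.univ.pi fun _ : Fin n =>
      Set.Icc (-1 : ℝ) 1) := isCompact_univ_pi fun _ => isCompact_univ_pi fun _ => isCompact_Icc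
  refine hK.of_isClosed_subset (s := (Set.univ.pi fun _ : Fin n => Set.univ.pi fun _ : Fin n =>
      Set.Icc (-1 : ℝ) 1)) ?_ fun M hM i _ j _ => ?_
  · have : (Matrix.specialOrthogonalGroup (Fin n) ℝ : Set (Matrix (Fin n) (Fin n) ℝ)) =
        {M | M * Mᵀ = 1} ∩ {M | M.det = 1} := by
      ext M
      exact Matrix.mem_specialOrthogonalGroup_iff.trans
        (and_congr (Matrix.mem_orthogonalGroup_iff _ _) Iff.rfl)
    rw [this]
    exact (isClosed_eq (by fun_prop) continuous_const).inter
      (isClosed_eq (by fun_prop) continuous_const)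
  · exact abs_le.1 (abs_le_one_iff_mul_self_le_one.2
      (by simpa [pow_two] using sq_entry_le_one ⟨M, hM⟩ i j))

instance instSecondCountableTopology (n : ℕ) : SecondCountableTopology (SO n) := by
  have : SecondCountableTopology (Matrix (Fin n) (Fin n) ℝ) :=
    inferInstanceAs (SecondCountableTopology (Fin n → Fin n → ℝ))
  exact Topology.IsEmbedding.subtypeVal.secondCountableTopology

@[simp] theorem incl_castSucc_castSucc (A : SO n) (i j : Fin n) :
    (incl n A).1 i.castSucc j.castSucc = A.1 i j := by
  change Matrix.fromBlocks A.1 0 0 (1 : Matrix (Fin 1) (Fin 1) ℝ)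
    (finSumFinEquiv.symm i.castSucc) (finSumFinEquiv.symm j.castSucc) = _
  simp

@[simp] theorem incl_castSucc_last (A : SO n) (i : Fin n) :
    (incl n A).1 i.castSucc (Fin.last n) = 0 := by
  change Matrix.fromBlocks A.1 0 0 (1 : Matrix (Fin 1) (Fin 1) ℝ)
    (finSumFinEquiv.symm i.castSucc) (finSumFinEquiv.symm (Fin.last n)) = _
  simp

@[simp] theorem incl_last_castSucc (A : SO n) (j : Fin n) :
    (incl n A).1 (Fin.last n) j.castSucc = 0 := by
  change Matrix.fromBlocks A.1 0 0 (1 : Matrix (Fin 1) (Fin 1) ℝ)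
    (finSumFinEquiv.symm (Fin.last n)) (finSumFinEquiv.symm j.castSucc) = _
  simp

@[simp] theorem incl_last_last (A : SO n) : (incl n A).1 (Fin.last n) (Fin.last n) = 1 := by
  change Matrix.fromBlocks A.1 0 0 (1 : Matrix (Fin 1) (Fin 1) ℝ)
    (finSumFinEquiv.symm (Fin.last n)) (finSumFinEquiv.symm (Fin.last n)) = _
  simp

/-- A rotation fixing the last basis vector belongs to `SO(n) ⊂ SO(n + 1)`. -/
theorem exists_incl_eq {A : SO (n + 1)}
    (h : A.1 *ᵥ Pi.single (Fin.last n) 1 = Pi.single (Fin.last n) 1) : ∃ B : SO n, incl n B = A := by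
  have hcol : ∀ i, A.1 i (Fin.last n) = (Pi.single (Fin.last n) 1 : Fin (n + 1) → ℝ) i :=
    fun i => by rw [← h]; simp
  have hrow' : A.1ᵀ *ᵥ Pi.single (Fin.last n) 1 = Pi.single (Fin.last n) 1 := by
    conv_lhs => rw [← h]
    rw [Matrix.mulVec_mulVec, transpose_mul, Matrix.one_mulVec]
  have hrow : ∀ i, A.1 (Fin.last n) i = (Pi.single (Fin.last n) 1 : Fin (n + 1) → ℝ) i :=
    fun i => by rw [← hrow']; simp
  set B : Matrix (Fin n) (Fin n) ℝ := A.1.submatrix Fin.castSucc Fin.castSucc with hB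
  have hA : A.1 = Matrix.reindex finSumFinEquiv finSumFinEquiv
      (Matrix.fromBlocks B 0 0 (1 : Matrix (Fin 1) (Fin 1) ℝ)) := by
    ext i j
    rw [Matrix.reindex_apply, Matrix.submatrix_apply]
    refine Fin.lastCases ?_ (fun i => ?_) i <;> refine Fin.lastCases ?_ (fun j => ?_) j
    · simp [hcol]
    · simp [hrow]
    · simp [hcol]
    · simp [hB]
  have horth : Bᵀ * B = 1 := by
    have h1 := transpose_mul A
    rw [hA, Matrix.reindex_apply, Matrix.transpose_submatrix, Matrix.submatrix_mul_equiv,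
        Matrix.fromBlocks_transpose, Matrix.fromBlocks_multiply] at h1
    ext i j
    have h2 := congrFun (congrFun h1 i.castSucc) j.castSucc
    simpa [Matrix.one_apply] using h2
  have hdet : B.det = 1 := by
    have h1 := det_eq_one A
    rw [hA] at h1
    simpa using h1
  exact ⟨ofMatrix B horth hdet, Subtype.ext hA.symm⟩

/-- The matrix of the reflection in the hyperplane orthogonal to `v`. -/
def reflMatrix (v : Fin n → ℝ) : Matrix (Fin n) (Fin n) ℝ :=
  1 - (2 / (v ⬝ᵥ v)) • Matrix.vecMulVec v v

theorem reflMatrix_transpose (v : Fin n → ℝ) : (reflMatrix v)ᵀ = reflMatrix v := by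
  simp [reflMatrix, Matrix.transpose_vecMulVec]

theorem reflMatrix_mulVec (v w : Fin n → ℝ) :
    reflMatrix v *ᵥ w = w - (2 * (v ⬝ᵥ w) / (v ⬝ᵥ v)) • v := by
  rw [reflMatrix, Matrix.sub_mulVec, Matrix.one_mulVec, Matrix.smul_mulVec,
    Matrix.vecMulVec_mulVec]
  ext i
  simp; ring

theorem reflMatrix_mul_self {v : Fin n → ℝ} (hv : v ⬝ᵥ v ≠ 0) :
    reflMatrix v * reflMatrix v = 1 := by
  rw [reflMatrix, sub_mul, one_mul, mul_sub, mul_one, smul_mul_smul_comm,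
    Matrix.vecMulVec_mul_vecMulVec]
  ext i j
  simp [Matrix.vecMulVec_apply]
  field_simp
  ring

theorem det_reflMatrix {v : Fin n → ℝ} (hv : v ⬝ᵥ v ≠ 0) : (reflMatrix v).det = -1 := by
  have h := Matrix.det_one_add_replicateCol_mul_replicateRow (ι := Unit)
    (-(2 / (v ⬝ᵥ v)) • v) v
  have h2 : reflMatrix v = 1 + Matrix.replicateCol Unit (-(2 / (v ⬝ᵥ v)) • v) *
      Matrix.replicateRow Unit v := by
    ext i j
    simp [reflMatrix, Matrix.vecMulVec_apply, Matrix.mul_apply]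
    ring
  rw [h2, h, dotProduct_smul, smul_eq_mul, neg_mul, div_mul_cancel₀ _ hv]
  norm_num

/-- The rotation in the plane of `v` and `w` which is the product of two reflections. -/
def rot (v w : Fin n → ℝ) : SO n :=
  if h : v ⬝ᵥ v ≠ 0 ∧ w ⬝ᵥ w ≠ 0 then
    ofMatrix (reflMatrix v * reflMatrix w)
      (by rw [Matrix.transpose_mul, reflMatrix_transpose, reflMatrix_transpose, mul_assoc,
            ← mul_assoc (reflMatrix v), reflMatrix_mul_self h.1, one_mul, reflMatrix_mul_self h.2])
      (by rw [Matrix.det_mul, det_reflMatrix h.1, det_reflMatrix h.2]; norm_num)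
  else 1

theorem coe_rot {v w : Fin n → ℝ} (hv : v ⬝ᵥ v ≠ 0) (hw : w ⬝ᵥ w ≠ 0) :
    (rot v w).1 = reflMatrix v * reflMatrix w := by
  rw [rot, dif_pos ⟨hv, hw⟩]; rfl

/-- For vectors of equal length, the reflection along `u + w` takes `w` to `-u`, and the reflection
along `u` takes `-u` to `u`. -/
theorem rot_mulVec {u w : Fin n → ℝ} (huw : u ⬝ᵥ u = w ⬝ᵥ w) (hu : u ⬝ᵥ u ≠ 0)
    (h : (u + w) ⬝ᵥ (u + w) ≠ 0) : (rot u (u + w)).1 *ᵥ w = u := by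
  have h1 : reflMatrix (u + w) *ᵥ w = -u := by
    have : 2 * ((u + w) ⬝ᵥ w) / ((u + w) ⬝ᵥ (u + w)) = 1 := by
      rw [div_eq_one_iff_eq h]
      simp only [add_dotProduct, dotProduct_add, huw, dotProduct_comm w u]; ring
    rw [reflMatrix_mulVec, this, one_smul]; abel
  rw [coe_rot hu h, ← Matrix.mulVec_mulVec, h1, reflMatrix_mulVec]
  have : 2 * (u ⬝ᵥ -u) / (u ⬝ᵥ u) = -2 := by
    rw [dotProduct_neg]; field_simp
  rw [this, neg_smul, two_smul]; abel

theorem contMDiffAt_rot {E H M : Type*} [NormedAddCommGroup E] [NormedSpace ℝ E]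
    [TopologicalSpace H] {I : ModelWithCorners ℝ E H} [TopologicalSpace M] [ChartedSpace H M]
    {v w : M → Fin n → ℝ} {x : M} (hv : ∀ i, ContMDiffAt I 𝓘(ℝ, ℝ) ∞ (fun y => v y i) x)
    (hw : ∀ i, ContMDiffAt I 𝓘(ℝ, ℝ) ∞ (fun y => w y i) x)
    (hv0 : v x ⬝ᵥ v x ≠ 0) (hw0 : w x ⬝ᵥ w x ≠ 0) :
    ContMDiffAt I 𝓘(ℝ, Coord n) ∞ (fun y => rot (v y) (w y)) x := by
  have hdot : ∀ {v : M → Fin n → ℝ}, (∀ i, ContMDiffAt I 𝓘(ℝ, ℝ) ∞ (fun y => v y i) x) →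
      ContMDiffAt I 𝓘(ℝ, ℝ) ∞ (fun y => v y ⬝ᵥ v y) x := fun hv => by
    simp only [dotProduct]
    exact ContMDiffAt.sum fun i _ => (hv i).mul (hv i)
  have hrefl : ∀ {v : M → Fin n → ℝ}, (∀ i, ContMDiffAt I 𝓘(ℝ, ℝ) ∞ (fun y => v y i) x) →
      v x ⬝ᵥ v x ≠ 0 → ∀ i j, ContMDiffAt I 𝓘(ℝ, ℝ) ∞ (fun y => reflMatrix (v y) i j) x :=
    fun hv h0 i j => by
      simp only [reflMatrix, Matrix.sub_apply, Matrix.smul_apply, Matrix.vecMulVec_apply,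
        smul_eq_mul]
      exact contMDiffAt_const.sub ((contMDiffAt_const.div₀ (hdot hv) h0).mul ((hv i).mul (hv j)))
  refine contMDiffAt_of_entry fun i j => ?_
  refine (contMDiffAt_matrix_mul (hrefl hv hv0) (hrefl hw hw0) i j).congr_of_eventuallyEq ?_
  filter_upwards [(hdot hv).continuousAt.eventually_ne hv0,
    (hdot hw).continuousAt.eventually_ne hw0] with y h1 h2
  rw [coe_rot h1 h2]

/-- `SO(n)` acts transitively on the vectors of a given nonzero length, for `n ≥ 2`. -/
theorem exists_mulVec_eq (hn : 2 ≤ n) {u w : Fin n → ℝ} (huw : u ⬝ᵥ u = w ⬝ᵥ w)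
    (hu : u ⬝ᵥ u ≠ 0) : ∃ A : SO n, A.1 *ᵥ w = u := by
  by_cases h : (u + w) ⬝ᵥ (u + w) ≠ 0
  · exact ⟨_, rot_mulVec huw hu h⟩
  · have hw : w = -u := by
      have := dotProduct_self_eq_zero.1 (not_not.1 h)
      exact eq_neg_of_add_eq_zero_right this
    -- In the antipodal case, reflecting along a vector orthogonal to `u` does nothing to `-u`, and
    -- the reflection along `u` finishes. Such a vector needs two coordinates.
    obtain ⟨v, hv0, hv⟩ : ∃ v : Fin n → ℝ, v ⬝ᵥ v ≠ 0 ∧ v ⬝ᵥ u = 0 := by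
      let i : Fin n := ⟨0, by omega⟩
      let j : Fin n := ⟨1, by omega⟩
      have hij : i ≠ j := by simp [i, j]
      by_cases hz : u i = 0 ∧ u j = 0
      · exact ⟨Pi.single i 1, by simp, by simp [hz.1]⟩
      · refine ⟨Pi.single i (u j) - Pi.single j (u i), fun h0 => hz ?_, ?_⟩
        · have h0 := dotProduct_self_eq_zero.1 h0
          have h1 := congrFun h0 i
          have h2 := congrFun h0 j
          simp [hij, hij.symm] at h1 h2
          exact ⟨h2, h1⟩
        · simp [sub_dotProduct, mul_comm]
    refine ⟨rot u v, ?_⟩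
    rw [coe_rot hu hv0, ← Matrix.mulVec_mulVec, reflMatrix_mulVec v, hw, dotProduct_neg, hv]
    simp [reflMatrix_mulVec]
    rw [neg_div, mul_div_assoc, div_self hu, mul_one, neg_smul, two_smul]
    abel

end SO

/-! ### Geometry of the sphere -/

namespace Sph

variable {n : ℕ}

instance instSMul (n : ℕ) : SMul (SO n) (Sph n) := (Sph.instMulAction n).toSMul

/-- The coordinates of a point of the sphere other than the last one. -/
def hor (x : Sph n) : Fin n → ℝ := fun i => x.1 i.castSucc

/-- The last coordinate of a point of the sphere. -/
def height (x : Sph n) : ℝ := x.1 (Fin.last n)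

theorem ext_coord {x y : Sph n} (h : hor x = hor y) (h' : height x = height y) : x = y := by
  refine Subtype.ext (PiLp.ext fun i => ?_)
  exact Fin.lastCases h' (fun i => congrFun h i) i

theorem hor_dotProduct_add (x : Sph n) : hor x ⬝ᵥ hor x + height x ^ 2 = 1 := by
  have h := EuclideanSpace.real_norm_sq_eq x.1
  have hx : ‖x.1‖ = 1 := by simp
  rw [hx, Fin.sum_univ_castSucc] at h
  simp only [dotProduct, hor, height, ← pow_two]
  linarith

/-- The point of the sphere with given coordinates. -/
def ofCoord (v : Fin n → ℝ) (r : ℝ) (h : v ⬝ᵥ v + r ^ 2 = 1) : Sph n :=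
  ⟨WithLp.toLp 2 (Fin.snoc v r : Fin (n + 1) → ℝ), by
    have h2 : ‖WithLp.toLp 2 (Fin.snoc v r : Fin (n + 1) → ℝ)‖ ^ 2 = 1 := by
      rw [EuclideanSpace.real_norm_sq_eq, Fin.sum_univ_castSucc, ← h]
      simp [dotProduct, pow_two]
    have h3 := (pow_eq_one_iff_of_nonneg (norm_nonneg _) two_ne_zero).1 h2
    simpa using h3⟩

@[simp] theorem hor_ofCoord (v : Fin n → ℝ) (r : ℝ) (h : v ⬝ᵥ v + r ^ 2 = 1) :
    hor (ofCoord v r h) = v := by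
  funext i; simp [hor, ofCoord]

@[simp] theorem height_ofCoord (v : Fin n → ℝ) (r : ℝ) (h : v ⬝ᵥ v + r ^ 2 = 1) :
    height (ofCoord v r h) = r := by
  simp [height, ofCoord]

@[simp] theorem hor_smul (A : SO n) (x : Sph n) : hor (A • x) = A.1 *ᵥ hor x := by
  funext i
  change ((SO.incl n A).1 *ᵥ x.1.ofLp) i.castSucc = _
  simp [Matrix.mulVec, dotProduct, Fin.sum_univ_castSucc, hor]

@[simp] theorem height_smul (A : SO n) (x : Sph n) : height (A • x) = height x := by
  change ((SO.incl n A).1 *ᵥ x.1.ofLp) (Fin.last n) = _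
  simp [Matrix.mulVec, dotProduct, Fin.sum_univ_castSucc, height]

@[simp] theorem hor_southPole : hor (southPole n) = 0 := by
  funext i; simp [hor, southPole]

@[simp] theorem height_southPole : height (southPole n) = -1 := by simp [height, southPole]

@[simp] theorem hor_northPole : hor (northPole n) = 0 := by
  funext i; simp [hor, northPole]

@[simp] theorem height_northPole : height (northPole n) = 1 := by simp [height, northPole]

theorem contMDiff_coord (i : Fin (n + 1)) :
    ContMDiff (𝓡 n) 𝓘(ℝ, ℝ) ∞ fun x : Sph n => x.1 i := by
  have := Fact.mk (@finrank_euclideanSpace_fin ℝ _ (n + 1))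
  exact (EuclideanSpace.proj (𝕜 := ℝ) i).contMDiff.comp contMDiff_coe_sphere

theorem contMDiff_hor (i : Fin n) : ContMDiff (𝓡 n) 𝓘(ℝ, ℝ) ∞ fun x : Sph n => hor x i :=
  contMDiff_coord _

theorem contMDiff_height : ContMDiff (𝓡 n) 𝓘(ℝ, ℝ) ∞ (height : Sph n → ℝ) :=
  contMDiff_coord _

theorem continuous_height : Continuous (height : Sph n → ℝ) := contMDiff_height.continuous

section Smooth

variable {E H M : Type*} [NormedAddCommGroup E] [NormedSpace ℝ E]
    [TopologicalSpace H] {I : ModelWithCorners ℝ E H} [TopologicalSpace M] [ChartedSpace H M]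
    [IsManifold I ∞ M]

theorem contMDiff_of_coord {f : M → Sph n}
    (hf : ∀ i, ContMDiff I 𝓘(ℝ, ℝ) ∞ fun y => hor (f y) i)
    (hf' : ContMDiff I 𝓘(ℝ, ℝ) ∞ fun y => height (f y)) : ContMDiff I (𝓡 n) ∞ f := by
  have := Fact.mk (@finrank_euclideanSpace_fin ℝ _ (n + 1))
  have h1 : ContMDiff I 𝓘(ℝ, Fin (n + 1) → ℝ) ∞ fun y => (f y).1.ofLp := by
    rw [contMDiff_pi_space]
    intro i
    exact Fin.lastCases hf' (fun i => hf i) i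
  have h2 : ContMDiff I 𝓘(ℝ, EuclideanSpace ℝ (Fin (n + 1))) ∞ fun y => (f y).1 :=
    (EuclideanSpace.equiv (Fin (n + 1)) ℝ).symm.contDiff.contMDiff.comp h1
  exact h2.codRestrict_sphere fun y => (f y).2

end Smooth

theorem contMDiff_smul : ContMDiff (𝓘(ℝ, SO.Coord n).prod (𝓡 n)) (𝓡 n) ∞
    fun p : SO n × Sph n => p.1 • p.2 := by
  refine contMDiff_of_coord (fun i => ?_) ?_
  · simp only [hor_smul, Matrix.mulVec, dotProduct]
    exact ContMDiff.sum fun j _ => ((SO.contMDiff_entry i j).comp contMDiff_fst).mul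
      ((contMDiff_hor j).comp contMDiff_snd)
  · simp only [height_smul]
    exact contMDiff_height.comp contMDiff_snd

theorem hor_eq_zero_iff (x : Sph n) : hor x = 0 ↔ x = southPole n ∨ x = northPole n := by
  refine ⟨fun h => ?_, ?_⟩
  · have h1 := hor_dotProduct_add x
    rw [h, dotProduct_zero, zero_add] at h1
    rcases (mul_self_eq_one_iff.1 ((pow_two _).symm.trans h1)) with h1 | h1
    · exact Or.inr (ext_coord (by simp [h]) (by simp [h1]))
    · exact Or.inl (ext_coord (by simp [h]) (by simp [h1]))
  · rintro (rfl | rfl) <;> simp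

/-- The meridian through the last coordinate vector of `ℝ^(n+1)`, from the south pole (at `0`)
to the north pole (at `π`). -/
def meridian (n : ℕ) (t : ℝ) : Sph (n + 1) :=
  ofCoord (Pi.single (Fin.last n) (Real.sin t)) (-Real.cos t) (by
    simp [← pow_two])

@[simp] theorem hor_meridian (t : ℝ) :
    hor (meridian n t) = Pi.single (Fin.last n) (Real.sin t) := hor_ofCoord _ _ _

@[simp] theorem height_meridian (t : ℝ) : height (meridian n t) = -Real.cos t :=
  height_ofCoord _ _ _

theorem contMDiff_meridian : ContMDiff 𝓘(ℝ, ℝ) (𝓡 (n + 1)) ∞ (meridian n) := by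
  refine contMDiff_of_coord (fun i => ?_) ?_
  · simp only [hor_meridian]
    by_cases h : i = Fin.last n
    · subst h
      simpa using Real.contDiff_sin.contMDiff
    · simpa [h] using contMDiff_const
  · simpa only [height_meridian] using Real.contDiff_cos.neg.contMDiff

theorem meridian_zero : meridian n 0 = southPole (n + 1) := ext_coord (by simp) (by simp)

theorem meridian_pi : meridian n Real.pi = northPole (n + 1) := ext_coord (by simp) (by simp)

theorem incl_smul_meridian (B : SO n) (t : ℝ) : SO.incl n B • meridian n t = meridian n t :=
  ext_coord (by rw [hor_smul, hor_meridian, SO.incl_mulVec_single_last]) (by simp)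

/-- For `0 < t < π` the sine does not vanish, so fixing the meridian point means fixing the last
basis vector. -/
theorem exists_incl_of_smul_meridian_eq {A : SO (n + 1)} {t : ℝ} (ht : t ∈ Set.Ioo 0 Real.pi)
    (h : A • meridian n t = meridian n t) : ∃ B : SO n, SO.incl n B = A := by
  refine SO.exists_incl_eq ?_
  have h1 := congrArg hor h
  rw [hor_smul, hor_meridian] at h1
  have hs : Real.sin t ≠ 0 := (Real.sin_pos_of_mem_Ioo ht).ne'
  have h2 : (Pi.single (Fin.last n) (Real.sin t) : Fin (n + 1) → ℝ) =
      Real.sin t • Pi.single (Fin.last n) 1 := by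
    rw [← Pi.single_smul]; simp
  rw [h2, Matrix.mulVec_smul] at h1
  exact smul_right_injective _ hs h1

theorem sin_arccos_neg_height (x : Sph n) :
    Real.sin (Real.arccos (-height x)) ^ 2 = hor x ⬝ᵥ hor x := by
  have h := hor_dotProduct_add x
  have h0 : 0 ≤ hor x ⬝ᵥ hor x := Finset.sum_nonneg fun i _ => mul_self_nonneg _
  rw [Real.sin_arccos, Real.sq_sqrt (by nlinarith)]
  linarith

theorem neg_height_mem (x : Sph n) : -height x ∈ Set.Icc (-1 : ℝ) 1 := by
  have h := hor_dotProduct_add x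
  have h0 : 0 ≤ hor x ⬝ᵥ hor x := Finset.sum_nonneg fun i _ => mul_self_nonneg _
  exact ⟨by nlinarith, by nlinarith⟩

theorem arccos_neg_height_mem (x : Sph n) :
    Real.arccos (-height x) ∈ Set.Icc 0 Real.pi :=
  ⟨Real.arccos_nonneg _, Real.arccos_le_pi _⟩

theorem cos_arccos_neg_height (x : Sph n) : Real.cos (Real.arccos (-height x)) = -height x :=
  Real.cos_arccos (neg_height_mem x).1 (neg_height_mem x).2

/-- The height is the only invariant of an orbit, since rotations act transitively on each latitude
sphere. This is where `1 ≤ n` enters: `SO(1)` is trivial. -/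
theorem exists_smul_meridian_eq (hn : 1 ≤ n) (x : Sph (n + 1)) :
    ∃ A : SO (n + 1), A • meridian n (Real.arccos (-height x)) = x := by
  have hdot := sin_arccos_neg_height x
  by_cases h0 : hor x ⬝ᵥ hor x = 0
  · refine ⟨1, ext_coord ?_ ?_⟩
    · rw [h0] at hdot
      have : Real.sin (Real.arccos (-height x)) = 0 := by simpa using hdot
      rw [one_smul, hor_meridian, this, Pi.single_zero, dotProduct_self_eq_zero.1 h0]
    · rw [one_smul, height_meridian, cos_arccos_neg_height, neg_neg]
  · obtain ⟨A, hA⟩ := SO.exists_mulVec_eq (n := n + 1) (by omega) (u := hor x)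
      (w := hor (meridian n (Real.arccos (-height x)))) (by
        rw [hor_meridian, ← hdot]; simp [pow_two]) h0
    refine ⟨A, ext_coord (by rw [hor_smul, hA]) ?_⟩
    rw [height_smul, height_meridian, cos_arccos_neg_height, neg_neg]

theorem arccos_neg_height_mem_Ioo {x : Sph n} (hx : hor x ⬝ᵥ hor x ≠ 0) :
    Real.arccos (-height x) ∈ Set.Ioo 0 Real.pi := by
  have h := hor_dotProduct_add x
  have h0 : 0 < hor x ⬝ᵥ hor x :=
    lt_of_le_of_ne (Finset.sum_nonneg fun i _ => mul_self_nonneg _) hx.symm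
  refine ⟨Real.arccos_pos.2 (by nlinarith), lt_of_le_of_ne (Real.arccos_le_pi _) fun hpi => ?_⟩
  rw [Real.arccos_eq_pi] at hpi
  nlinarith

/-- Away from the poles, a point can be moved to the meridian in a locally smooth way. -/
theorem exists_smooth_polar (hn : 1 ≤ n) {x : Sph (n + 1)} (hx : hor x ⬝ᵥ hor x ≠ 0) :
    ∃ (U : Set (Sph (n + 1))) (f : Sph (n + 1) → SO (n + 1)), IsOpen U ∧ x ∈ U ∧
      ContMDiffOn (𝓡 (n + 1)) 𝓘(ℝ, SO.Coord (n + 1)) ∞ f U ∧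
      ContMDiffOn (𝓡 (n + 1)) 𝓘(ℝ, ℝ) ∞ (fun y : Sph (n + 1) => Real.arccos (-height y)) U ∧
      ∀ y ∈ U, Real.arccos (-height y) ∈ Set.Ioo 0 Real.pi ∧
        f y • meridian n (Real.arccos (-height y)) = y := by
  obtain ⟨A, hA⟩ := exists_smul_meridian_eq hn x
  -- `w y` is the meridian point at the latitude of `y`, carried by the fixed rotation `A` that
  -- suits `x`. Near `x` it is close to `hor y`, so `SO.rot` provides a smooth correction.
  set w : Sph (n + 1) → Fin (n + 1) → ℝ := fun y =>
    A.1 *ᵥ hor (meridian n (Real.arccos (-height y))) with hw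
  have hwx : w x = hor x := by rw [hw]; simp only; rw [← hor_smul, hA]
  have hwi : ∀ y i, w y i = A.1 i (Fin.last n) * Real.sin (Real.arccos (-height y)) :=
    fun y i => by simp [hw, mul_comm]
  have hww : ∀ y, w y ⬝ᵥ w y = hor y ⬝ᵥ hor y := fun y => by
    rw [hw]; simp only
    rw [Matrix.dotProduct_mulVec, ← Matrix.mulVec_transpose, Matrix.mulVec_mulVec,
      SO.transpose_mul, Matrix.one_mulVec, hor_meridian, ← sin_arccos_neg_height]
    simp [pow_two]
  have hch : ∀ i, Continuous fun y : Sph (n + 1) => hor y i := fun i =>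
    (contMDiff_hor i).continuous
  have hcw : ∀ i, Continuous fun y : Sph (n + 1) => w y i := fun i => by
    simp only [hwi]
    exact continuous_const.mul
      (Real.continuous_sin.comp (Real.continuous_arccos.comp continuous_height.neg))
  have ha : ∀ y : Sph (n + 1), hor y ⬝ᵥ hor y ≠ 0 → ContMDiffAt (𝓡 (n + 1)) 𝓘(ℝ, ℝ) ∞
      (fun y : Sph (n + 1) => Real.arccos (-height y)) y := fun y hy => by
    have h := arccos_neg_height_mem_Ioo hy
    have h1 : -height y ≠ -1 := fun h' => by rw [h', Real.arccos_neg_one] at h; exact h.2.ne rfl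
    have h2 : -height y ≠ 1 := fun h' => by rw [h', Real.arccos_one] at h; exact h.1.ne rfl
    exact ContMDiffAt.comp (I' := 𝓘(ℝ, ℝ)) (g := Real.arccos) y (Real.contDiffAt_arccos h1 h2).contMDiffAt
      contMDiff_height.neg.contMDiffAt
  refine ⟨{y | hor y ⬝ᵥ hor y ≠ 0} ∩ {y | (hor y + w y) ⬝ᵥ (hor y + w y) ≠ 0},
    fun y => SO.rot (hor y) (hor y + w y) * A, ?_, ⟨hx, ?_⟩, fun y hy => ?_,
    fun y hy => (ha y hy.1).contMDiffWithinAt, fun y hy => ⟨arccos_neg_height_mem_Ioo hy.1, ?_⟩⟩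
  · refine (isOpen_ne_fun ?_ continuous_const).inter (isOpen_ne_fun ?_ continuous_const)
    · exact continuous_finsetSum _ fun i _ => (hch i).mul (hch i)
    · exact continuous_finsetSum _ fun i _ => ((hch i).add (hcw i)).mul ((hch i).add (hcw i))
  -- At `x` the two vectors coincide and their sum is twice `hor x`.
  · simp only [Set.mem_ofPred_eq, hwx, add_dotProduct, dotProduct_add]
    intro h
    exact hx (by linarith)
  · have h1 : ∀ i, ContMDiffAt (𝓡 (n + 1)) 𝓘(ℝ, ℝ) ∞ (fun y : Sph (n + 1) => w y i) y := fun i => by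
      simp only [hwi]
      exact contMDiffAt_const.mul (ContMDiffAt.comp (I' := 𝓘(ℝ, ℝ)) (g := Real.sin) y
        Real.contDiff_sin.contMDiff.contMDiffAt (ha y hy.1))
    exact ((SO.contMDiffAt_rot (fun i => (contMDiff_hor i).contMDiffAt)
      (fun i => (contMDiff_hor i).contMDiffAt.add (h1 i)) hy.1 hy.2).mul
        contMDiffAt_const).contMDiffWithinAt
  · refine ext_coord ?_ ?_
    · rw [hor_smul]
      change ((SO.rot (hor y) (hor y + w y)).1 * A.1) *ᵥ _ = _
      rw [← Matrix.mulVec_mulVec]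
      exact SO.rot_mulVec (hww y).symm hy.1 hy.2
    · rw [height_smul, height_meridian, cos_arccos_neg_height, neg_neg]

end Sph

/-! ### Central projection at the poles -/

namespace Sph

variable {n : ℕ}

/-- The linear action of `SO(n)` on Euclidean space. -/
def rotAct (A : SO n) (y : EuclideanSpace ℝ (Fin n)) : EuclideanSpace ℝ (Fin n) :=
  WithLp.toLp 2 (A.1 *ᵥ y.ofLp)

theorem rotAct_mul (A B : SO n) (y : EuclideanSpace ℝ (Fin n)) :
    rotAct (A * B) y = rotAct A (rotAct B y) := by
  change WithLp.toLp 2 ((A.1 * B.1) *ᵥ y.ofLp) = WithLp.toLp 2 (A.1 *ᵥ (B.1 *ᵥ y.ofLp))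
  rw [Matrix.mulVec_mulVec]

theorem norm_sq_eq_dotProduct (y : EuclideanSpace ℝ (Fin n)) : ‖y‖ ^ 2 = y.ofLp ⬝ᵥ y.ofLp := by
  rw [EuclideanSpace.real_norm_sq_eq]
  simp [dotProduct, pow_two]

theorem norm_rotAct (A : SO n) (y : EuclideanSpace ℝ (Fin n)) : ‖rotAct A y‖ = ‖y‖ := by
  refine (pow_left_inj₀ (norm_nonneg _) (norm_nonneg _) two_ne_zero).1 ?_
  rw [norm_sq_eq_dotProduct, norm_sq_eq_dotProduct]
  change (A.1 *ᵥ y.ofLp) ⬝ᵥ (A.1 *ᵥ y.ofLp) = _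
  rw [Matrix.dotProduct_mulVec, ← Matrix.mulVec_transpose, Matrix.mulVec_mulVec,
    SO.transpose_mul, Matrix.one_mulVec]

theorem one_add_norm_sq_pos (y : EuclideanSpace ℝ (Fin n)) : 0 < 1 + ‖y‖ ^ 2 := by positivity

/-- Central projection of the hyperplane tangent at the pole of height `ε = ±1`. -/
def poleMap (ε : ℝ) (hε : ε ^ 2 = 1) (y : EuclideanSpace ℝ (Fin n)) : Sph n :=
  ofCoord ((√(1 + ‖y‖ ^ 2))⁻¹ • y.ofLp) (ε * (√(1 + ‖y‖ ^ 2))⁻¹) (by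
    have h := one_add_norm_sq_pos y
    rw [smul_dotProduct, dotProduct_smul, ← norm_sq_eq_dotProduct, mul_pow, hε, inv_pow,
      Real.sq_sqrt h.le, smul_eq_mul, smul_eq_mul, ← mul_assoc, ← pow_two, inv_pow,
      Real.sq_sqrt h.le]
    field_simp
    ring)

theorem contMDiff_poleMap (ε : ℝ) (hε : ε ^ 2 = 1) :
    ContMDiff 𝓘(ℝ, EuclideanSpace ℝ (Fin n)) (𝓡 n) ∞ (poleMap (n := n) ε hε) := by
  have h1 : ContDiff ℝ ∞ fun y : EuclideanSpace ℝ (Fin n) => (√(1 + ‖y‖ ^ 2))⁻¹ := by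
    refine ContDiff.inv (ContDiff.sqrt (contDiff_const.add (contDiff_norm_sq ℝ))
      fun y => (one_add_norm_sq_pos y).ne') fun y => ?_
    exact (Real.sqrt_pos.2 (one_add_norm_sq_pos y)).ne'
  refine contMDiff_of_coord (fun i => ?_) ?_
  · simp only [poleMap, hor_ofCoord]
    exact (h1.mul (EuclideanSpace.proj (𝕜 := ℝ) i).contDiff).contMDiff
  · simp only [poleMap, height_ofCoord]
    exact (contDiff_const.mul h1).contMDiff

/-- In these coordinates rotations act by linear isometries fixing `0`, as required for cocycles on
balls. -/
theorem poleMap_rotAct (ε : ℝ) (hε : ε ^ 2 = 1) (A : SO n) (y : EuclideanSpace ℝ (Fin n)) :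
    poleMap ε hε (rotAct A y) = A • poleMap ε hε y := by
  refine ext_coord ?_ ?_
  · rw [hor_smul]
    simp only [poleMap, hor_ofCoord, norm_rotAct]
    rw [Matrix.mulVec_smul]; rfl
  · rw [height_smul]
    simp only [poleMap, height_ofCoord, norm_rotAct]

/-- The inverse of the central projection `poleMap ε`. -/
def poleCoord (ε : ℝ) (x : Sph n) : EuclideanSpace ℝ (Fin n) :=
  WithLp.toLp 2 ((ε / height x) • hor x)

theorem contMDiffAt_poleCoord (ε : ℝ) {x : Sph n} (hx : height x ≠ 0) :
    ContMDiffAt (𝓡 n) 𝓘(ℝ, EuclideanSpace ℝ (Fin n)) ∞ (poleCoord ε) x := by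
  have h1 : ContMDiffAt (𝓡 n) 𝓘(ℝ, Fin n → ℝ) ∞ (fun x : Sph n => (ε / height x) • hor x) x := by
    rw [contMDiffAt_pi_space]
    intro i
    simp only [Pi.smul_apply, smul_eq_mul]
    exact (contMDiffAt_const.div₀ contMDiff_height.contMDiffAt hx).mul
      (contMDiff_hor i).contMDiffAt
  exact ContMDiffAt.comp (I' := 𝓘(ℝ, Fin n → ℝ)) x
    (EuclideanSpace.equiv (Fin n) ℝ).symm.contDiff.contMDiff.contMDiffAt h1

theorem poleCoord_smul (ε : ℝ) (A : SO n) (x : Sph n) :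
    poleCoord ε (A • x) = rotAct A (poleCoord ε x) := by
  simp only [poleCoord, rotAct, height_smul, hor_smul]
  rw [Matrix.mulVec_smul]

theorem poleMap_poleCoord (ε : ℝ) (hε : ε ^ 2 = 1) {x : Sph n} (hx : 0 < ε * height x) :
    poleMap ε hε (poleCoord ε x) = x := by
  have hh : height x ≠ 0 := by rintro h; simp [h] at hx
  have h1 : 1 + ‖poleCoord ε x‖ ^ 2 = (ε / height x) ^ 2 := by
    rw [norm_sq_eq_dotProduct, poleCoord, smul_dotProduct, dotProduct_smul, smul_eq_mul,
      smul_eq_mul, ← mul_assoc, ← pow_two, div_pow, hε]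
    field_simp
    linarith [hor_dotProduct_add x]
  have h2 : (√(1 + ‖poleCoord ε x‖ ^ 2))⁻¹ = (ε / height x)⁻¹ := by
    have : 0 ≤ ε / height x := by
      rw [← mul_div_mul_right _ _ hh]
      exact div_nonneg hx.le (mul_self_nonneg _)
    rw [h1, Real.sqrt_sq this]
  have hε0 : ε ≠ 0 := by rintro h; simp [h] at hx
  refine ext_coord ?_ ?_
  · simp only [poleMap, hor_ofCoord, h2]
    simp only [poleCoord]
    rw [smul_smul, inv_mul_cancel₀ (div_ne_zero hε0 hh), one_smul]
  · simp only [poleMap, height_ofCoord, h2]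
    field_simp

theorem poleMap_zero_neg : poleMap (n := n) (-1) (by norm_num) 0 = southPole n :=
  ext_coord (by simp [poleMap]) (by simp [poleMap])

theorem poleMap_zero_one : poleMap (n := n) 1 (by norm_num) 0 = northPole n :=
  ext_coord (by simp [poleMap]) (by simp [poleMap])

end Sph

/-! ### Sections and lifts of equivariant bundles -/

namespace EquivBundle

universe u v

variable {N : ℕ} {V : Type v} [NormedAddCommGroup V] [NormedSpace ℝ V]
  {G : Type u} [Group G] [TopologicalSpace G] [ChartedSpace V G]

instance instSMulLeft (ξ : EquivBundle N V G) : SMul (SO N) ξ.Total := ξ.leftAction.toSMul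

instance instSMulRight (ξ : EquivBundle N V G) : SMul Gᵐᵒᵖ ξ.Total := ξ.rightAction.toSMul

theorem right_mul (ξ : EquivBundle N V G) (z : ξ.Total) (g h : G) :
    z <• (g * h) = (z <• g) <• h := by
  rw [MulOpposite.op_mul, mul_smul]

theorem right_one (ξ : EquivBundle N V G) (z : ξ.Total) : z <• (1 : G) = z := by
  rw [MulOpposite.op_one, one_smul]

open Classical in
/-- The element of `G` carrying `z` to `w`, if they lie in the same fibre. -/
def div (ξ : EquivBundle N V G) (z w : ξ.Total) : G :=
  if h : ξ.proj z = ξ.proj w then (ξ.exists_right_eq h).choose else 1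

theorem right_div (ξ : EquivBundle N V G) {z w : ξ.Total} (h : ξ.proj z = ξ.proj w) :
    z <• ξ.div z w = w := by
  rw [div, dif_pos h]
  exact (ξ.exists_right_eq h).choose_spec.symm

theorem div_eq_iff (ξ : EquivBundle N V G) {z w : ξ.Total} (h : ξ.proj z = ξ.proj w) {g : G} :
    ξ.div z w = g ↔ z <• g = w :=
  ⟨fun hg => hg ▸ ξ.right_div h, fun hg => ξ.eq_of_right_eq z ((ξ.right_div h).trans hg.symm)⟩

theorem div_right (ξ : EquivBundle N V G) (z : ξ.Total) (g : G) : ξ.div z (z <• g) = g :=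
  (ξ.div_eq_iff (ξ.proj_right z g).symm).2 rfl

/-- In a trivialization, `div` is a quotient of fibre coordinates; its smoothness and continuity
follow from this formula. -/
theorem div_eq_of_trivialization (ξ : EquivBundle N V G) {e : Bundle.Trivialization G ξ.proj}
    (he : ∀ z ∈ e.source, ∀ g : G, (e (z <• g)).2 = (e z).2 * g) {z w : ξ.Total}
    (h : ξ.proj z = ξ.proj w) (hz : ξ.proj z ∈ e.baseSet) :
    ξ.div z w = (e z).2⁻¹ * (e w).2 := by
  have := he z (e.mem_source.2 hz) (ξ.div z w)
  rw [ξ.right_div h] at this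
  rw [this]; group

section Smooth

variable {E H M : Type*} [NormedAddCommGroup E] [NormedSpace ℝ E]
    [TopologicalSpace H] {I : ModelWithCorners ℝ E H} [TopologicalSpace M] [ChartedSpace H M]
    (ξ : EquivBundle N V G)

theorem contMDiffOn_right {s : M → ξ.Total} {g : M → G} {S : Set M}
    (hs : ContMDiffOn I ((𝓡 N).prod 𝓘(ℝ, V)) ∞ s S) (hg : ContMDiffOn I 𝓘(ℝ, V) ∞ g S) :
    ContMDiffOn I ((𝓡 N).prod 𝓘(ℝ, V)) ∞ (fun x => s x <• g x) S :=
  ξ.contMDiff_right.comp_contMDiffOn (hs.prodMk hg)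

theorem contMDiffOn_left {s : M → ξ.Total} {A : M → SO N} {S : Set M}
    (hA : ContMDiffOn I 𝓘(ℝ, SO.Coord N) ∞ A S)
    (hs : ContMDiffOn I ((𝓡 N).prod 𝓘(ℝ, V)) ∞ s S) :
    ContMDiffOn I ((𝓡 N).prod 𝓘(ℝ, V)) ∞ (fun x => A x • s x) S :=
  ξ.contMDiff_left.comp_contMDiffOn (hA.prodMk hs)

variable [LieGroup 𝓘(ℝ, V) ∞ G]

theorem contMDiffOn_div {s₁ s₂ : M → ξ.Total} {S : Set M}
    (h₁ : ContMDiffOn I ((𝓡 N).prod 𝓘(ℝ, V)) ∞ s₁ S)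
    (h₂ : ContMDiffOn I ((𝓡 N).prod 𝓘(ℝ, V)) ∞ s₂ S)
    (h : ∀ x ∈ S, ξ.proj (s₁ x) = ξ.proj (s₂ x)) :
    ContMDiffOn I 𝓘(ℝ, V) ∞ (fun x => ξ.div (s₁ x) (s₂ x)) S := by
  intro x hx
  obtain ⟨e, hxe, he1, -, he⟩ := ξ.locally_trivial (ξ.proj (s₁ x))
  have hat : ∀ {z : ξ.Total}, ξ.proj z ∈ e.baseSet →
      ContMDiffAt ((𝓡 N).prod 𝓘(ℝ, V)) ((𝓡 N).prod 𝓘(ℝ, V)) ∞ e z := fun hz =>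
    he1.contMDiffAt (e.open_source.mem_nhds (e.mem_source.2 hz))
  have hf : ContMDiffWithinAt I 𝓘(ℝ, V) ∞ (fun x => (e (s₁ x)).2⁻¹ * (e (s₂ x)).2) S x := by
    refine ContMDiffWithinAt.mul (ContMDiffWithinAt.inv ?_) ?_
    · exact contMDiffAt_snd.comp_contMDiffWithinAt x
        ((hat hxe).comp_contMDiffWithinAt x (h₁ x hx))
    · exact contMDiffAt_snd.comp_contMDiffWithinAt x
        ((hat (h x hx ▸ hxe)).comp_contMDiffWithinAt x (h₂ x hx))
  refine hf.congr_of_eventuallyEq_of_mem ?_ hx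
  have hc : ContinuousWithinAt (fun x => ξ.proj (s₁ x)) S x :=
    ξ.contMDiff_proj.continuous.continuousAt.comp_continuousWithinAt (h₁ x hx).continuousWithinAt
  filter_upwards [hc (e.open_baseSet.mem_nhds hxe), self_mem_nhdsWithin] with y hy hyS
  exact ξ.div_eq_of_trivialization he (h y hyS) hy

/-- Needed besides the smooth version because adapted lifts are compared on the closed interval `[0,
π]`, where at the end points only continuity is used. -/
theorem continuousOn_div {s₁ s₂ : M → ξ.Total} {S : Set M}
    (h₁ : ContinuousOn s₁ S) (h₂ : ContinuousOn s₂ S)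
    (h : ∀ x ∈ S, ξ.proj (s₁ x) = ξ.proj (s₂ x)) :
    ContinuousOn (fun x => ξ.div (s₁ x) (s₂ x)) S := by
  have : IsTopologicalGroup G := topologicalGroup_of_lieGroup 𝓘(ℝ, V) ∞
  intro x hx
  obtain ⟨e, hxe, he1, -, he⟩ := ξ.locally_trivial (ξ.proj (s₁ x))
  have hat : ∀ {z : ξ.Total}, ξ.proj z ∈ e.baseSet → ContinuousAt e z := fun hz =>
    e.continuousAt (e.mem_source.2 hz)
  have hf : ContinuousWithinAt (fun x => (e (s₁ x)).2⁻¹ * (e (s₂ x)).2) S x := by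
    refine ContinuousWithinAt.mul (ContinuousWithinAt.inv ?_) ?_
    · exact continuousAt_snd.comp_continuousWithinAt
        ((hat hxe).comp_continuousWithinAt (h₁ x hx))
    · exact continuousAt_snd.comp_continuousWithinAt
        ((hat (h x hx ▸ hxe)).comp_continuousWithinAt (h₂ x hx))
  refine hf.congr_of_eventuallyEq_of_mem ?_ hx
  have hc : ContinuousWithinAt (fun x => ξ.proj (s₁ x)) S x :=
    ξ.contMDiff_proj.continuous.continuousAt.comp_continuousWithinAt (h₁ x hx)
  filter_upwards [hc (e.open_baseSet.mem_nhds hxe), self_mem_nhdsWithin] with y hy hyS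
  exact ξ.div_eq_of_trivialization he (h y hyS) hy

end Smooth

variable [LieGroup 𝓘(ℝ, V) ∞ G] [FiniteDimensional ℝ V]

/-- Existence of equivariant sections along an equivariant map `q` near a fixed point. -/
theorem exists_equivariant_section (ξ : EquivBundle N V G) {m : ℕ} {ι : SO m →* SO N}
    (hι : ContMDiff 𝓘(ℝ, SO.Coord m) 𝓘(ℝ, SO.Coord N) ∞ ι)
    {W : Type} [NormedAddCommGroup W] [NormedSpace ℝ W] [FiniteDimensional ℝ W]
    {act : SO m → W → W} (hmul : ∀ A B y, act (A * B) y = act A (act B y))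
    (hnorm : ∀ A y, ‖act A y‖ = ‖y‖) {q : W → Sph N} (hq : ContMDiff 𝓘(ℝ, W) (𝓡 N) ∞ q)
    (hqact : ∀ A y, q (act A y) = ι A • q y) {a : ξ.Total} (ha : ξ.proj a = q 0)
    {α : SmoothHom m V G} (hα : ∀ A, ι A • a = a <• α A) :
    ∃ (ε : ℝ) (s : W → ξ.Total), 0 < ε ∧
      ContMDiffOn 𝓘(ℝ, W) ((𝓡 N).prod 𝓘(ℝ, V)) ∞ s (Metric.ball 0 ε) ∧ s 0 = a ∧
      ∀ y ∈ Metric.ball 0 ε, ξ.proj (s y) = q y ∧ ∀ A, ι A • s y = s (act A y) <• α A := by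
  obtain ⟨e, hxe, he1, he2, he⟩ := ξ.locally_trivial (q 0)
  obtain ⟨r, hr, hball⟩ := Metric.isOpen_iff.1 (e.open_baseSet.preimage hq.continuous) 0 hxe
  set g₀ : G := (e a).2 with hg₀
  have hact0 : ∀ A, act A 0 = 0 := fun A => norm_eq_zero.1 (by rw [hnorm, norm_zero])
  have hactb : ∀ A, ∀ y ∈ Metric.ball (0 : W) r, act A y ∈ Metric.ball (0 : W) r :=
    fun A y hy => by simpa [hnorm] using hy
  -- The section through `a` with constant fibre coordinate. It need not be equivariant; `φ` below
  -- measures the defect and is a cocycle with value `α` at `0`.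
  set τ : W → ξ.Total := fun y => e.toOpenPartialHomeomorph.symm (q y, g₀) with hτ
  have hτp : ∀ y ∈ Metric.ball (0 : W) r, ξ.proj (τ y) = q y := fun y hy =>
    e.proj_symm_apply' (hball hy)
  have hτe : ∀ y ∈ Metric.ball (0 : W) r, e (τ y) = (q y, g₀) := fun y hy =>
    e.apply_symm_apply' (hball hy)
  have hτ0 : τ 0 = a := by
    have ha' : a ∈ e.source := e.mem_source.2 (by rw [ha]; exact hxe)
    refine e.injOn (e.mem_source.2 ?_) ha' ?_
    · rw [hτp 0 (Metric.mem_ball_self hr)]; exact hxe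
    · change e (τ 0) = e a
      rw [hτe 0 (Metric.mem_ball_self hr)]
      exact Prod.ext (by rw [e.coe_fst ha', ha]) rfl
  have hτs : ContMDiffOn 𝓘(ℝ, W) ((𝓡 N).prod 𝓘(ℝ, V)) ∞ τ (Metric.ball 0 r) :=
    he2.comp (hq.prodMk contMDiff_const).contMDiffOn fun y hy => e.mem_target.2 (hball hy)
  set φ : SO m × W → G := fun x => g₀⁻¹ * (e (ι x.1 • τ x.2)).2 with hφ
  have hproj : ∀ A, ∀ y ∈ Metric.ball (0 : W) r, ξ.proj (ι A • τ y) = q (act A y) :=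
    fun A y hy => by rw [ξ.proj_left, hτp y hy, hqact]
  have hφτ : ∀ A, ∀ y ∈ Metric.ball (0 : W) r, ι A • τ y = τ (act A y) <• φ (A, y) :=
    fun A y hy => by
      have h1 : ξ.proj (τ (act A y)) = ξ.proj (ι A • τ y) := by
        rw [hproj A y hy, hτp _ (hactb A y hy)]
      rw [← ξ.right_div h1, ξ.div_eq_of_trivialization he h1
        (by rw [hτp _ (hactb A y hy)]; exact hball (hactb A y hy)), hτe _ (hactb A y hy)]
  have hcoc : IsSmoothCocycle (E := SO.Coord m) (V := V) α.toMonoidHom act φ r :=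
    { r_pos := hr
      contMDiff_hom := α.contMDiff_toFun
      norm_act := hnorm
      contMDiffOn := by
        refine contMDiffOn_const.mul (contMDiff_snd.comp_contMDiffOn (he1.comp
          (ξ.contMDiffOn_left (hι.comp contMDiff_fst).contMDiffOn
            (hτs.comp contMDiff_snd.contMDiffOn fun x hx => hx.2)) fun x hx => ?_))
        exact e.mem_source.2 (by rw [hproj _ _ hx.2]; exact hball (hactb _ _ hx.2))
      map_zero := fun A => by
        refine ξ.eq_of_right_eq a ?_
        have := hφτ A 0 (Metric.mem_ball_self hr)
        rw [hact0, hτ0] at this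
        rw [← this, hα]; rfl
      map_mul := fun A B y hy => by
        have hy' : y ∈ Metric.ball (0 : W) r := by simpa using hy
        refine ξ.eq_of_right_eq (τ (act (A * B) y)) ?_
        rw [← hφτ _ _ hy', map_mul, mul_smul, hφτ B y hy', ξ.left_right_comm,
          hφτ A _ (hactb B y hy'), ξ.right_mul _ (φ (A, act B y)) (φ (B, y)), hmul] }
  -- Multiplying `τ` by the solution `f` of `φ(A, y) f(y) = f(A y) α(A)` replaces the cocycle by the
  -- constant one.
  obtain ⟨ε, f, hε, hεr, hf, hf0, hfe⟩ := hcoc.exists_smooth_trivialization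
  have hsub : Metric.ball (0 : W) ε ⊆ Metric.ball 0 r := Metric.ball_subset_ball hεr
  refine ⟨ε, fun y => τ y <• f y, hε, ξ.contMDiffOn_right (hτs.mono hsub) hf, ?_,
    fun y hy => ⟨?_, fun A => ?_⟩⟩
  · simp only [hf0, hτ0]; exact ξ.right_one a
  · rw [ξ.proj_right, hτp y (hsub hy)]
  · rw [ξ.left_right_comm, hφτ A y (hsub hy), ← ξ.right_mul, hfe A y hy, ξ.right_mul]; rfl

end EquivBundle

universe u v

/-! ### Polar sections -/

section

variable {N n m : ℕ} {V : Type v} [NormedAddCommGroup V] [NormedSpace ℝ V]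
  {G : Type u} [Group G] [TopologicalSpace G] [ChartedSpace V G] [LieGroup 𝓘(ℝ, V) ∞ G]

/-- The homomorphism `A ↦ g⁻¹ α(A) g`. -/
def SmoothHom.conj (α : SmoothHom m V G) (g : G) : SmoothHom m V G where
  toFun A := g⁻¹ * α A * g
  map_one' := by simp
  map_mul' A B := by simp [mul_assoc]
  contMDiff_toFun := (contMDiff_const.mul α.contMDiff_toFun).mul contMDiff_const

theorem SmoothHom.conj_apply (α : SmoothHom m V G) (g : G) (A : SO m) :
    α.conj g A = g⁻¹ * α A * g := rfl

theorem SmoothHom.res_apply (α : SmoothHom (n + 1) V G) (A : SO n) :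
    SmoothHom.res α A = α (SO.incl n A) := rfl

theorem RepClass.mk_conj (α : SmoothHom m V G) (g : G) :
    RepClass.mk (α.conj g) = RepClass.mk α :=
  Quotient.sound ⟨g, fun A => by rw [SmoothHom.conj_apply]; group⟩

namespace EquivBundle

theorem IsIsotropyRep.right {ξ : EquivBundle N V G} {a : ξ.Total} {α : SmoothHom N V G}
    (h : ξ.IsIsotropyRep a α) (g : G) : ξ.IsIsotropyRep (a <• g) (α.conj g) := fun A => by
  rw [ξ.left_right_comm, h A, ← ξ.right_mul, ← ξ.right_mul, SmoothHom.conj_apply]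
  congr 2
  group

/-- A local section near the fixed point `x₀` on which `SO(N)` acts through `α`. -/
structure IsPolarSection (ξ : EquivBundle N V G) (x₀ : Sph N) (α : SmoothHom N V G)
    (U : Set (Sph N)) (σ : Sph N → ξ.Total) : Prop where
  isOpen : IsOpen U
  mem : x₀ ∈ U
  smul_mem : ∀ (A : SO N), ∀ x ∈ U, A • x ∈ U
  contMDiffOn : ContMDiffOn (𝓡 N) ((𝓡 N).prod 𝓘(ℝ, V)) ∞ σ U
  proj : ∀ x ∈ U, ξ.proj (σ x) = x
  smul : ∀ (A : SO N), ∀ x ∈ U, A • σ x = σ (A • x) <• α A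

namespace IsPolarSection

variable {ξ : EquivBundle N V G} {x₀ : Sph N} {α : SmoothHom N V G} {U : Set (Sph N)}
  {σ : Sph N → ξ.Total}

theorem mono (h : ξ.IsPolarSection x₀ α U σ) {U' : Set (Sph N)} (hU : IsOpen U') (hx : x₀ ∈ U')
    (hU' : ∀ (A : SO N), ∀ x ∈ U', A • x ∈ U') : ξ.IsPolarSection x₀ α (U ∩ U') σ where
  isOpen := h.isOpen.inter hU
  mem := ⟨h.mem, hx⟩
  smul_mem A x hx := ⟨h.smul_mem A x hx.1, hU' A x hx.2⟩
  contMDiffOn := h.contMDiffOn.mono Set.inter_subset_left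
  proj x hx := h.proj x hx.1
  smul A x hx := h.smul A x hx.1

theorem right (h : ξ.IsPolarSection x₀ α U σ) (g : G) :
    ξ.IsPolarSection x₀ (α.conj g) U (fun x => σ x <• g) where
  isOpen := h.isOpen
  mem := h.mem
  smul_mem := h.smul_mem
  contMDiffOn := ξ.contMDiffOn_right h.contMDiffOn contMDiffOn_const
  proj x hx := by rw [ξ.proj_right, h.proj x hx]
  smul A x hx := by
    rw [ξ.left_right_comm, h.smul A x hx, ← ξ.right_mul, ← ξ.right_mul, SmoothHom.conj_apply]
    congr 2
    group

end IsPolarSection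

/-- An equivariant section in the coordinates of central projection. Its domain is cut out of a
hemisphere by a ball in these coordinates, and rotations preserve both height and norm. -/
theorem exists_isPolarSection [FiniteDimensional ℝ V] (ξ : EquivBundle N V G) {ε : ℝ}
    (hε : ε ^ 2 = 1) {a : ξ.Total} (ha : ξ.proj a = Sph.poleMap ε hε 0) {α : SmoothHom N V G}
    (hα : ξ.IsIsotropyRep a α) :
    ∃ U σ, ξ.IsPolarSection (Sph.poleMap ε hε 0) α U σ ∧ σ (Sph.poleMap ε hε 0) = a := by
  obtain ⟨δ, s, hδ, hs, hs0, hsA⟩ := ξ.exists_equivariant_section (ι := MonoidHom.id (SO N))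
    contMDiff_id Sph.rotAct_mul Sph.norm_rotAct (Sph.contMDiff_poleMap ε hε)
    (Sph.poleMap_rotAct ε hε) ha hα
  have hopen : IsOpen {x : Sph N | 0 < ε * Sph.height x} :=
    isOpen_lt continuous_const (continuous_const.mul Sph.continuous_height)
  have hne : ∀ x : Sph N, 0 < ε * Sph.height x → Sph.height x ≠ 0 := fun x hx h => by
    simp [h] at hx
  have hsm : ContMDiffOn (𝓡 N) 𝓘(ℝ, EuclideanSpace ℝ (Fin N)) ∞ (Sph.poleCoord ε)
      {x : Sph N | 0 < ε * Sph.height x} := fun x hx =>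
    (Sph.contMDiffAt_poleCoord ε (hne x hx)).contMDiffWithinAt
  have hor0 : Sph.hor (Sph.poleMap (n := N) ε hε 0) = 0 := by simp [Sph.poleMap]
  have hc0 : Sph.poleCoord ε (Sph.poleMap (n := N) ε hε 0) = 0 := by
    rw [Sph.poleCoord, hor0]; simp
  refine ⟨{x | 0 < ε * Sph.height x} ∩ Sph.poleCoord ε ⁻¹' Metric.ball 0 δ,
    fun x => s (Sph.poleCoord ε x),
    { isOpen := hsm.continuousOn.isOpen_inter_preimage hopen Metric.isOpen_ball
      mem := ⟨?_, ?_⟩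
      smul_mem := fun A x hx => ⟨?_, ?_⟩
      contMDiffOn := hs.comp (hsm.mono Set.inter_subset_left) fun x hx => hx.2
      proj := fun x hx => ?_
      smul := fun A x hx => ?_ }, ?_⟩
  · simp [Sph.poleMap, ← pow_two, hε]
  · rw [Set.mem_preimage, hc0]; exact Metric.mem_ball_self hδ
  · simpa using hx.1
  · have := hx.2
    simpa [Sph.poleCoord_smul, Sph.norm_rotAct] using this
  · rw [(hsA _ hx.2).1, Sph.poleMap_poleCoord ε hε hx.1]
  · rw [Sph.poleCoord_smul]
    exact (hsA _ hx.2).2 A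
  · simp only [hc0, hs0]

/-! ### Lifts of the meridian -/

/-- A smooth lift of the meridian on which `SO(n)` acts through `γ`. -/
structure IsLift (ξ : EquivBundle (n + 1) V G) (γ : SmoothHom n V G) (S : Set ℝ)
    (s : ℝ → ξ.Total) : Prop where
  contMDiffOn : ContMDiffOn 𝓘(ℝ, ℝ) ((𝓡 (n + 1)).prod 𝓘(ℝ, V)) ∞ s S
  proj : ∀ t ∈ S, ξ.proj (s t) = Sph.meridian n t
  smul : ∀ B, ∀ t ∈ S, SO.incl n B • s t = s t <• γ B

theorem IsLift.mono {ξ : EquivBundle (n + 1) V G} {γ : SmoothHom n V G} {S S' : Set ℝ}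
    {s : ℝ → ξ.Total} (h : ξ.IsLift γ S s) (hS : S' ⊆ S) : ξ.IsLift γ S' s :=
  ⟨h.contMDiffOn.mono hS, fun t ht => h.proj t (hS ht), fun B t ht => h.smul B t (hS ht)⟩

/-- The isotropy representation of the subgroup `SO(n)` alone; this is all that is available over an
interior point of the meridian. -/
theorem exists_isotropy_incl (ξ : EquivBundle (n + 1) V G) (a : ξ.Total)
    (ha : ∀ B : SO n, SO.incl n B • ξ.proj a = ξ.proj a) :
    ∃ γ : SmoothHom n V G, ∀ B, SO.incl n B • a = a <• γ B := by
  have hp : ∀ B : SO n, ξ.proj a = ξ.proj (SO.incl n B • a) := fun B => by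
    rw [ξ.proj_left, ha]
  have hd : ∀ B : SO n, a <• ξ.div a (SO.incl n B • a) = SO.incl n B • a := fun B =>
    ξ.right_div (hp B)
  refine ⟨{ toFun := fun B => ξ.div a (SO.incl n B • a), map_one' := ?_, map_mul' := ?_,
            contMDiff_toFun := ?_ }, fun B => (hd B).symm⟩
  · refine (ξ.div_eq_iff (hp 1)).2 ?_
    rw [map_one, one_smul, ξ.right_one]
  · intro A B
    refine (ξ.div_eq_iff (hp _)).2 ?_
    rw [ξ.right_mul, hd A, ← ξ.left_right_comm, hd B, map_mul, mul_smul]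
  · rw [← contMDiffOn_univ]
    exact ξ.contMDiffOn_div contMDiffOn_const (ξ.contMDiffOn_left
      (SO.contMDiff_incl n).contMDiffOn contMDiffOn_const) fun B _ => hp B

/-- The case of the trivial action of `SO(n)` on a line. The homomorphism `γ` depends on `t₀`;
`IsLift.extend` later adjusts the lift to the prescribed one. -/
theorem exists_isLift_near [FiniteDimensional ℝ V] (ξ : EquivBundle (n + 1) V G) (t₀ : ℝ) :
    ∃ (ε : ℝ) (γ : SmoothHom n V G) (s : ℝ → ξ.Total), 0 < ε ∧
      ξ.IsLift γ (Set.Ioo (t₀ - ε) (t₀ + ε)) s := by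
  obtain ⟨a, ha⟩ := ξ.exists_proj_eq (Sph.meridian n t₀)
  obtain ⟨γ, hγ⟩ := ξ.exists_isotropy_incl a fun B => by rw [ha, Sph.incl_smul_meridian]
  obtain ⟨ε, s, hε, hs, -, hsA⟩ := ξ.exists_equivariant_section (SO.contMDiff_incl n)
    (act := fun _ (y : ℝ) => y) (fun _ _ _ => rfl) (fun _ _ => rfl)
    (q := fun y => Sph.meridian n (t₀ + y))
    (Sph.contMDiff_meridian.comp (contDiff_const.add contDiff_id).contMDiff)
    (fun A y => (Sph.incl_smul_meridian A _).symm) (by rw [ha, add_zero]) hγ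
  have hmem : ∀ t ∈ Set.Ioo (t₀ - ε) (t₀ + ε), t - t₀ ∈ Metric.ball (0 : ℝ) ε := fun t ht => by
    rw [mem_ball_zero_iff, Real.norm_eq_abs, abs_lt]
    exact ⟨by linarith [ht.1], by linarith [ht.2]⟩
  refine ⟨ε, γ, fun t => s (t - t₀), hε, hs.comp
    (contDiff_id.sub contDiff_const).contMDiff.contMDiffOn hmem, fun t ht => ?_, fun B t ht => ?_⟩
  · rw [(hsA _ (hmem t ht)).1]; congr 1; ring
  · exact (hsA _ (hmem t ht)).2 B

/-- The identity for `t ≤ a`, the constant `b` for `t ≥ b`. -/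
def freeze (a b t : ℝ) : ℝ := t + Real.smoothTransition ((t - a) / (b - a)) * (b - t)

theorem contDiff_freeze (a b : ℝ) : ContDiff ℝ ∞ (freeze a b) := by
  unfold freeze
  exact contDiff_id.add ((Real.smoothTransition.contDiff.comp
    ((contDiff_id.sub contDiff_const).div_const _)).mul (contDiff_const.sub contDiff_id))

theorem freeze_of_le {a b t : ℝ} (hab : a < b) (ht : t ≤ a) : freeze a b t = t := by
  rw [freeze, Real.smoothTransition.zero_of_nonpos
    (div_nonpos_of_nonpos_of_nonneg (by linarith) (by linarith))]
  simp

theorem freeze_of_ge {a b t : ℝ} (hab : a < b) (ht : b ≤ t) : freeze a b t = b := by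
  rw [freeze, Real.smoothTransition.one_of_one_le
    ((one_le_div (by linarith)).2 (by linarith))]
  ring

theorem freeze_mem {a b t : ℝ} (hab : a < b) (hat : a ≤ t) : freeze a b t ∈ Set.Icc a b := by
  rcases le_total b t with h | h
  · rw [freeze_of_ge hab h]; exact ⟨hab.le, le_rfl⟩
  · have h0 := Real.smoothTransition.nonneg ((t - a) / (b - a))
    have h1 := Real.smoothTransition.le_one ((t - a) / (b - a))
    rw [freeze]
    constructor <;> nlinarith

/-- On the overlap `s = s' z`, and `z` intertwines `γ` with `γ'`. Freezing the argument of `z` at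
`b` yields a lift equal to `s` up to `a` and to `s'` times the constant `z b` from `b` on. Right
multiplication by `z` also turns `γ'` into `γ`. -/
theorem IsLift.extend {ξ : EquivBundle (n + 1) V G} {γ γ' : SmoothHom n V G} {s s' : ℝ → ξ.Total}
    {p q p' q' a b : ℝ} (hs : ξ.IsLift γ (Set.Ioo p q) s) (hs' : ξ.IsLift γ' (Set.Ioo p' q') s')
    (hp : p ≤ p') (hpa : p' < a) (hab : a < b) (hbq : b < q) (hq : q ≤ q') :
    ∃ (s'' : ℝ → ξ.Total) (g : G), ξ.IsLift γ (Set.Ioo p q') s'' ∧ (∀ t ≤ a, s'' t = s t) ∧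
      ∀ t, b ≤ t → s'' t = s' t <• g := by
  classical
  set z : ℝ → G := fun t => ξ.div (s' t) (s t) with hz
  have hpz : ∀ t ∈ Set.Ioo p' q, ξ.proj (s' t) = ξ.proj (s t) := fun t ht => by
    rw [hs.proj t ⟨hp.trans_lt ht.1, ht.2⟩, hs'.proj t ⟨ht.1, ht.2.trans_le hq⟩]
  have hzs : ∀ t ∈ Set.Ioo p' q, s' t <• z t = s t := fun t ht => ξ.right_div (hpz t ht)
  have hzsm : ContMDiffOn 𝓘(ℝ, ℝ) 𝓘(ℝ, V) ∞ z (Set.Ioo p' q) :=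
    ξ.contMDiffOn_div (hs'.contMDiffOn.mono (Set.Ioo_subset_Ioo_right hq))
      (hs.contMDiffOn.mono (Set.Ioo_subset_Ioo_left hp)) hpz
  have hzγ : ∀ t ∈ Set.Ioo p' q, ∀ B, γ' B * z t = z t * γ B := fun t ht B => by
    refine ξ.eq_of_right_eq (s' t) ?_
    rw [ξ.right_mul, ξ.right_mul, hzs t ht, ← hs.smul B t ⟨hp.trans_lt ht.1, ht.2⟩,
      ← hs'.smul B t ⟨ht.1, ht.2.trans_le hq⟩, ← ξ.left_right_comm, hzs t ht]
  -- The frozen argument never leaves the overlap, the only place where `z` is controlled.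
  have hfr : ∀ t, p' < t → freeze a b t ∈ Set.Ioo p' q := fun t ht => by
    rcases le_total t a with h | h
    · rw [freeze_of_le hab h]; exact ⟨ht, by linarith⟩
    · have := freeze_mem hab h
      exact ⟨hpa.trans_le this.1, this.2.trans_lt hbq⟩
  set r : ℝ → ξ.Total := fun t => s' t <• z (freeze a b t) with hr
  have hrs : ∀ t, p' < t → t ≤ a → r t = s t := fun t ht hta => by
    simp only [hr]
    rw [freeze_of_le hab hta, hzs t ⟨ht, by linarith⟩]
  set s'' : ℝ → ξ.Total := fun t => if t ≤ a then s t else r t with hs''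
  have hl : ∀ t ≤ a, s'' t = s t := fun t ht => if_pos ht
  have hrr : ∀ t, p' < t → s'' t = r t := fun t ht => by
    by_cases hta : t ≤ a
    · rw [hl t hta, hrs t ht hta]
    · exact if_neg hta
  have hrsm : ContMDiffOn 𝓘(ℝ, ℝ) ((𝓡 (n + 1)).prod 𝓘(ℝ, V)) ∞ r (Set.Ioo p' q') :=
    ξ.contMDiffOn_right hs'.contMDiffOn
      (hzsm.comp (contDiff_freeze a b).contMDiff.contMDiffOn fun t ht => hfr t ht.1)
  refine ⟨s'', z b, ⟨fun t ht => ?_, fun t ht => ?_, fun B t ht => ?_⟩, hl, fun t ht => ?_⟩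
  · rcases lt_or_ge t a with hta | hta
    · refine ((hs.contMDiffOn.contMDiffAt (Ioo_mem_nhds ht.1 (by linarith))).congr_of_eventuallyEq
        ?_).contMDiffWithinAt
      filter_upwards [Iio_mem_nhds hta] with t' ht' using hl t' (le_of_lt ht')
    · refine ((hrsm.contMDiffAt (Ioo_mem_nhds (hpa.trans_le hta) ht.2)).congr_of_eventuallyEq
        ?_).contMDiffWithinAt
      filter_upwards [Ioi_mem_nhds (hpa.trans_le hta)] with t' ht' using hrr t' ht'
  · rcases lt_or_ge t a with hta | hta
    · rw [hl t hta.le, hs.proj t ⟨ht.1, by linarith⟩]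
    · rw [hrr t (hpa.trans_le hta), hr]
      simp only [ξ.proj_right]
      exact hs'.proj t ⟨hpa.trans_le hta, ht.2⟩
  · rcases lt_or_ge t a with hta | hta
    · rw [hl t hta.le, hs.smul B t ⟨ht.1, by linarith⟩]
    · have hpt := hpa.trans_le hta
      rw [hrr t hpt, hr]
      simp only
      rw [ξ.left_right_comm, hs'.smul B t ⟨hpt, ht.2⟩, ← ξ.right_mul,
        hzγ _ (hfr t hpt), ξ.right_mul]
  · rw [hrr t (by linarith), hr]
    simp only [freeze_of_ge hab ht]

/-- If the reachable end points were bounded, a local lift around their supremum could be spliced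
on, leading beyond it. -/
theorem IsLift.exists_extension [FiniteDimensional ℝ V] {ξ : EquivBundle (n + 1) V G}
    {γ : SmoothHom n V G} {s : ℝ → ξ.Total} {p q a : ℝ} (hs : ξ.IsLift γ (Set.Ioo p q) s)
    (hpa : p < a) (haq : a < q) (T : ℝ) :
    ∃ s', ξ.IsLift γ (Set.Ioo p T) s' ∧ ∀ t ≤ a, s' t = s t := by
  set good : Set ℝ := {T | ∃ s', ξ.IsLift γ (Set.Ioo p T) s' ∧ ∀ t ≤ a, s' t = s t} with hgood
  have hdown : ∀ T ∈ good, ∀ T' ≤ T, T' ∈ good := fun T ⟨s', h1, h2⟩ T' hT' =>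
    ⟨s', h1.mono (Set.Ioo_subset_Ioo_right hT'), h2⟩
  have hq : q ∈ good := ⟨s, hs, fun _ _ => rfl⟩
  by_contra hT
  have hbdd : BddAbove good := ⟨T, fun T' hT' => le_of_not_ge fun h => hT (hdown T' hT' T h)⟩
  have hqS : q ≤ sSup good := le_csSup hbdd hq
  obtain ⟨ε, γ', s', hε, hs'⟩ := ξ.exists_isLift_near (sSup good)
  -- Splicing only to the right of `a` preserves the agreement with `s` up to `a`.
  set p' := max (sSup good - ε) a with hp'
  have hp'S : p' < sSup good := max_lt (by linarith) (by linarith)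
  obtain ⟨T', ⟨s₁, h1, h2⟩, hT'⟩ := exists_lt_of_lt_csSup ⟨q, hq⟩ hp'S
  obtain ⟨m, hm1, hm2⟩ := exists_between hT'
  obtain ⟨m', hm1', hm2'⟩ := exists_between hm2
  have hT'S : T' ≤ sSup good := le_csSup hbdd ⟨s₁, h1, h2⟩
  obtain ⟨s₂, g, h3, h4, -⟩ := h1.extend
    (hs'.mono (Set.Ioo_subset_Ioo_left (le_max_left _ _ : sSup good - ε ≤ p')))
    (hpa.le.trans (le_max_right _ _)) hm1 hm1' hm2' (by linarith)
  have : sSup good + ε ∈ good := ⟨s₂, h3, fun t ht => by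
    rw [h4 t (ht.trans ((le_max_right _ _).trans hm1.le)), h2 t ht]⟩
  linarith [le_csSup hbdd this]

/-- A lift of the meridian from pole to pole which is compatible with equivariant local sections
near both poles. -/
structure IsAdapted (ξ : EquivBundle (n + 1) V G) (α β : SmoothHom (n + 1) V G)
    (s : ℝ → ξ.Total) : Prop where
  lift : ξ.IsLift (SmoothHom.res α) (Set.Ioo 0 Real.pi) s
  south : ∃ U σ, ξ.IsPolarSection (southPole (n + 1)) α U σ ∧
    ∀ t ∈ Set.Icc 0 Real.pi, Sph.meridian n t ∈ U → s t = σ (Sph.meridian n t)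
  north : ∃ U σ, ξ.IsPolarSection (northPole (n + 1)) β U σ ∧
    ∀ t ∈ Set.Icc 0 Real.pi, Sph.meridian n t ∈ U → s t = σ (Sph.meridian n t)

theorem IsPolarSection.isLift {ξ : EquivBundle (n + 1) V G} {x₀ : Sph (n + 1)}
    {α : SmoothHom (n + 1) V G} {U : Set (Sph (n + 1))} {σ : Sph (n + 1) → ξ.Total}
    (h : ξ.IsPolarSection x₀ α U σ) {S : Set ℝ} (hS : ∀ t ∈ S, Sph.meridian n t ∈ U) :
    ξ.IsLift (SmoothHom.res α) S (fun t => σ (Sph.meridian n t)) where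
  contMDiffOn := h.contMDiffOn.comp Sph.contMDiff_meridian.contMDiffOn hS
  proj t ht := h.proj _ (hS t ht)
  smul B t ht := by
    rw [h.smul _ _ (hS t ht), Sph.incl_smul_meridian]; rfl

/-- Every equivariant bundle has an adapted lift starting from a given point over the south
pole. -/
theorem exists_isAdapted [FiniteDimensional ℝ V] (ξ : EquivBundle (n + 1) V G) {a : ξ.Total}
    (ha : ξ.proj a = southPole (n + 1)) {α : SmoothHom (n + 1) V G} (hα : ξ.IsIsotropyRep a α) :
    ∃ β s, ξ.IsAdapted α β s := by
  have hpi := Real.pi_pos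
  obtain ⟨U, σ, hσ, -⟩ := ξ.exists_isPolarSection (ε := -1) (by norm_num)
    (ha.trans Sph.poleMap_zero_neg.symm) hα
  obtain ⟨β₀, b₀, hb₀, hβ₀⟩ := ξ.exists_isIsotropyRep_over (northPole (n + 1)) smul_northPole
  obtain ⟨U', σ', hσ', -⟩ := ξ.exists_isPolarSection (ε := 1) (by norm_num)
    (hb₀.trans Sph.poleMap_zero_one.symm) hβ₀
  rw [Sph.poleMap_zero_neg] at hσ
  rw [Sph.poleMap_zero_one] at hσ'
  have hcont := (Sph.contMDiff_meridian (n := n)).continuous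
  obtain ⟨δ, hδ, hδU⟩ := Metric.isOpen_iff.1 (hσ.isOpen.preimage hcont) 0
    (by rw [Set.mem_preimage, Sph.meridian_zero]; exact hσ.mem)
  obtain ⟨δ', hδ', hδU'⟩ := Metric.isOpen_iff.1 (hσ'.isOpen.preimage hcont) Real.pi
    (by rw [Set.mem_preimage, Sph.meridian_pi]; exact hσ'.mem)
  rw [Real.ball_eq_Ioo] at hδU hδU'
  rw [zero_sub, zero_add] at hδU
  -- Up to `c` the lift follows the southern polar section. All splicing with the northern one takes
  -- place to the right of `c`.
  set c := min (δ / 2) (Real.pi / 2) with hc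
  have hc0 : 0 < c := lt_min (by linarith) (by linarith)
  have hcδ : c < δ := (min_le_left _ _).trans_lt (by linarith)
  have hcpi : c < Real.pi := (min_le_right _ _).trans_lt (by linarith)
  obtain ⟨s₁, hs₁, hs₁'⟩ := (hσ.isLift (fun t ht => hδU ht)).exists_extension
    (by linarith) hcδ Real.pi
  set p' := max (Real.pi - δ') c with hp'
  have hp'pi : p' < Real.pi := max_lt (by linarith) hcpi
  obtain ⟨m, hm1, hm2⟩ := exists_between hp'pi
  obtain ⟨m', hm1', hm2'⟩ := exists_between hm2
  have hcp : c ≤ p' := le_max_right _ _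
  obtain ⟨s, g, hs, hsl, hsr⟩ := hs₁.extend
    ((hσ'.isLift (fun t ht => hδU' ht)).mono
      (Set.Ioo_subset_Ioo_left (le_max_left _ _ : Real.pi - δ' ≤ p')))
    (by linarith) hm1 hm1' hm2' (by linarith)
  -- The splice multiplies the northern section by `g`, which conjugates its isotropy. The domains
  -- are cut down by height to rotation-invariant sets over which the lift really follows the
  -- sections.
  refine ⟨β₀.conj g, s, hs.mono (Set.Ioo_subset_Ioo (by linarith) (by linarith)),
    ⟨_, σ, hσ.mono (U' := {x | Sph.height x < -Real.cos c})
      (isOpen_lt Sph.continuous_height continuous_const) ?_ (fun A x hx => by simpa using hx),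
      fun t ht htU => ?_⟩,
    ⟨_, _, (hσ'.right g).mono (U' := {x | -Real.cos m' < Sph.height x})
      (isOpen_lt continuous_const Sph.continuous_height) ?_ (fun A x hx => by simpa using hx),
      fun t ht htU => ?_⟩⟩
  · have := Real.cos_lt_cos_of_nonneg_of_le_pi le_rfl hcpi.le hc0
    simpa using this
  · have h1 : -Real.cos t < -Real.cos c := by simpa using htU.2
    have h2 : t < c := by
      by_contra h
      have := Real.cos_le_cos_of_nonneg_of_le_pi hc0.le ht.2 (not_lt.1 h)
      linarith
    rw [hsl t (by linarith), hs₁' t h2.le]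
  · have := Real.cos_lt_cos_of_nonneg_of_le_pi (by linarith) le_rfl hm2'
    rw [Real.cos_pi] at this
    simp only [Set.mem_ofPred_eq, Sph.height_northPole]
    linarith
  · have h1 : -Real.cos m' < -Real.cos t := by simpa using htU.2
    have h2 : m' < t := by
      by_contra h
      have := Real.cos_le_cos_of_nonneg_of_le_pi ht.1 hm2'.le (not_lt.1 h)
      linarith
    exact hsr t h2.le

end EquivBundle
end

/-! ### Comparison of two bundles along adapted lifts -/

section

variable {n : ℕ} {V : Type v} [NormedAddCommGroup V] [NormedSpace ℝ V]
  {G : Type u} [Group G] [TopologicalSpace G] [ChartedSpace V G] [LieGroup 𝓘(ℝ, V) ∞ G]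

theorem Sph.exists_neg_height_arccos (hn : 1 ≤ n) (x : Sph (n + 1)) :
    ∃ (A : SO (n + 1)), ∃ t ∈ Set.Icc 0 Real.pi, A • Sph.meridian n t = x :=
  (Sph.exists_smul_meridian_eq hn x).imp fun _ hA => ⟨_, Sph.arccos_neg_height_mem x, hA⟩

theorem Sph.arccos_neg_height_smul_meridian (A : SO (n + 1)) {t : ℝ}
    (ht : t ∈ Set.Icc 0 Real.pi) :
    Real.arccos (-Sph.height (A • Sph.meridian n t)) = t := by
  rw [Sph.height_smul, Sph.height_meridian, neg_neg, Real.arccos_cos ht.1 ht.2]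

namespace EquivBundle

namespace IsPolarSection

variable {N : ℕ} {ξ : EquivBundle N V G} {x₀ : Sph N} {α : SmoothHom N V G} {U : Set (Sph N)}
  {σ : Sph N → ξ.Total}

theorem apply_smul (h : ξ.IsPolarSection x₀ α U σ) (A : SO N) {x : Sph N} (hx : x ∈ U) :
    σ (A • x) = (A • σ x) <• (α A)⁻¹ := by
  rw [h.smul A x hx, ← ξ.right_mul, mul_inv_cancel, ξ.right_one]

theorem isIsotropyRep (h : ξ.IsPolarSection x₀ α U σ) (hx₀ : ∀ A : SO N, A • x₀ = x₀) :
    ξ.IsIsotropyRep (σ x₀) α := fun A => by rw [h.smul A x₀ h.mem, hx₀]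

end IsPolarSection

namespace IsAdapted

variable {ξ η : EquivBundle (n + 1) V G} {α β : SmoothHom (n + 1) V G} {s : ℝ → ξ.Total}
  {s' : ℝ → η.Total}

theorem zero_eq (h : ξ.IsAdapted α β s) :
    ξ.proj (s 0) = southPole (n + 1) ∧ ξ.IsIsotropyRep (s 0) α := by
  obtain ⟨U, σ, hσ, hs⟩ := h.south
  have h0 := hs 0 ⟨le_rfl, Real.pi_pos.le⟩ (by rw [Sph.meridian_zero]; exact hσ.mem)
  rw [Sph.meridian_zero] at h0
  rw [h0]
  exact ⟨hσ.proj _ hσ.mem, hσ.isIsotropyRep smul_southPole⟩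

theorem pi_eq (h : ξ.IsAdapted α β s) :
    ξ.proj (s Real.pi) = northPole (n + 1) ∧ ξ.IsIsotropyRep (s Real.pi) β := by
  obtain ⟨U, σ, hσ, hs⟩ := h.north
  have h0 := hs Real.pi ⟨Real.pi_pos.le, le_rfl⟩ (by rw [Sph.meridian_pi]; exact hσ.mem)
  rw [Sph.meridian_pi] at h0
  rw [h0]
  exact ⟨hσ.proj _ hσ.mem, hσ.isIsotropyRep smul_northPole⟩

/-- At an interior point close to the north pole, `SO(n)` acts through `SmoothHom.res α` by the lift
condition and through `SmoothHom.res β` by the polar section. -/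
theorem res_eq (h : ξ.IsAdapted α β s) : SmoothHom.res α = SmoothHom.res β := by
  obtain ⟨U, σ, hσ, hs⟩ := h.north
  have hcont := (Sph.contMDiff_meridian (n := n)).continuous
  have hev : ∀ᶠ t in nhds Real.pi, Sph.meridian n t ∈ U :=
    hcont.continuousAt (by rw [Sph.meridian_pi]; exact hσ.isOpen.mem_nhds hσ.mem)
  obtain ⟨t, htU, ht⟩ : ∃ t, Sph.meridian n t ∈ U ∧ t ∈ Set.Ioo 0 Real.pi := by
    have h1 : ∀ᶠ t in nhdsWithin Real.pi (Set.Iio Real.pi), Sph.meridian n t ∈ U :=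
      hev.filter_mono nhdsWithin_le_nhds
    exact (h1.and (Ioo_mem_nhdsLT Real.pi_pos)).exists
  refine DFunLike.ext _ _ fun B => ?_
  refine ξ.eq_of_right_eq (s t) ?_
  rw [← h.lift.smul B t ht, hs t ⟨ht.1.le, ht.2.le⟩ htU, hσ.smul _ _ htU,
    Sph.incl_smul_meridian]
  rfl

theorem proj (h : ξ.IsAdapted α β s) {t : ℝ} (ht : t ∈ Set.Icc 0 Real.pi) :
    ξ.proj (s t) = Sph.meridian n t := by
  rcases eq_or_lt_of_le ht.1 with rfl | h0
  · rw [h.zero_eq.1, Sph.meridian_zero]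
  rcases eq_or_lt_of_le ht.2 with rfl | h1
  · rw [h.pi_eq.1, Sph.meridian_pi]
  exact h.lift.proj t ⟨h0, h1⟩

theorem incl_smul (h : ξ.IsAdapted α β s) (B : SO n) {t : ℝ} (ht : t ∈ Set.Icc 0 Real.pi) :
    SO.incl n B • s t = s t <• α (SO.incl n B) := by
  rcases eq_or_lt_of_le ht.1 with rfl | h0
  · exact h.zero_eq.2 _
  rcases eq_or_lt_of_le ht.2 with rfl | h1
  · have := congrArg (fun γ : SmoothHom n V G => γ B) h.res_eq
    rw [h.pi_eq.2 _]
    exact congrArg (fun g : G => s Real.pi <• g) this.symm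
  exact h.lift.smul B t ⟨h0, h1⟩

/-- In the interior the lift is smooth; at either end it coincides, within the interval, with a
polar section evaluated along the meridian. -/
theorem continuousOn (h : ξ.IsAdapted α β s) : ContinuousOn s (Set.Icc 0 Real.pi) := by
  have hcont := (Sph.contMDiff_meridian (n := n)).continuous
  have hpole : ∀ {x₀ : Sph (n + 1)} {γ : SmoothHom (n + 1) V G} {U : Set (Sph (n + 1))}
      {σ : Sph (n + 1) → ξ.Total} {t : ℝ}, ξ.IsPolarSection x₀ γ U σ →
      (∀ t ∈ Set.Icc 0 Real.pi, Sph.meridian n t ∈ U → s t = σ (Sph.meridian n t)) →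
      t ∈ Set.Icc 0 Real.pi → Sph.meridian n t ∈ U →
      ContinuousWithinAt s (Set.Icc 0 Real.pi) t := fun {x₀ γ U σ t} hσ hs ht htU => by
    have h1 : ContinuousAt (fun t => σ (Sph.meridian n t)) t :=
      ContinuousAt.comp (hσ.contMDiffOn.continuousOn.continuousAt (hσ.isOpen.mem_nhds htU))
        hcont.continuousAt
    refine h1.continuousWithinAt.congr_of_eventuallyEq_of_mem ?_ ht
    filter_upwards [nhdsWithin_le_nhds (hcont.continuousAt (hσ.isOpen.mem_nhds htU)),
      self_mem_nhdsWithin] with t' h2 h3 using hs t' h3 h2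
  intro t ht
  rcases eq_or_lt_of_le ht.1 with rfl | h0
  · obtain ⟨U, σ, hσ, hs⟩ := h.south
    exact hpole hσ hs ht (by rw [Sph.meridian_zero]; exact hσ.mem)
  rcases eq_or_lt_of_le ht.2 with rfl | h1
  · obtain ⟨U, σ, hσ, hs⟩ := h.north
    exact hpole hσ hs ht (by rw [Sph.meridian_pi]; exact hσ.mem)
  exact (h.lift.contMDiffOn.contMDiffAt (Ioo_mem_nhds h0 h1)).continuousAt.continuousWithinAt

/-- The stabilizer of a point of the meridian acts in the same way on both lifts. -/
theorem exists_stabilizer_smul (h : ξ.IsAdapted α β s) (h' : η.IsAdapted α β s')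
    {C : SO (n + 1)} {t : ℝ} (ht : t ∈ Set.Icc 0 Real.pi)
    (hC : C • Sph.meridian n t = Sph.meridian n t) :
    ∃ k : G, C • s t = s t <• k ∧ C • s' t = s' t <• k := by
  rcases eq_or_lt_of_le ht.1 with rfl | h0
  · exact ⟨α C, h.zero_eq.2 C, h'.zero_eq.2 C⟩
  rcases eq_or_lt_of_le ht.2 with rfl | h1
  · exact ⟨β C, h.pi_eq.2 C, h'.pi_eq.2 C⟩
  obtain ⟨B, rfl⟩ := Sph.exists_incl_of_smul_meridian_eq ⟨h0, h1⟩ hC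
  exact ⟨α (SO.incl n B), h.incl_smul B ht, h'.incl_smul B ht⟩

end IsAdapted

/-- A rotation moving the meridian to a given point. -/
def frame (hn : 1 ≤ n) (x : Sph (n + 1)) : SO (n + 1) :=
  (Sph.exists_smul_meridian_eq hn x).choose

theorem frame_smul (hn : 1 ≤ n) (x : Sph (n + 1)) :
    frame hn x • Sph.meridian n (Real.arccos (-Sph.height x)) = x :=
  (Sph.exists_smul_meridian_eq hn x).choose_spec

/-- The set-theoretic section spread out from a lift of the meridian. -/
def spread (hn : 1 ≤ n) {ξ : EquivBundle (n + 1) V G} (s : ℝ → ξ.Total) (x : Sph (n + 1)) :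
    ξ.Total :=
  frame hn x • s (Real.arccos (-Sph.height x))

/-- The map sending `A s(t) g` to `A s'(t) g`. -/
def transport (hn : 1 ≤ n) {ξ η : EquivBundle (n + 1) V G} (s : ℝ → ξ.Total) (s' : ℝ → η.Total)
    (z : ξ.Total) : η.Total :=
  spread hn s' (ξ.proj z) <• ξ.div (spread hn s (ξ.proj z)) z

section Transport

variable (hn : 1 ≤ n) {ξ η : EquivBundle (n + 1) V G} {α β : SmoothHom (n + 1) V G}
  {s : ℝ → ξ.Total} {s' : ℝ → η.Total}

theorem proj_spread (h : ξ.IsAdapted α β s) (x : Sph (n + 1)) : ξ.proj (spread hn s x) = x := by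
  rw [spread, ξ.proj_left, h.proj (Sph.arccos_neg_height_mem x), frame_smul]

theorem proj_transport (h' : η.IsAdapted α β s') (z : ξ.Total) :
    η.proj (transport hn s s' z) = ξ.proj z := by
  rw [transport, η.proj_right, proj_spread hn h']

theorem transport_right (h : ξ.IsAdapted α β s) (z : ξ.Total) (g : G) :
    transport hn s s' (z <• g) = transport hn s s' z <• g := by
  have h1 : ξ.proj (spread hn s (ξ.proj z)) = ξ.proj z := proj_spread hn h _
  have h2 : ξ.div (spread hn s (ξ.proj z)) (z <• g) = ξ.div (spread hn s (ξ.proj z)) z * g := by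
    refine (ξ.div_eq_iff (by rw [h1, ξ.proj_right])).2 ?_
    rw [ξ.right_mul, ξ.right_div h1]
  rw [transport, ξ.proj_right, h2, η.right_mul]; rfl

/-- The result is independent of the choice made in `frame`: two rotations taking a meridian point
to the same place differ by a stabilizer element, which acts by the same `k` on both lifts. -/
theorem transport_smul_lift (h : ξ.IsAdapted α β s) (h' : η.IsAdapted α β s') (A : SO (n + 1))
    {t : ℝ} (ht : t ∈ Set.Icc 0 Real.pi) : transport hn s s' (A • s t) = A • s' t := by
  have hx : ξ.proj (A • s t) = A • Sph.meridian n t := by rw [ξ.proj_left, h.proj ht]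
  set F := frame hn (A • Sph.meridian n t) with hF
  have hF' : F • Sph.meridian n t = A • Sph.meridian n t := by
    have := frame_smul hn (A • Sph.meridian n t)
    rwa [Sph.arccos_neg_height_smul_meridian A ht] at this
  have hC : (F⁻¹ * A) • Sph.meridian n t = Sph.meridian n t := by
    rw [mul_smul, ← hF', inv_smul_smul]
  obtain ⟨k, hk, hk'⟩ := h.exists_stabilizer_smul h' ht hC
  have hk1 : A • s t = (F • s t) <• k := by
    rw [← ξ.left_right_comm, ← hk, ← mul_smul, mul_inv_cancel_left]
  have hk1' : A • s' t = (F • s' t) <• k := by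
    rw [← η.left_right_comm, ← hk', ← mul_smul, mul_inv_cancel_left]
  rw [transport, hx, spread, spread, Sph.arccos_neg_height_smul_meridian A ht, ← hF, hk1,
    ξ.div_right, hk1']

theorem eq_spread_right (hn : 1 ≤ n) (h : ξ.IsAdapted α β s) (z : ξ.Total) :
    ∃ (A : SO (n + 1)), ∃ t ∈ Set.Icc 0 Real.pi, ∃ g : G, z = (A • s t) <• g :=
  ⟨frame hn (ξ.proj z), _, Sph.arccos_neg_height_mem (ξ.proj z), ξ.div (spread hn s (ξ.proj z)) z,
    (ξ.right_div (proj_spread hn h (ξ.proj z))).symm⟩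

theorem transport_left (h : ξ.IsAdapted α β s) (h' : η.IsAdapted α β s') (B : SO (n + 1))
    (z : ξ.Total) : transport hn s s' (B • z) = B • transport hn s s' z := by
  obtain ⟨A, t, ht, g, rfl⟩ := eq_spread_right hn h z
  rw [ξ.left_right_comm, transport_right hn h, transport_right hn h, η.left_right_comm,
    ← mul_smul, transport_smul_lift hn h h' _ ht, transport_smul_lift hn h h' _ ht, mul_smul]

theorem transport_transport (h : ξ.IsAdapted α β s) (h' : η.IsAdapted α β s') (z : ξ.Total) :
    transport hn s' s (transport hn s s' z) = z := by
  obtain ⟨A, t, ht, g, rfl⟩ := eq_spread_right hn h z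
  rw [transport_right hn h, transport_smul_lift hn h h' _ ht, transport_right hn h',
    transport_smul_lift hn h' h _ ht]

/-- Both polar sections are recovered from the lifts by the same formula `A s(t) δ(A)⁻¹`, so they
correspond. This is what gives smoothness at the poles. -/
theorem transport_polarSection (h : ξ.IsAdapted α β s) (h' : η.IsAdapted α β s')
    {x₀ : Sph (n + 1)} {δ : SmoothHom (n + 1) V G} {U U' : Set (Sph (n + 1))}
    {σ : Sph (n + 1) → ξ.Total} {σ' : Sph (n + 1) → η.Total}
    (hσ : ξ.IsPolarSection x₀ δ U σ) (hσ' : η.IsPolarSection x₀ δ U' σ')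
    (hs : ∀ t ∈ Set.Icc 0 Real.pi, Sph.meridian n t ∈ U → s t = σ (Sph.meridian n t))
    (hs' : ∀ t ∈ Set.Icc 0 Real.pi, Sph.meridian n t ∈ U' → s' t = σ' (Sph.meridian n t))
    {x : Sph (n + 1)} (hx : x ∈ U) (hx' : x ∈ U') : transport hn s s' (σ x) = σ' x := by
  obtain ⟨A, t, ht, rfl⟩ := Sph.exists_neg_height_arccos hn x
  have hU : Sph.meridian n t ∈ U := by simpa using hσ.smul_mem A⁻¹ _ hx
  have hU' : Sph.meridian n t ∈ U' := by simpa using hσ'.smul_mem A⁻¹ _ hx'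
  have hA := transport_smul_lift hn h h' A ht
  rw [hσ.apply_smul A hU, hσ'.apply_smul A hU', transport_right hn h, ← hs t ht hU,
    ← hs' t ht hU', hA]

/-- Near every point there are smooth sections which correspond under `transport`. -/
theorem exists_corresponding_sections (h : ξ.IsAdapted α β s) (h' : η.IsAdapted α β s')
    (x : Sph (n + 1)) :
    ∃ (U : Set (Sph (n + 1))) (τ : Sph (n + 1) → ξ.Total) (τ' : Sph (n + 1) → η.Total),
      IsOpen U ∧ x ∈ U ∧ ContMDiffOn (𝓡 (n + 1)) ((𝓡 (n + 1)).prod 𝓘(ℝ, V)) ∞ τ U ∧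
      ContMDiffOn (𝓡 (n + 1)) ((𝓡 (n + 1)).prod 𝓘(ℝ, V)) ∞ τ' U ∧
      (∀ y ∈ U, ξ.proj (τ y) = y) ∧ ∀ y ∈ U, transport hn s s' (τ y) = τ' y := by
  -- At the poles one uses the polar sections; elsewhere the lifts are spread out by a locally
  -- smooth choice of rotation.
  by_cases hx : Sph.hor x ⬝ᵥ Sph.hor x = 0
  · rcases (Sph.hor_eq_zero_iff x).1 (dotProduct_self_eq_zero.1 hx) with rfl | rfl
    · obtain ⟨U, σ, hσ, hs⟩ := h.south
      obtain ⟨U', σ', hσ', hs'⟩ := h'.south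
      exact ⟨U ∩ U', σ, σ', hσ.isOpen.inter hσ'.isOpen, ⟨hσ.mem, hσ'.mem⟩,
        hσ.contMDiffOn.mono Set.inter_subset_left, hσ'.contMDiffOn.mono Set.inter_subset_right,
        fun y hy => hσ.proj y hy.1,
        fun y hy => transport_polarSection hn h h' hσ hσ' hs hs' hy.1 hy.2⟩
    · obtain ⟨U, σ, hσ, hs⟩ := h.north
      obtain ⟨U', σ', hσ', hs'⟩ := h'.north
      exact ⟨U ∩ U', σ, σ', hσ.isOpen.inter hσ'.isOpen, ⟨hσ.mem, hσ'.mem⟩,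
        hσ.contMDiffOn.mono Set.inter_subset_left, hσ'.contMDiffOn.mono Set.inter_subset_right,
        fun y hy => hσ.proj y hy.1,
        fun y hy => transport_polarSection hn h h' hσ hσ' hs hs' hy.1 hy.2⟩
  · obtain ⟨U, f, hU, hxU, hf, ht, hfU⟩ := Sph.exists_smooth_polar hn hx
    have hI : ∀ y ∈ U, Real.arccos (-Sph.height y) ∈ Set.Icc 0 Real.pi := fun y _ =>
      Sph.arccos_neg_height_mem y
    refine ⟨U, fun y => f y • s (Real.arccos (-Sph.height y)),
      fun y => f y • s' (Real.arccos (-Sph.height y)), hU, hxU,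
      ξ.contMDiffOn_left hf (h.lift.contMDiffOn.comp ht fun y hy => (hfU y hy).1),
      η.contMDiffOn_left hf (h'.lift.contMDiffOn.comp ht fun y hy => (hfU y hy).1),
      fun y hy => ?_, fun y hy => transport_smul_lift hn h h' _ (hI y hy)⟩
    rw [ξ.proj_left, h.proj (hI y hy), (hfU y hy).2]

/-- Locally every point is `τ` times an element of `G` depending smoothly on it, and `transport`
replaces `τ` by `τ'`. The arbitrary choices in `frame` thus do no harm. -/
theorem contMDiff_transport (h : ξ.IsAdapted α β s) (h' : η.IsAdapted α β s') :
    ContMDiff ((𝓡 (n + 1)).prod 𝓘(ℝ, V)) ((𝓡 (n + 1)).prod 𝓘(ℝ, V)) ∞ (transport hn s s') := by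
  intro z
  obtain ⟨U, τ, τ', hU, hzU, hτ, hτ', hτp, hττ'⟩ :=
    exists_corresponding_sections hn h h' (ξ.proj z)
  have hopen : IsOpen (ξ.proj ⁻¹' U) := hU.preimage ξ.contMDiff_proj.continuous
  have hp : ContMDiffOn ((𝓡 (n + 1)).prod 𝓘(ℝ, V)) (𝓡 (n + 1)) ∞ ξ.proj (ξ.proj ⁻¹' U) :=
    ξ.contMDiff_proj.contMDiffOn
  have hdiv : ContMDiffOn ((𝓡 (n + 1)).prod 𝓘(ℝ, V)) 𝓘(ℝ, V) ∞
      (fun w : ξ.Total => ξ.div (τ (ξ.proj w)) w) (ξ.proj ⁻¹' U) :=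
    ξ.contMDiffOn_div (hτ.comp hp fun w hw => hw) contMDiffOn_id fun w hw => hτp _ hw
  have hfun := η.contMDiffOn_right (hτ'.comp hp fun w hw => hw) hdiv
  refine (hfun.congr fun w hw => ?_).contMDiffAt (hopen.mem_nhds hzU)
  have hw' : τ (ξ.proj w) <• ξ.div (τ (ξ.proj w)) w = w := ξ.right_div (hτp _ hw)
  conv_lhs => rw [← hw']
  rw [transport_right hn h, hττ' _ hw]
  rfl

/-- No clutching element appears, because `α` and `β` are here actual homomorphisms along a
connected lift and not conjugacy classes. The gluing data lies in the position of `β` inside its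
class. -/
theorem IsAdapted.iso (hn : 1 ≤ n) (h : ξ.IsAdapted α β s) (h' : η.IsAdapted α β s') : ξ.Iso η :=
  ⟨{ toFun := transport hn s s'
     invFun := transport hn s' s
     left_inv := transport_transport hn h h'
     right_inv := transport_transport hn h' h
     contMDiff_toFun := contMDiff_transport hn h h'
     contMDiff_invFun := contMDiff_transport hn h' h },
    transport_left hn h h', transport_right hn h, proj_transport hn h'⟩

end Transport

end EquivBundle
end

section

variable {N n m : ℕ} {V : Type v} [NormedAddCommGroup V] [NormedSpace ℝ V]
  {G : Type u} [Group G] [TopologicalSpace G] [ChartedSpace V G] [LieGroup 𝓘(ℝ, V) ∞ G]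

/-! ### The clutching type of an equivariant bundle -/

theorem SmoothHom.mem_centralizer_iff {α : SmoothHom m V G} {g : G} :
    g ∈ SmoothHom.centralizer α ↔ ∀ A, α A * g = g * α A := by
  refine Subgroup.mem_centralizer_iff.trans ⟨fun h A => h _ ⟨A, rfl⟩, ?_⟩
  rintro h _ ⟨A, rfl⟩
  exact h A

theorem SmoothHom.conj_eq_self {α : SmoothHom m V G} {g : G}
    (hg : g ∈ SmoothHom.centralizer α) : α.conj g = α :=
  DFunLike.ext _ _ fun A => by
    rw [SmoothHom.conj_apply, mul_assoc, SmoothHom.mem_centralizer_iff.1 hg A, inv_mul_cancel_left]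

namespace EquivBundle

theorem mul_eq_of_smul_eq (ξ : EquivBundle N V G) {C : SO N} {a : ξ.Total} {g k k' : G}
    (h : C • a = a <• k) (h' : C • (a <• g) = (a <• g) <• k') : k * g = g * k' := by
  refine ξ.eq_of_right_eq a ?_
  rw [ξ.right_mul, ξ.right_mul, ← h, ← ξ.left_right_comm, h']

theorem IsIsotropyRep.eq_conj {ξ : EquivBundle N V G} {a : ξ.Total} {α α' : SmoothHom N V G}
    {g : G} (h : ξ.IsIsotropyRep a α) (h' : ξ.IsIsotropyRep (a <• g) α') :
    α' = α.conj g :=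
  DFunLike.ext _ _ fun A => by
    rw [SmoothHom.conj_apply, mul_assoc, ξ.mul_eq_of_smul_eq (h A) (h' A), inv_mul_cancel_left]

theorem IsIsotropyRep.mem_centralizer {ξ : EquivBundle N V G} {a : ξ.Total} {α : SmoothHom N V G}
    {g : G} (h : ξ.IsIsotropyRep a α) (h' : ξ.IsIsotropyRep (a <• g) α) :
    g ∈ SmoothHom.centralizer α :=
  SmoothHom.mem_centralizer_iff.2 fun A => ξ.mul_eq_of_smul_eq (h A) (h' A)

theorem exists_isIsotropyRep_of_isotropyClass_eq (ξ : EquivBundle N V G) {x : Sph N}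
    (hx : ∀ A : SO N, A • x = x) {α : SmoothHom N V G}
    (h : ξ.isotropyClass x hx = RepClass.mk α) :
    ∃ a : ξ.Total, ξ.proj a = x ∧ ξ.IsIsotropyRep a α := by
  obtain ⟨α₀, a, ha, hα₀⟩ := ξ.exists_isIsotropyRep_over x hx
  rw [ξ.isotropyClass_eq hx ha hα₀] at h
  obtain ⟨g, hg⟩ := Quotient.exact h
  refine ⟨a <• g⁻¹, by rw [ξ.proj_right, ha], ?_⟩
  have : α = α₀.conj g⁻¹ := DFunLike.ext _ _ fun A => by rw [hg, SmoothHom.conj_apply, inv_inv]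
  rw [this]
  exact hα₀.right g⁻¹

namespace IsAdapted

variable {ξ η : EquivBundle (n + 1) V G} {α β : SmoothHom (n + 1) V G} {s : ℝ → ξ.Total}

theorem isotropyMap_eq (h : ξ.IsAdapted α β s) :
    isotropyMap (n + 1) V G (Quotient.mk _ ξ) = (RepClass.mk α, RepClass.mk β) :=
  Prod.ext (ξ.isotropyClass_eq smul_southPole h.zero_eq.1 h.zero_eq.2)
    (ξ.isotropyClass_eq smul_northPole h.pi_eq.1 h.pi_eq.2)

/-- Modification of an adapted lift by a path in the centralizer which is constant near both
poles. -/
theorem right_path (h : ξ.IsAdapted α β s) {a b : ℝ} (ha : 0 < a) (hb : b < Real.pi)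
    (ha' : a ≤ Real.pi) (hb' : 0 ≤ b)
    {ζ : ℝ → G} (hζ : ContMDiff 𝓘(ℝ, ℝ) 𝓘(ℝ, V) ∞ ζ)
    (hc : ∀ t, ζ t ∈ SmoothHom.centralizer (SmoothHom.res α)) {g k : G}
    (hg : g ∈ SmoothHom.centralizer α) (hζa : ∀ t ≤ a, ζ t = g) (hζb : ∀ t, b ≤ t → ζ t = k) :
    ξ.IsAdapted α (β.conj k) (fun t => s t <• ζ t) where
  lift :=
    { contMDiffOn := ξ.contMDiffOn_right h.lift.contMDiffOn hζ.contMDiffOn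
      proj := fun t ht => by rw [ξ.proj_right, h.lift.proj t ht]
      smul := fun B t ht => by
        rw [ξ.left_right_comm, h.lift.smul B t ht, ← ξ.right_mul, ← ξ.right_mul,
          SmoothHom.mem_centralizer_iff.1 (hc t)] }
  south := by
    obtain ⟨U, σ, hσ, hs⟩ := h.south
    have hσg := hσ.right g
    rw [SmoothHom.conj_eq_self hg] at hσg
    refine ⟨_, _, hσg.mono (U' := {x | Sph.height x < -Real.cos a})
      (isOpen_lt Sph.continuous_height continuous_const) ?_ (fun A x hx => by simpa using hx),
      fun t ht htU => ?_⟩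
    · have := Real.cos_lt_cos_of_nonneg_of_le_pi le_rfl ha' ha
      simpa using this
    · have h1 : -Real.cos t < -Real.cos a := by simpa using htU.2
      have h2 : t < a := by
        by_contra h
        have := Real.cos_le_cos_of_nonneg_of_le_pi ha.le ht.2 (not_lt.1 h)
        linarith
      simp only [hζa t h2.le, hs t ht htU.1]
  north := by
    obtain ⟨U, σ, hσ, hs⟩ := h.north
    refine ⟨_, _, (hσ.right k).mono (U' := {x | -Real.cos b < Sph.height x})
      (isOpen_lt continuous_const Sph.continuous_height) ?_ (fun A x hx => by simpa using hx),
      fun t ht htU => ?_⟩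
    · have := Real.cos_lt_cos_of_nonneg_of_le_pi hb' le_rfl hb
      rw [Real.cos_pi] at this
      simp only [Set.mem_ofPred_eq, Sph.height_northPole]
      linarith
    · have h1 : -Real.cos b < -Real.cos t := by simpa using htU.2
      have h2 : b < t := by
        by_contra h
        have := Real.cos_le_cos_of_nonneg_of_le_pi ht.1 hb.le (not_lt.1 h)
        linarith
      simp only [hζb t h2.le, hs t ht htU.1]

end IsAdapted

/-- Isomorphisms carry polar sections to polar sections. -/
theorem IsPolarSection.map {ξ η : EquivBundle N V G}
    (f : Diffeomorph ((𝓡 N).prod 𝓘(ℝ, V)) ((𝓡 N).prod 𝓘(ℝ, V)) ξ.Total η.Total ∞)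
    (h1 : ∀ (A : SO N) (z : ξ.Total), f (A • z) = A • f z)
    (h2 : ∀ (z : ξ.Total) (g : G), f (z <• g) = f z <• g)
    (h3 : ∀ z : ξ.Total, η.proj (f z) = ξ.proj z) {x₀ : Sph N} {α : SmoothHom N V G}
    {U : Set (Sph N)} {σ : Sph N → ξ.Total} (h : ξ.IsPolarSection x₀ α U σ) :
    η.IsPolarSection x₀ α U (fun x => f (σ x)) where
  isOpen := h.isOpen
  mem := h.mem
  smul_mem := h.smul_mem
  contMDiffOn := f.contMDiff.comp_contMDiffOn h.contMDiffOn
  proj x hx := by rw [h3, h.proj x hx]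
  smul A x hx := by rw [← h1, h.smul A x hx, h2]

theorem IsAdapted.exists_of_iso {ξ η : EquivBundle (n + 1) V G} (hiso : ξ.Iso η)
    {α β : SmoothHom (n + 1) V G} {s : ℝ → ξ.Total} (h : ξ.IsAdapted α β s) {z : G}
    {β' : SmoothHom (n + 1) V G} (hz : ξ.IsIsotropyRep (s Real.pi <• z) β') :
    ∃ s' : ℝ → η.Total, η.IsAdapted α β s' ∧ η.IsIsotropyRep (s' Real.pi <• z) β' := by
  obtain ⟨f, h1, h2, h3⟩ := hiso
  refine ⟨fun t => f (s t), ⟨⟨f.contMDiff.comp_contMDiffOn h.lift.contMDiffOn,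
    fun t ht => by rw [h3, h.lift.proj t ht],
    fun B t ht => by rw [← h1, h.lift.smul B t ht, h2]⟩, ?_, ?_⟩,
    fun A => by rw [← h2, ← h1, hz A, h2]⟩
  · obtain ⟨U, σ, hσ, hs⟩ := h.south
    exact ⟨U, _, hσ.map f h1 h2 h3, fun t ht htU => congrArg f (hs t ht htU)⟩
  · obtain ⟨U, σ, hσ, hs⟩ := h.north
    exact ⟨U, _, hσ.map f h1 h2 h3, fun t ht htU => congrArg f (hs t ht htU)⟩

/-- `ξ` is obtained by clutching with `z`: an adapted lift starting from a point with isotropy `α`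
ends at `b <• z⁻¹`, where `b` has isotropy `β`. -/
def HasType (ξ : EquivBundle (n + 1) V G) (α β : SmoothHom (n + 1) V G) (z : G) : Prop :=
  ∃ (β' : SmoothHom (n + 1) V G) (s : ℝ → ξ.Total), ξ.IsAdapted α β' s ∧
    ξ.IsIsotropyRep (s Real.pi <• z) β

namespace HasType

variable {ξ η : EquivBundle (n + 1) V G} {α β : SmoothHom (n + 1) V G} {z w : G}

theorem isotropyMap_eq (h : ξ.HasType α β z) :
    isotropyMap (n + 1) V G (Quotient.mk _ ξ) = (RepClass.mk α, RepClass.mk β) := by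
  obtain ⟨β', s, hs, hz⟩ := h
  rw [hs.isotropyMap_eq, hs.pi_eq.2.eq_conj hz, RepClass.mk_conj]

theorem of_iso (hiso : ξ.Iso η) (h : ξ.HasType α β z) : η.HasType α β z := by
  obtain ⟨β', s, hs, hz⟩ := h
  obtain ⟨s', hs', hz'⟩ := hs.exists_of_iso hiso hz
  exact ⟨β', s', hs', hz'⟩

theorem mem_centralizer (h : ξ.HasType α β z) (hαβ : SmoothHom.res α = SmoothHom.res β) :
    z ∈ SmoothHom.centralizer (SmoothHom.res α) := by
  obtain ⟨β', s, hs, hz⟩ := h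
  refine SmoothHom.mem_centralizer_iff.2 fun B => ?_
  have h1 := ξ.mul_eq_of_smul_eq (hs.pi_eq.2 (SO.incl n B)) (hz (SO.incl n B))
  rw [← SmoothHom.res_apply, ← SmoothHom.res_apply, ← hs.res_eq, ← hαβ] at h1
  exact h1

/-- Each lift ends with isotropy `z β z⁻¹`, so both bundles have adapted lifts with equal
homomorphisms at both ends. -/
theorem iso (hn : 1 ≤ n) (h : ξ.HasType α β z) (h' : η.HasType α β z) : ξ.Iso η := by
  obtain ⟨β₁, s, hs, hz⟩ := h
  obtain ⟨β₂, s', hs', hz'⟩ := h'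
  have h1 := hs.pi_eq.2.eq_conj hz
  have h2 := hs'.pi_eq.2.eq_conj hz'
  have h3 : β₁ = β₂ := DFunLike.ext _ _ fun A => by
    have := congrArg (fun γ : SmoothHom (n + 1) V G => γ A) (h1.symm.trans h2)
    simp only [SmoothHom.conj_apply] at this
    exact mul_left_cancel (mul_right_cancel this)
  subst h3
  exact hs.iso hn hs'

/-- Translate the whole lift by the constant `u`, and the comparison point over the north pole by
`v`. -/
theorem mul_mul (h : ξ.HasType α β z) {u v : G} (hu : u ∈ SmoothHom.centralizer α)
    (hv : v ∈ SmoothHom.centralizer β) : ξ.HasType α β (u⁻¹ * z * v) := by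
  obtain ⟨β', s, hs, hz⟩ := h
  refine ⟨β'.conj u, fun t => s t <• u, hs.right_path (a := 1) (b := 1) (ζ := fun _ => u) one_pos
    (by linarith [Real.pi_gt_three]) (by linarith [Real.pi_gt_three]) zero_le_one contMDiff_const
    (fun _ => SmoothHom.centralizer_le_res α hu) hu (fun _ _ => rfl) (fun _ _ => rfl), ?_⟩
  have h1 := hz.right v
  rw [SmoothHom.conj_eq_self hv] at h1
  have h2 : (s Real.pi <• u) <• (u⁻¹ * z * v) = (s Real.pi <• z) <• v := by
    rw [← ξ.right_mul, ← ξ.right_mul]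
    congr 2
    group
  simpa only [h2] using h1

/-- Multiply the lift by a smooth path in the centralizer from `1` to `z * w⁻¹`. The end point
absorbs this factor, and `w` takes over the role of `z`. -/
theorem of_joined [FiniteDimensional ℝ V] (h : ξ.HasType α β z)
    (hw : z * w⁻¹ ∈ SmoothHom.centralizer (SmoothHom.res α))
    (hj : Joined (1 : SmoothHom.centralizer (SmoothHom.res α)) ⟨z * w⁻¹, hw⟩) :
    ξ.HasType α β w := by
  obtain ⟨β', s, hs, hz⟩ := h
  obtain ⟨ζ, h1, h2, h3, h4⟩ := mem_smoothlyJoined_of_joined (V := V)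
    (α := (SmoothHom.res α).toMonoidHom) (SmoothHom.res α).contMDiff_toFun hj
  have hpi := Real.pi_gt_three
  -- The path is shifted to run during `[1, 2] ⊂ (0, π)`, hence constant near both poles.
  refine ⟨_, _, hs.right_path (a := 1) (b := 2) (ζ := fun t => ζ (t - 1)) (k := z * w⁻¹) one_pos
    (by linarith) (by linarith) zero_le_two
    (h1.comp (contDiff_id.sub contDiff_const).contMDiff) (fun t => h2 _) (one_mem _)
    (fun t ht => h3 _ (by linarith)) (fun t ht => h4 _ (by linarith)), ?_⟩
  have h5 : (s Real.pi <• ζ (Real.pi - 1)) <• w = s Real.pi <• z := by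
    rw [h4 _ (by linarith), ← ξ.right_mul]
    congr 2
    simp
  simpa only [h5] using hz

/-- Two clutching elements of the same bundle differ by a path in the centralizer of the
restriction, up to elements of the two isotropy centralizers. -/
theorem exists_joined (h : ξ.HasType α β z) (h' : ξ.HasType α β w) :
    ∃ (u : SmoothHom.centralizer α) (v : SmoothHom.centralizer β)
      (k : SmoothHom.centralizer (SmoothHom.res α)),
      Joined (Subgroup.inclusion (SmoothHom.centralizer_le_res α) u) k ∧
        z * v.1 = k.1 * w := by
  obtain ⟨β₁, s₁, hs₁, hz⟩ := h
  obtain ⟨β₂, s₂, hs₂, hw⟩ := h'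
  have hp : ∀ t ∈ Set.Icc 0 Real.pi, ξ.proj (s₁ t) = ξ.proj (s₂ t) := fun t ht => by
    rw [hs₁.proj ht, hs₂.proj ht]
  have hd : ∀ t ∈ Set.Icc 0 Real.pi, s₁ t <• ξ.div (s₁ t) (s₂ t) = s₂ t := fun t ht =>
    ξ.right_div (hp t ht)
  have h0 : (0 : ℝ) ∈ Set.Icc 0 Real.pi := ⟨le_rfl, Real.pi_pos.le⟩
  have hpi : Real.pi ∈ Set.Icc 0 Real.pi := ⟨Real.pi_pos.le, le_rfl⟩
  -- The quotient of the two lifts is the required path: it lies in the centralizer of the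
  -- restriction throughout and starts in that of `α`. Its end point, conjugated through `z` and
  -- `w`, gives an element centralizing `β`.
  have hc : ∀ t ∈ Set.Icc 0 Real.pi,
      ξ.div (s₁ t) (s₂ t) ∈ SmoothHom.centralizer (SmoothHom.res α) := fun t ht =>
    SmoothHom.mem_centralizer_iff.2 fun B => ξ.mul_eq_of_smul_eq (hs₁.incl_smul B ht) (by
      rw [hd t ht]; exact hs₂.incl_smul B ht)
  have hu : ξ.div (s₁ 0) (s₂ 0) ∈ SmoothHom.centralizer α :=
    hs₁.zero_eq.2.mem_centralizer (by rw [hd 0 h0]; exact hs₂.zero_eq.2)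
  have hq : (s₁ Real.pi <• z) <• (z⁻¹ * ξ.div (s₁ Real.pi) (s₂ Real.pi) * w) =
      s₂ Real.pi <• w := by
    rw [← ξ.right_mul, ← mul_assoc, mul_inv_cancel_left, ξ.right_mul, hd _ hpi]
  have hv : z⁻¹ * ξ.div (s₁ Real.pi) (s₂ Real.pi) * w ∈ SmoothHom.centralizer β :=
    hz.mem_centralizer (by rw [hq]; exact hw)
  have hcont : ContinuousOn (fun t => ξ.div (s₁ t) (s₂ t)) (Set.Icc 0 Real.pi) :=
    ξ.continuousOn_div hs₁.continuousOn hs₂.continuousOn hp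
  have hI : ∀ t : unitInterval, Real.pi * t ∈ Set.Icc 0 Real.pi := fun t =>
    ⟨mul_nonneg Real.pi_pos.le t.2.1, mul_le_of_le_one_right Real.pi_pos.le t.2.2⟩
  refine ⟨⟨_, hu⟩, ⟨_, hv⟩, ⟨_, hc _ hpi⟩, ⟨⟨⟨fun t => ⟨_, hc _ (hI t)⟩, ?_⟩, ?_, ?_⟩⟩, ?_⟩
  · exact (hcont.comp_continuous (by fun_prop) hI).subtype_mk _
  · exact Subtype.ext (by simp)
  · exact Subtype.ext (by simp)
  · simp only [mul_assoc, mul_inv_cancel_left]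

end HasType

theorem exists_hasType [FiniteDimensional ℝ V] {ξ : EquivBundle (n + 1) V G}
    {α β : SmoothHom (n + 1) V G}
    (h : isotropyMap (n + 1) V G (Quotient.mk _ ξ) = (RepClass.mk α, RepClass.mk β)) :
    ∃ z, ξ.HasType α β z := by
  obtain ⟨a, ha, hα⟩ := ξ.exists_isIsotropyRep_of_isotropyClass_eq smul_southPole
    (congrArg Prod.fst h)
  obtain ⟨b, hb, hβ⟩ := ξ.exists_isIsotropyRep_of_isotropyClass_eq smul_northPole
    (congrArg Prod.snd h)
  obtain ⟨β', s, hs⟩ := ξ.exists_isAdapted ha hα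
  refine ⟨ξ.div (s Real.pi) b, β', s, hs, ?_⟩
  rwa [ξ.right_div (hs.pi_eq.1.trans hb.symm)]

end EquivBundle
end

/-! ### Manifolds from atlases with values in a manifold -/

section ChartedSpaceComp

variable {E H M₀ M : Type*} [NormedAddCommGroup E] [NormedSpace ℝ E] [TopologicalSpace H]
  (I : ModelWithCorners ℝ E H) [TopologicalSpace M₀] [ChartedSpace H M₀] [IsManifold I ∞ M₀]
  [TopologicalSpace M] [ChartedSpace M₀ M]

variable (M₀) in
/-- The pregroupoid of smooth maps between open subsets of a manifold. -/
def contMDiffPregroupoid : Pregroupoid M₀ where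
  property f s := ContMDiffOn I I ∞ f s
  comp hf hg _ _ _ := hg.comp (hf.mono Set.inter_subset_left) Set.inter_subset_right
  id_mem := contMDiffOn_id
  locality _ h := contMDiffOn_of_locally_contMDiffOn fun x hx => h x hx
  congr _ h hf := hf.congr h

/-- A bundle comes with charts valued in base times fibre, not in a model space. It suffices to
check transition maps as smooth maps between open sets of that manifold. -/
theorem isManifold_chartedSpace_comp
    (h : ∀ e ∈ atlas M₀ M, ∀ e' ∈ atlas M₀ M,
      ContMDiffOn I I ∞ (e.symm ≫ₕ e') (e.symm ≫ₕ e').source) :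
    @IsManifold _ _ _ _ _ _ _ I ∞ M _ (ChartedSpace.comp H M₀ M) := by
  have h1 : HasGroupoid M (contMDiffPregroupoid M₀ I).groupoid :=
    hasGroupoid_of_pregroupoid _ fun he he' => h _ he _ he'
  let _ := ChartedSpace.comp H M₀ M
  refine { StructureGroupoid.HasGroupoid.comp (contMDiffPregroupoid M₀ I).groupoid ?_ with }
  intro e he
  exact (isLocalStructomorphOn_contDiffGroupoid_iff e).2 (mem_groupoid_of_pregroupoid.1 he)

/-- Locally `e` is a composite chart followed by the inverse of a chart of `M₀`; both are smooth by
construction. -/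
theorem contMDiffOn_of_mem_atlas_comp
    (h : @IsManifold _ _ _ _ _ _ _ I ∞ M _ (ChartedSpace.comp H M₀ M))
    {e : OpenPartialHomeomorph M M₀} (he : e ∈ atlas M₀ M) :
    letI := ChartedSpace.comp H M₀ M
    ContMDiffOn I I ∞ e e.source ∧ ContMDiffOn I I ∞ e.symm e.target := by
  let _ := ChartedSpace.comp H M₀ M
  have hmem : ∀ c ∈ atlas H M₀, e ≫ₕ c ∈ IsManifold.maximalAtlas I ∞ M := fun c hc =>
    IsManifold.subset_maximalAtlas ⟨e, he, c, hc, rfl⟩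
  constructor
  · intro z hz
    set c := chartAt H (e z)
    have hc : c ∈ atlas H M₀ := chart_mem_atlas H _
    have hzc : e z ∈ c.source := mem_chart_source H _
    have h1 : ContMDiffOn I I ∞ (c.symm ∘ (e ≫ₕ c)) (e ≫ₕ c).source :=
      (contMDiffOn_symm_of_mem_maximalAtlas (IsManifold.subset_maximalAtlas hc)).comp
        (contMDiffOn_of_mem_maximalAtlas (hmem c hc)) fun y hy => by
          rw [OpenPartialHomeomorph.trans_source] at hy
          exact c.map_source hy.2
    have hz' : z ∈ (e ≫ₕ c).source := by
      rw [OpenPartialHomeomorph.trans_source]; exact ⟨hz, hzc⟩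
    refine ((h1.congr fun y hy => ?_).contMDiffAt
      ((e ≫ₕ c).open_source.mem_nhds hz')).contMDiffWithinAt
    rw [OpenPartialHomeomorph.trans_source] at hy
    exact (c.left_inv hy.2).symm
  · intro w hw
    set c := chartAt H w
    have hc : c ∈ atlas H M₀ := chart_mem_atlas H _
    have hwc : w ∈ c.source := mem_chart_source H _
    have h1 : ContMDiffOn I I ∞ ((e ≫ₕ c).symm ∘ c) (c.source ∩ e.target) :=
      (contMDiffOn_symm_of_mem_maximalAtlas (hmem c hc)).comp
        ((contMDiffOn_of_mem_maximalAtlas (IsManifold.subset_maximalAtlas hc)).mono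
          Set.inter_subset_left) fun y hy => by
          rw [OpenPartialHomeomorph.trans_target]
          refine ⟨c.map_source hy.1, ?_⟩
          rw [Set.mem_preimage, c.left_inv hy.1]
          exact hy.2
    refine ((h1.congr fun y hy => ?_).contMDiffAt
      ((c.open_source.inter e.open_target).mem_nhds ⟨hwc, hw⟩)).contMDiffWithinAt
    exact congrArg e.symm (c.left_inv hy.1).symm

end ChartedSpaceComp

section

variable {N n : ℕ} {V : Type v} [NormedAddCommGroup V] [NormedSpace ℝ V]
  {G : Type u} [Group G] [TopologicalSpace G] [ChartedSpace V G] [LieGroup 𝓘(ℝ, V) ∞ G]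

/-! ### Clutching -/

/-- `θ` is an equivariant transition function between product bundles around the two poles, on
which `SO(N)` acts through `α` and `β`. -/
structure IsClutching (α β : SmoothHom N V G) (θ : Sph N → G) : Prop where
  contMDiffOn : ContMDiffOn (𝓡 N) 𝓘(ℝ, V) ∞ θ ({northPole N}ᶜ ∩ {southPole N}ᶜ)
  smul : ∀ (A : SO N), ∀ x ∈ ({northPole N}ᶜ ∩ {southPole N}ᶜ : Set (Sph N)),
    θ (A • x) * β A = α A * θ x

/-- The sphere without the north pole (`false`) or without the south pole (`true`). -/
def Sph.cap (N : ℕ) : Bool → Set (Sph N)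
  | false => {northPole N}ᶜ
  | true => {southPole N}ᶜ

theorem Sph.isOpen_cap (i : Bool) : IsOpen (Sph.cap N i) := by
  cases i <;> exact isOpen_compl_singleton

theorem Sph.smul_mem_cap (A : SO N) {x : Sph N} {i : Bool} (hx : x ∈ Sph.cap N i) :
    A • x ∈ Sph.cap N i := by
  cases i
  · exact fun h => hx (by
      rw [Set.mem_singleton_iff] at h ⊢
      rw [← inv_smul_smul A x, h, smul_northPole])
  · exact fun h => hx (by
      rw [Set.mem_singleton_iff] at h ⊢
      rw [← inv_smul_smul A x, h, smul_southPole])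

namespace IsClutching

/-- The transition function to the southern product bundle. -/
def factor (θ : Sph N → G) (x : Sph N) : Bool → G
  | false => 1
  | true => θ x

/-- The homomorphism through which `SO(N)` acts on a product bundle. -/
def rep (α β : SmoothHom N V G) : Bool → SmoothHom N V G
  | false => α
  | true => β

variable {α β : SmoothHom N V G} {θ : Sph N → G}

theorem contMDiffOn_factor (h : IsClutching α β θ) (i j : Bool) :
    ContMDiffOn (𝓡 N) 𝓘(ℝ, V) ∞ (fun x => (factor θ x j)⁻¹ * factor θ x i)
      (Sph.cap N i ∩ Sph.cap N j) := by
  cases i <;> cases j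
  · simpa [factor] using contMDiffOn_const
  · simpa [factor, Sph.cap] using h.contMDiffOn.inv
  · simpa [factor, Set.inter_comm, Sph.cap] using h.contMDiffOn
  · simpa [factor] using contMDiffOn_const

theorem factor_smul (h : IsClutching α β θ) (A : SO N) {x : Sph N} {i j : Bool}
    (hi : x ∈ Sph.cap N i) (hj : x ∈ Sph.cap N j) :
    (factor θ (A • x) j)⁻¹ * factor θ (A • x) i * rep α β i A =
      rep α β j A * ((factor θ x j)⁻¹ * factor θ x i) := by
  cases i <;> cases j
  · simp [factor, rep]
  · have := h.smul A x ⟨hi, hj⟩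
    simp only [factor, rep, mul_one]
    rw [eq_mul_inv_iff_mul_eq, mul_assoc, ← this, inv_mul_cancel_left]
  · simpa [factor, rep] using h.smul A x ⟨hj, hi⟩
  · simp [factor, rep]

/-- The bundle glued from two product bundles. -/
def core (h : IsClutching α β θ) : FiberBundleCore Bool (Sph N) G where
  baseSet := Sph.cap N
  isOpen_baseSet := Sph.isOpen_cap
  -- The height is invariant under rotations, so the action preserves the choice of trivialization.
  indexAt x := decide (0 < Sph.height x)
  mem_baseSet_at x := by
    by_cases hx : 0 < Sph.height x
    · simp only [hx, decide_true, Sph.cap]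
      rintro rfl
      norm_num at hx
    · simp only [hx, decide_false, Sph.cap]
      rintro rfl
      norm_num at hx
  -- Quotients of functions indexed by one trivialization each satisfy the cocycle condition
  -- automatically.
  coordChange i j x g := (factor θ x j)⁻¹ * factor θ x i * g
  coordChange_self i x _ g := by simp
  continuousOn_coordChange i j := by
    have : IsTopologicalGroup G := topologicalGroup_of_lieGroup 𝓘(ℝ, V) ∞
    exact ((h.contMDiffOn_factor i j).continuousOn.comp continuousOn_fst fun p hp => hp.1).mul
      continuousOn_snd
  coordChange_comp i j k x _ g := by group

/-- The total space of the glued bundle. -/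
def Total (h : IsClutching α β θ) : Type u := Bundle.TotalSpace G h.core.Fiber

instance (h : IsClutching α β θ) : TopologicalSpace h.Total :=
  inferInstanceAs (TopologicalSpace (Bundle.TotalSpace G h.core.Fiber))

instance (h : IsClutching α β θ) : ChartedSpace (Sph N × G) h.Total :=
  inferInstanceAs (ChartedSpace (Sph N × G) (Bundle.TotalSpace G h.core.Fiber))

instance (h : IsClutching α β θ) :
    ChartedSpace (ModelProd (EuclideanSpace ℝ (Fin N)) V) h.Total :=
  ChartedSpace.comp _ (Sph N × G) _

/-- The projection of the glued bundle. -/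
def proj (h : IsClutching α β θ) : h.Total → Sph N := h.core.proj

/-- The local trivializations of the glued bundle. -/
def triv (h : IsClutching α β θ) (i : Bool) : Bundle.Trivialization G h.proj := h.core.localTriv i

/-- The point with given coordinates in the preferred trivialization. -/
def pt (h : IsClutching α β θ) (x : Sph N) (g : G) : h.Total := ⟨x, g⟩

/-- The fibre coordinate in the preferred trivialization. -/
def coord (h : IsClutching α β θ) (p : h.Total) : G := Bundle.TotalSpace.snd p

theorem pt_proj_coord (h : IsClutching α β θ) (p : h.Total) : h.pt (h.proj p) (h.coord p) = p := rfl

theorem proj_pt (h : IsClutching α β θ) (x : Sph N) (g : G) : h.proj (h.pt x g) = x := rfl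

theorem coord_pt (h : IsClutching α β θ) (x : Sph N) (g : G) : h.coord (h.pt x g) = g := rfl

/-- The index of the preferred trivialization. -/
def index (x : Sph N) : Bool := decide (0 < Sph.height x)

theorem index_smul (A : SO N) (x : Sph N) : index (A • x) = index x := by simp [index]

theorem mem_cap_index (h : IsClutching α β θ) (x : Sph N) : x ∈ Sph.cap N (index x) :=
  h.core.mem_baseSet_at x

theorem triv_apply (h : IsClutching α β θ) (i : Bool) (p : h.Total) :
    h.triv i p = (h.proj p,
      (factor θ (h.proj p) i)⁻¹ * factor θ (h.proj p) (index (h.proj p)) * h.coord p) := rfl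

theorem triv_symm_apply (h : IsClutching α β θ) (i : Bool) (q : Sph N × G) :
    (h.triv i).toOpenPartialHomeomorph.symm q =
      h.pt q.1 ((factor θ q.1 (index q.1))⁻¹ * factor θ q.1 i * q.2) := rfl

theorem mem_atlas_iff (h : IsClutching α β θ) {e : OpenPartialHomeomorph h.Total (Sph N × G)} :
    e ∈ atlas (Sph N × G) h.Total ↔ ∃ i, e = (h.triv i).toOpenPartialHomeomorph := by
  constructor
  · rintro ⟨_, ⟨i, rfl⟩, rfl⟩
    exact ⟨i, rfl⟩
  · rintro ⟨i, rfl⟩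
    exact ⟨_, ⟨i, rfl⟩, rfl⟩

instance isManifold (h : IsClutching α β θ) : IsManifold ((𝓡 N).prod 𝓘(ℝ, V)) ∞ h.Total := by
  refine isManifold_chartedSpace_comp (M₀ := Sph N × G) _ fun e he e' he' => ?_
  obtain ⟨i, rfl⟩ := h.mem_atlas_iff.1 he
  obtain ⟨j, rfl⟩ := h.mem_atlas_iff.1 he'
  have h1 : ContMDiffOn ((𝓡 N).prod 𝓘(ℝ, V)) ((𝓡 N).prod 𝓘(ℝ, V)) ∞
      (fun q : Sph N × G => (q.1, (factor θ q.1 j)⁻¹ * factor θ q.1 i * q.2))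
      ((Sph.cap N i ∩ Sph.cap N j) ×ˢ Set.univ) :=
    contMDiffOn_fst.prodMk (((h.contMDiffOn_factor i j).comp contMDiffOn_fst
      fun p hp => hp.1).mul contMDiffOn_snd)
  refine (h1.mono fun q hq => ?_).congr fun q hq => ?_
  · rw [OpenPartialHomeomorph.trans_source] at hq
    exact ⟨⟨hq.1.1, hq.2⟩, trivial⟩
  · change h.triv j ((h.triv i).toOpenPartialHomeomorph.symm q) = _
    rw [h.triv_symm_apply, h.triv_apply, h.proj_pt, h.coord_pt]
    refine Prod.ext rfl ?_
    group

theorem contMDiffOn_triv (h : IsClutching α β θ) (i : Bool) :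
    ContMDiffOn ((𝓡 N).prod 𝓘(ℝ, V)) ((𝓡 N).prod 𝓘(ℝ, V)) ∞ (h.triv i) (h.triv i).source :=
  (contMDiffOn_of_mem_atlas_comp _ h.isManifold (h.mem_atlas_iff.2 ⟨i, rfl⟩)).1

theorem contMDiffOn_triv_symm (h : IsClutching α β θ) (i : Bool) :
    ContMDiffOn ((𝓡 N).prod 𝓘(ℝ, V)) ((𝓡 N).prod 𝓘(ℝ, V)) ∞
      (h.triv i).toOpenPartialHomeomorph.symm (h.triv i).target :=
  (contMDiffOn_of_mem_atlas_comp _ h.isManifold (h.mem_atlas_iff.2 ⟨i, rfl⟩)).2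

instance rightAction (h : IsClutching α β θ) : MulAction Gᵐᵒᵖ h.Total where
  smul g p := h.pt (h.proj p) (h.coord p * g.unop)
  one_smul p := congrArg (h.pt (h.proj p)) (mul_one (h.coord p))
  mul_smul g g' p :=
    congrArg (h.pt (h.proj p)) (mul_assoc (h.coord p) g'.unop g.unop).symm

/-- Defined in the preferred fibre coordinate; associativity rests on the invariance of `index`. -/
instance leftAction (h : IsClutching α β θ) : MulAction (SO N) h.Total where
  smul A p := h.pt (A • h.proj p) (rep α β (index (h.proj p)) A * h.coord p)
  one_smul p := by
    change h.pt ((1 : SO N) • h.proj p) (rep α β (index (h.proj p)) 1 * h.coord p) = p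
    rw [one_smul, map_one, one_mul, h.pt_proj_coord]
  mul_smul A B p := by
    change h.pt ((A * B) • h.proj p) (rep α β (index (h.proj p)) (A * B) * h.coord p) =
      h.pt (A • B • h.proj p) (rep α β (index (B • h.proj p)) A *
        (rep α β (index (h.proj p)) B * h.coord p))
    rw [index_smul, mul_smul, map_mul, mul_assoc]

theorem triv_right (h : IsClutching α β θ) (i : Bool) (p : h.Total) (g : G) :
    h.triv i (p <• g) = ((h.triv i p).1, (h.triv i p).2 * g) :=
  Prod.ext rfl (mul_assoc _ (h.coord p) g).symm

/-- The equivariance of `θ` makes the action a product action in each trivialization and not only in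
the preferred one. Since the preferred index jumps at the equator, smoothness is deduced from this
form. -/
theorem triv_smul (h : IsClutching α β θ) {i : Bool} (A : SO N) {p : h.Total}
    (hp : h.proj p ∈ Sph.cap N i) :
    h.triv i (A • p) = (A • (h.triv i p).1, rep α β i A * (h.triv i p).2) := by
  refine Prod.ext rfl ?_
  change (factor θ (A • h.proj p) i)⁻¹ * factor θ (A • h.proj p) (index (A • h.proj p)) *
    (rep α β (index (h.proj p)) A * h.coord p) = rep α β i A *
      ((factor θ (h.proj p) i)⁻¹ * factor θ (h.proj p) (index (h.proj p)) * h.coord p)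
  rw [index_smul, ← mul_assoc, h.factor_smul A (h.mem_cap_index _) hp]
  simp only [mul_assoc]

theorem contMDiff_proj (h : IsClutching α β θ) :
    ContMDiff ((𝓡 N).prod 𝓘(ℝ, V)) (𝓡 N) ∞ h.proj := fun p =>
  ((contMDiff_fst.comp_contMDiffOn (h.contMDiffOn_triv _)).contMDiffAt
    ((h.triv (index (h.proj p))).open_source.mem_nhds (h.mem_cap_index _))).congr_of_eventuallyEq
      (Filter.Eventually.of_forall fun _ => rfl)

theorem isOpen_proj_preimage (h : IsClutching α β θ) (i : Bool) :
    IsOpen (h.proj ⁻¹' Sph.cap N i) := (h.triv i).open_source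

theorem contMDiff_right (h : IsClutching α β θ) :
    ContMDiff (((𝓡 N).prod 𝓘(ℝ, V)).prod 𝓘(ℝ, V)) ((𝓡 N).prod 𝓘(ℝ, V)) ∞
      (fun p : h.Total × G => p.1 <• p.2) := by
  intro p
  set i := index (h.proj p.1)
  have hopen : IsOpen (Prod.fst ⁻¹' (h.proj ⁻¹' Sph.cap N i) : Set (h.Total × G)) :=
    (h.isOpen_proj_preimage i).preimage continuous_fst
  have h1 : ContMDiffOn (((𝓡 N).prod 𝓘(ℝ, V)).prod 𝓘(ℝ, V)) ((𝓡 N).prod 𝓘(ℝ, V)) ∞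
      (fun q : h.Total × G => h.triv i q.1) (Prod.fst ⁻¹' (h.proj ⁻¹' Sph.cap N i)) :=
    (h.contMDiffOn_triv i).comp contMDiffOn_fst fun q hq => hq
  have h2 := (h.contMDiffOn_triv_symm i).comp
    ((contMDiff_fst.comp_contMDiffOn h1).prodMk
      ((contMDiff_snd.comp_contMDiffOn h1).mul contMDiffOn_snd)) fun q hq => ⟨hq, trivial⟩
  refine (h2.congr fun q hq => ?_).contMDiffAt (hopen.mem_nhds (h.mem_cap_index _))
  have := (h.triv i).left_inv (x := q.1 <• q.2) hq
  rw [Bundle.Trivialization.coe_coe, h.triv_right] at this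
  exact this.symm

theorem contMDiff_left (h : IsClutching α β θ) :
    ContMDiff (𝓘(ℝ, SO.Coord N).prod ((𝓡 N).prod 𝓘(ℝ, V))) ((𝓡 N).prod 𝓘(ℝ, V)) ∞
      (fun p : SO N × h.Total => p.1 • p.2) := by
  intro p
  set i := index (h.proj p.2)
  have hopen : IsOpen (Prod.snd ⁻¹' (h.proj ⁻¹' Sph.cap N i) : Set (SO N × h.Total)) :=
    (h.isOpen_proj_preimage i).preimage continuous_snd
  have h1 : ContMDiffOn (𝓘(ℝ, SO.Coord N).prod ((𝓡 N).prod 𝓘(ℝ, V))) ((𝓡 N).prod 𝓘(ℝ, V)) ∞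
      (fun q : SO N × h.Total => h.triv i q.2) (Prod.snd ⁻¹' (h.proj ⁻¹' Sph.cap N i)) :=
    (h.contMDiffOn_triv i).comp contMDiffOn_snd fun q hq => hq
  have h2 := (h.contMDiffOn_triv_symm i).comp
    ((Sph.contMDiff_smul.comp_contMDiffOn
      (contMDiffOn_fst.prodMk (contMDiff_fst.comp_contMDiffOn h1))).prodMk
      (((rep α β i).contMDiff_toFun.comp_contMDiffOn contMDiffOn_fst).mul
        (contMDiff_snd.comp_contMDiffOn h1))) fun q hq => ⟨Sph.smul_mem_cap q.1 hq, trivial⟩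
  refine (h2.congr fun q hq => ?_).contMDiffAt (hopen.mem_nhds (h.mem_cap_index _))
  have := (h.triv i).left_inv (x := q.1 • q.2) (Sph.smul_mem_cap q.1 hq)
  rw [Bundle.Trivialization.coe_coe, h.triv_smul q.1 hq] at this
  exact this.symm

/-- The equivariant bundle glued from two product bundles. -/
def bundle (h : IsClutching α β θ) : EquivBundle N V G where
  Total := h.Total
  proj := h.proj
  contMDiff_proj := h.contMDiff_proj
  contMDiff_right := h.contMDiff_right
  contMDiff_left := h.contMDiff_left
  proj_right _ _ := rfl
  proj_left _ _ := rfl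
  left_right_comm A p g :=
    congrArg (h.pt (A • h.proj p)) (mul_assoc (rep α β (index (h.proj p)) A) (h.coord p) g).symm
  locally_trivial x := ⟨h.triv (index x), h.mem_cap_index x, h.contMDiffOn_triv _,
    h.contMDiffOn_triv_symm _, fun z _ g => congrArg Prod.snd (h.triv_right _ z g)⟩

/-- The unit sections of the two product bundles. -/
def unitSection (h : IsClutching α β θ) (i : Bool) (x : Sph N) : h.bundle.Total :=
  (h.triv i).toOpenPartialHomeomorph.symm (x, 1)

theorem contMDiffOn_unitSection (h : IsClutching α β θ) (i : Bool) :
    ContMDiffOn (𝓡 N) ((𝓡 N).prod 𝓘(ℝ, V)) ∞ (h.unitSection i) (Sph.cap N i) :=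
  (h.contMDiffOn_triv_symm i).comp (contMDiffOn_id.prodMk contMDiffOn_const)
    fun _ hx => ⟨hx, trivial⟩

theorem proj_unitSection (h : IsClutching α β θ) (i : Bool) (x : Sph N) :
    h.bundle.proj (h.unitSection i x) = x := rfl

theorem triv_unitSection (h : IsClutching α β θ) {i : Bool} {x : Sph N} (hx : x ∈ Sph.cap N i) :
    h.triv i (h.unitSection i x) = (x, 1) :=
  (h.triv i).right_inv ⟨hx, trivial⟩

theorem smul_unitSection (h : IsClutching α β θ) {i : Bool} (A : SO N) {x : Sph N}
    (hx : x ∈ Sph.cap N i) :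
    A • h.unitSection i x = h.unitSection i (A • x) <• rep α β i A := by
  refine (h.triv i).injOn (Sph.smul_mem_cap A hx) (Sph.smul_mem_cap A hx) ?_
  refine (h.triv_smul A hx).trans (Eq.trans ?_ (h.triv_right i _ _).symm)
  rw [h.triv_unitSection hx, h.triv_unitSection (Sph.smul_mem_cap A hx), mul_one, one_mul]

theorem unitSection_true (h : IsClutching α β θ) (x : Sph N) :
    h.unitSection true x = h.unitSection false x <• θ x := by
  refine congrArg (h.pt x) ?_
  change (factor θ x (index x))⁻¹ * factor θ x true * 1 =
    (factor θ x (index x))⁻¹ * factor θ x false * 1 * θ x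
  simp [factor]

theorem isPolarSection (h : IsClutching α β θ) {i : Bool} {x₀ : Sph N} (hx₀ : x₀ ∈ Sph.cap N i) :
    h.bundle.IsPolarSection x₀ (rep α β i) (Sph.cap N i) (h.unitSection i) where
  isOpen := Sph.isOpen_cap i
  mem := hx₀
  smul_mem A _ hx := Sph.smul_mem_cap A hx
  contMDiffOn := h.contMDiffOn_unitSection i
  proj x _ := h.proj_unitSection i x
  smul A _ hx := h.smul_unitSection A hx

end IsClutching

theorem southPole_ne_northPole : southPole N ≠ northPole N := fun h => by
  have := congrArg Sph.height h
  norm_num at this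

theorem Sph.hor_dotProduct_ne_zero {x : Sph N} (h1 : x ≠ northPole N) (h2 : x ≠ southPole N) :
    Sph.hor x ⬝ᵥ Sph.hor x ≠ 0 := fun h =>
  ((Sph.hor_eq_zero_iff x).1 (dotProduct_self_eq_zero.1 h)).elim h2 h1

theorem Sph.meridian_mem_cap {t : ℝ} (ht : t ∈ Set.Ioo 0 Real.pi) (i : Bool) :
    Sph.meridian n t ∈ Sph.cap (n + 1) i := by
  have h1 := Real.cos_lt_cos_of_nonneg_of_le_pi le_rfl ht.2.le ht.1
  have h2 := Real.cos_lt_cos_of_nonneg_of_le_pi ht.1.le le_rfl ht.2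
  rw [Real.cos_zero] at h1
  rw [Real.cos_pi] at h2
  cases i
  · intro h
    have := congrArg Sph.height (Set.mem_singleton_iff.1 h)
    simp only [Sph.height_meridian, Sph.height_northPole] at this
    linarith
  · intro h
    have := congrArg Sph.height (Set.mem_singleton_iff.1 h)
    simp only [Sph.height_meridian, Sph.height_southPole] at this
    linarith

/-- The transition function with value `z` on the meridian. -/
def clutchMap (hn : 1 ≤ n) (α β : SmoothHom (n + 1) V G) (z : G) (x : Sph (n + 1)) : G :=
  α (EquivBundle.frame hn x) * z * (β (EquivBundle.frame hn x))⁻¹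

/-! ### The transition function of a centralizer element -/

section ClutchMap

variable (hn : 1 ≤ n) {α β : SmoothHom (n + 1) V G} {z : G}

/-- The choice of rotation is immaterial: two choices differ by an element of `SO(n)`, on which `α`
and `β` agree and with whose image `z` commutes. -/
theorem clutchMap_smul_meridian (hαβ : SmoothHom.res α = SmoothHom.res β)
    (hz : z ∈ SmoothHom.centralizer (SmoothHom.res α)) (A : SO (n + 1)) {t : ℝ}
    (ht : t ∈ Set.Ioo 0 Real.pi) :
    clutchMap hn α β z (A • Sph.meridian n t) = α A * z * (β A)⁻¹ := by
  rw [clutchMap]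
  set F := EquivBundle.frame hn (A • Sph.meridian n t) with hF
  have hF' : F • Sph.meridian n t = A • Sph.meridian n t := by
    have := EquivBundle.frame_smul hn (A • Sph.meridian n t)
    rwa [Sph.arccos_neg_height_smul_meridian A ⟨ht.1.le, ht.2.le⟩] at this
  have hC : (A⁻¹ * F) • Sph.meridian n t = Sph.meridian n t := by
    rw [mul_smul, hF', inv_smul_smul]
  obtain ⟨B, hB⟩ := Sph.exists_incl_of_smul_meridian_eq ht hC
  have hFB : F = A * SO.incl n B := by rw [hB, mul_inv_cancel_left]
  have h1 := SmoothHom.mem_centralizer_iff.1 hz B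
  have h2 : β (SO.incl n B) = α (SO.incl n B) :=
    (congrArg (fun γ : SmoothHom n V G => γ B) hαβ).symm
  rw [SmoothHom.res_apply] at h1
  rw [hFB, map_mul, map_mul, h2, mul_assoc (α A), h1]
  group

/-- Off the poles, the rotation in the formula may be replaced by a locally smooth one. -/
theorem isClutching_clutchMap (hαβ : SmoothHom.res α = SmoothHom.res β)
    (hz : z ∈ SmoothHom.centralizer (SmoothHom.res α)) :
    IsClutching α β (clutchMap hn α β z) where
  contMDiffOn x hx := by
    obtain ⟨U, f, hU, hxU, hf, -, hfU⟩ :=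
      Sph.exists_smooth_polar hn (Sph.hor_dotProduct_ne_zero hx.1 hx.2)
    have h1 : ContMDiffOn (𝓡 (n + 1)) 𝓘(ℝ, V) ∞ (fun y => α (f y) * z * (β (f y))⁻¹) U :=
      ((α.contMDiff_toFun.comp_contMDiffOn hf).mul contMDiffOn_const).mul
        (β.contMDiff_toFun.comp_contMDiffOn hf).inv
    refine ((h1.congr fun y hy => ?_).contMDiffAt (hU.mem_nhds hxU)).contMDiffWithinAt
    have := clutchMap_smul_meridian hn hαβ hz (f y) (hfU y hy).1
    rwa [(hfU y hy).2] at this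
  smul A x hx := by
    obtain ⟨U, f, -, hxU, -, -, hfU⟩ :=
      Sph.exists_smooth_polar hn (Sph.hor_dotProduct_ne_zero hx.1 hx.2)
    obtain ⟨ht, hy⟩ := hfU x hxU
    rw [← hy, ← mul_smul, clutchMap_smul_meridian hn hαβ hz _ ht,
      clutchMap_smul_meridian hn hαβ hz _ ht, map_mul, map_mul]
    group

/-- Along the meridian the two unit sections differ by the constant `z`, so one lift is adapted at
both ends and reaches the north pole as the northern unit section times `z⁻¹`. -/
theorem EquivBundle.hasType_clutchMap (hαβ : SmoothHom.res α = SmoothHom.res β)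
    (hz : z ∈ SmoothHom.centralizer (SmoothHom.res α)) :
    (isClutching_clutchMap hn hαβ hz).bundle.HasType α β z := by
  set h := isClutching_clutchMap hn hαβ hz
  -- The southern section is not controlled over the north pole, so the end value is taken from the
  -- northern one.
  set s : ℝ → h.bundle.Total := fun t => if t < Real.pi then
    h.unitSection false (Sph.meridian n t) else h.unitSection true (Sph.meridian n t) <• z⁻¹ with hs
  have hS : southPole (n + 1) ∈ Sph.cap (n + 1) false := southPole_ne_northPole
  have hN : northPole (n + 1) ∈ Sph.cap (n + 1) true := southPole_ne_northPole.symm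
  have hlt : ∀ t < Real.pi, s t = h.unitSection false (Sph.meridian n t) := fun t ht => if_pos ht
  have hpos : ∀ t, 0 < t → t ≤ Real.pi →
      s t = h.unitSection true (Sph.meridian n t) <• z⁻¹ := fun t h0 h1 => by
    rcases h1.lt_or_eq with h1 | rfl
    · have h2 := clutchMap_smul_meridian hn hαβ hz 1 ⟨h0, h1⟩
      rw [one_smul, map_one, map_one, one_mul, inv_one, mul_one] at h2
      rw [hlt t h1, h.unitSection_true, h2, ← h.bundle.right_mul, mul_inv_cancel,
        h.bundle.right_one]
    · exact if_neg (lt_irrefl _)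
  have hmer := Sph.contMDiff_meridian (n := n)
  refine ⟨β.conj z⁻¹, s, ⟨⟨?_, fun t ht => ?_, fun B t ht => ?_⟩, ?_, ?_⟩, ?_⟩
  · exact ((h.contMDiffOn_unitSection false).comp hmer.contMDiffOn
      fun t ht => Sph.meridian_mem_cap ht false).congr fun t ht => hlt t ht.2
  · rw [hlt t ht.2, h.proj_unitSection]
  · rw [hlt t ht.2, h.smul_unitSection _ (Sph.meridian_mem_cap ht false), Sph.incl_smul_meridian]
    rfl
  · refine ⟨_, _, h.isPolarSection hS, fun t ht htU => hlt t (ht.2.lt_of_ne ?_)⟩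
    rintro rfl
    exact htU (Sph.meridian_pi)
  · refine ⟨_, _, (h.isPolarSection hN).right z⁻¹, fun t ht htU =>
      hpos t (ht.1.lt_of_ne ?_) ht.2⟩
    rintro rfl
    exact htU (Sph.meridian_zero)
  · rw [hpos _ Real.pi_pos le_rfl, ← h.bundle.right_mul, inv_mul_cancel, h.bundle.right_one,
      Sph.meridian_pi]
    exact (h.isPolarSection hN).isIsotropyRep smul_northPole

end ClutchMap
end

section

variable {n : ℕ} {V : Type v} [NormedAddCommGroup V] [NormedSpace ℝ V]
  {G : Type u} [Group G] [TopologicalSpace G] [ChartedSpace V G] [LieGroup 𝓘(ℝ, V) ∞ G]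

/-! ### The classification -/

namespace CentralizerDoubleCosets

variable {α β : SmoothHom (n + 1) V G} {hβ : SmoothHom.res β = SmoothHom.res α}

/-- The double coset of an element of the centralizer of the common restriction. -/
def mk (hβ : SmoothHom.res β = SmoothHom.res α)
    (z : SmoothHom.centralizer (SmoothHom.res α)) :
    CentralizerDoubleCosets α β (SmoothHom.res α) rfl hβ :=
  Quotient.mk'' (ZerothHomotopy.mk z)

theorem mk_surjective : Function.Surjective (mk hβ) := by
  rintro ⟨⟨z⟩⟩
  exact ⟨z, rfl⟩

theorem mk_eq_mk_iff {z w : SmoothHom.centralizer (SmoothHom.res α)} :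
    mk hβ z = mk hβ w ↔ ∃ (u : SmoothHom.centralizer α) (v : SmoothHom.centralizer β),
      Joined w (Subgroup.inclusion (SmoothHom.centralizer_le_res α) u * z *
        Subgroup.inclusion (hβ ▸ SmoothHom.centralizer_le_res β) v) := by
  have : IsTopologicalGroup G := topologicalGroup_of_lieGroup 𝓘(ℝ, V) ∞
  refine (DoubleCoset.eq (pi0Inclusion (SmoothHom.centralizer_le_res α)).range
    (pi0Inclusion (H := SmoothHom.centralizer β) (K := SmoothHom.centralizer (SmoothHom.res α))
      (hβ ▸ SmoothHom.centralizer_le_res β)).range (.mk z) (.mk w)).trans ?_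
  constructor
  · rintro ⟨_, ⟨⟨u⟩, rfl⟩, _, ⟨⟨v⟩, rfl⟩, h⟩
    exact ⟨u, v, Quotient.exact h⟩
  · rintro ⟨u, v, h⟩
    exact ⟨_, ⟨.mk u, rfl⟩, _, ⟨.mk v, rfl⟩, Quotient.sound h⟩

end CentralizerDoubleCosets

namespace EquivBundle

variable {α β : SmoothHom (n + 1) V G} {ξ η : EquivBundle (n + 1) V G}

/-- Forward, two adapted lifts of one bundle are compared; backward, `z` is moved to `w` by the
permitted changes of lift and end points, after which the types are equal. -/
theorem HasType.iso_iff [FiniteDimensional ℝ V] (hn : 1 ≤ n)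
    (hβ : SmoothHom.res β = SmoothHom.res α)
    {z w : SmoothHom.centralizer (SmoothHom.res α)}
    (h : ξ.HasType α β z) (h' : η.HasType α β w) :
    ξ.Iso η ↔ CentralizerDoubleCosets.mk hβ z = CentralizerDoubleCosets.mk hβ w := by
  have : IsTopologicalGroup G := topologicalGroup_of_lieGroup 𝓘(ℝ, V) ∞
  rw [CentralizerDoubleCosets.mk_eq_mk_iff]
  constructor
  · intro hiso
    obtain ⟨u, v, k, huk, hk⟩ := (h.of_iso hiso).exists_joined h'
    refine ⟨u⁻¹, v, ?_⟩
    have h1 := ((Joined.refl (Subgroup.inclusion (SmoothHom.centralizer_le_res α) u)⁻¹).mul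
      huk).mul (Joined.refl w)
    convert h1 using 1
    · group
    · refine Subtype.ext ?_
      change (u.1)⁻¹ * z.1 * v.1 = (u.1)⁻¹ * k.1 * w.1
      rw [mul_assoc, hk, mul_assoc]
  · rintro ⟨u, v, huv⟩
    -- A change of starting point by `u` acts on types through `u⁻¹`, hence the inverse here.
    have h1 := h.mul_mul (u := u.1⁻¹) (inv_mem u.2) v.2
    rw [inv_inv] at h1
    refine (h1.of_joined (w := w.1) (Subgroup.mul_mem _ (Subgroup.mul_mem _ (Subgroup.mul_mem _
      (SmoothHom.centralizer_le_res α u.2) z.2) (hβ ▸ SmoothHom.centralizer_le_res β v.2))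
      (inv_mem w.2)) ?_).iso hn h'
    have h2 := huv.mul (Joined.refl w⁻¹)
    rwa [mul_inv_cancel] at h2

theorem exists_hasType_of_isotropyMap_eq [FiniteDimensional ℝ V]
    (hβ : SmoothHom.res β = SmoothHom.res α) {c : BundleClass (n + 1) V G}
    (hc : isotropyMap (n + 1) V G c = (RepClass.mk α, RepClass.mk β)) :
    ∃ (ξ : EquivBundle (n + 1) V G) (z : SmoothHom.centralizer (SmoothHom.res α)),
      Quotient.mk _ ξ = c ∧ ξ.HasType α β z := by
  obtain ⟨ξ, rfl⟩ := Quotient.exists_rep c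
  obtain ⟨z, hz⟩ := exists_hasType hc
  exact ⟨ξ, ⟨z, hz.mem_centralizer hβ.symm⟩, rfl, hz⟩

/-- Send a class to the double coset of the type of some representative. Injectivity is
`HasType.iso_iff`, surjectivity is clutching. -/
theorem nonempty_fiber_equiv [FiniteDimensional ℝ V] (hn : 1 ≤ n)
    (hβ : SmoothHom.res β = SmoothHom.res α) :
    Nonempty (isotropyMap (n + 1) V G ⁻¹' {(RepClass.mk α, RepClass.mk β)} ≃
      CentralizerDoubleCosets α β (SmoothHom.res α) rfl hβ) := by
  choose ξ z hξ hz using fun c : isotropyMap (n + 1) V G ⁻¹' {(RepClass.mk α, RepClass.mk β)} =>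
    exists_hasType_of_isotropyMap_eq hβ c.2
  refine ⟨Equiv.ofBijective (fun c => CentralizerDoubleCosets.mk hβ (z c)) ⟨fun c d hcd => ?_,
    fun q => ?_⟩⟩
  · refine Subtype.ext ?_
    rw [← hξ c, ← hξ d]
    exact Quotient.sound (((hz c).iso_iff hn hβ (hz d)).2 hcd)
  · obtain ⟨w, rfl⟩ := CentralizerDoubleCosets.mk_surjective q
    have hw := hasType_clutchMap hn hβ.symm w.2
    refine ⟨⟨Quotient.mk _ _, hw.isotropyMap_eq⟩, ((hz _).iso_iff hn hβ hw).1 ?_⟩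
    exact Quotient.exact (hξ ⟨Quotient.mk _ _, hw.isotropyMap_eq⟩)

theorem range_isotropyMap [FiniteDimensional ℝ V] (hn : 1 ≤ n) :
    Set.range (isotropyMap (n + 1) V G) =
      {p : RepClass (n + 1) V G × RepClass (n + 1) V G | p.1.res = p.2.res} := by
  ext ⟨a, b⟩
  constructor
  · rintro ⟨c, hc⟩
    obtain ⟨ξ, rfl⟩ := Quotient.exists_rep c
    obtain ⟨α, x, hx, hα⟩ := ξ.exists_isIsotropyRep_over _ smul_southPole
    obtain ⟨β, s, hs⟩ := ξ.exists_isAdapted hx hα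
    rw [hs.isotropyMap_eq] at hc
    obtain ⟨rfl, rfl⟩ := Prod.ext_iff.1 hc
    exact congrArg RepClass.mk hs.res_eq
  · intro hab
    obtain ⟨α, rfl⟩ := Quotient.exists_rep a
    obtain ⟨β, rfl⟩ := Quotient.exists_rep b
    obtain ⟨g, hg⟩ : ∃ g : G, ∀ A, SmoothHom.res β A = g * SmoothHom.res α A * g⁻¹ :=
      Quotient.exact hab
    -- Conjugating `β` makes the restrictions equal and not merely conjugate; clutching with `z = 1`
    -- then applies.
    have h1 : SmoothHom.res α = SmoothHom.res (β.conj g) := DFunLike.ext _ _ fun A => by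
      rw [SmoothHom.res_apply (β.conj g), SmoothHom.conj_apply, ← SmoothHom.res_apply, hg]
      group
    refine ⟨Quotient.mk _ _, (hasType_clutchMap hn h1 (one_mem _)).isotropyMap_eq.trans ?_⟩
    rw [RepClass.mk_conj]
    rfl

end EquivBundle
end

end

/-- The rotation group has rank `n + 1`, so that its subgroup is `SO(n)` and rank at least two reads
`1 ≤ n`. -/
theorem theoremB (n : ℕ) (hn : 1 ≤ n)
    {V : Type*} [NormedAddCommGroup V] [NormedSpace ℝ V] [FiniteDimensional ℝ V]
    {G : Type*} [Group G] [TopologicalSpace G] [ChartedSpace V G] [LieGroup 𝓘(ℝ, V) ∞ G] :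
    Set.range (isotropyMap (n + 1) V G) =
        {p : RepClass (n + 1) V G × RepClass (n + 1) V G | p.1.res = p.2.res} ∧
      ∀ (α β : SmoothHom (n + 1) V G) (γ : SmoothHom n V G)
        (hα : SmoothHom.res α = γ) (hβ : SmoothHom.res β = γ),
        Nonempty (isotropyMap (n + 1) V G ⁻¹' {(RepClass.mk α, RepClass.mk β)} ≃
          CentralizerDoubleCosets α β γ hα hβ) := by
  refine ⟨EquivBundle.range_isotropyMap hn, ?_⟩
  rintro α β γ rfl hβ
  exact EquivBundle.nonempty_fiber_equiv hn hβ
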